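/- Let $\mathcal G$ be a strip graph: a connected graph (loops and multiple edges allowed) embedded in $\mathbb R^2$, invariant under the translations $(x,y)\mapsto(x+k,y)$, $k\in\mathbb Z$, and with finite quotient $\mathcal G_1=\mathcal G/\mathbb Z$. Let $c>0$ be a translation-invariant conductance function on its edges, and let $m$ be the width of $\mathcal G$, i.e. the maximal number of pairwise vertex-disjoint bi-infinite paths in $\mathcal G$. For $z\in\mathbb C^*$ let $\Delta(z)$ be the Laplacian $\Delta f(v)=\sum_{w\sim v}c_{vw}(f(v)-f(w))$ acting on the functions $f$ on the vertices with $f(v+1)=zf(v)$, and let $P(z)=\det\Delta(z)$, a Laurent polynomial in $z$. Then $P$ has degree $m$ and exactly $m-1$ real roots larger than $1$, counted with multiplicity. Denote the latter by $1<\lambda_2\le\dots\le\lambda_m$, and let $C_m$ be the leading coefficient of $P$, i.e. the coefficient of $z^m$. For every $1\le j\le m$, the growth rate of the weighted sum of essential spanning forests of $\mathcal G$ with $j$ components is $$a_j=\log|C_m|+\sum_{i=j+1}^m\log\lambda_i .$$ Precisely, give a set of edges the product of the conductances of its edges as weight. An essential spanning forest (ESF) of $\mathcal G$ is a set of edges each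 of whose components (on the full vertex set) is an infinite tree. (i) Let $Z_j(n)$ be the weighted sum of all the configurations $F\cap W_n$, where $W_n$ is the set of edges in $n$ consecutive translates of a fundamental domain and $F$ runs over the ESFs of $\mathcal G$ with exactly $j$ components, all of them bi-infinite (unbounded in both directions of the strip); each configuration is counted once. Then $Z_j(n)>0$ for all large $n$ and $\frac1n\log Z_j(n)\to a_j$ as $n\to\infty$. (ii) Let $N_j(n)$ be the weighted sum of the cycle-rooted spanning forests (sets of edges each of whose components has as many edges as vertices) of $\mathcal G_n=\mathcal G/n\mathbb Z$ with exactly $j$ components, each winding once around the cylinder. Then $N_j(n)>0$ for all large $n$ and $\frac1n\log N_j(n)\to a_j$ as $n\to\infty$. -/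

import Mathlib

noncomputable section

/-- A multigraph (loops and parallel edges allowed) with vertex set `V` and edge set `E`.  Every edge
comes with an arbitrary orientation, from `src` to `tgt`, used only to name its two ends. -/
structure EdgeGraph (V E : Type*) where
  src : E → V
  tgt : E → V

namespace EdgeGraph

variable {V E : Type*}

/-- The graph on all the vertices formed by the edges in `F`, as far as connectivity is concerned
(loops and multiplicities are forgotten). -/
def spanned (H : EdgeGraph V E) (F : Set E) : SimpleGraph V :=
  SimpleGraph.fromRel fun u v => ∃ e ∈ F, H.src e = u ∧ H.tgt e = v

/-- `F` has no cycles: each edge of `F` is a bridge of `F` (so `F` has no loops, and no two parallel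
edges). -/
def IsForest (H : EdgeGraph V E) (F : Set E) : Prop :=
  ∀ e ∈ F, ¬ (H.spanned (F \ {e})).Reachable (H.src e) (H.tgt e)

/-- The number of components of `F`; isolated vertices are components. -/
def numComponents (H : EdgeGraph V E) (F : Set E) : ℕ :=
  Nat.card (H.spanned F).ConnectedComponent

/-- Essential spanning forest: every component is an infinite tree. -/
def IsESF (H : EdgeGraph V E) (F : Set E) : Prop :=
  H.IsForest F ∧ ∀ K : (H.spanned F).ConnectedComponent, K.supp.Infinite

/-- Cycle-rooted spanning forest of a finite graph: every component has as many vertices as edges. -/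
def IsCRSF (H : EdgeGraph V E) (F : Set E) : Prop :=
  ∀ K : (H.spanned F).ConnectedComponent, {e ∈ F | H.src e ∈ K.supp}.ncard = K.supp.ncard

end EdgeGraph

/-- A graph `𝒢` with a free action of `ℤ` and finitely many orbits, described through a fundamental
domain.  `V` and `E` are the vertices and edges of the quotient `𝒢₁ = 𝒢/ℤ`; the vertices of `𝒢` are
the pairs `(v, k) : V × ℤ`, its edges the pairs `(e, k) : E × ℤ`, translation by `1` adds `1` to
`k`, and the edge `(e, k)` joins `(src e, k)` to `(tgt e, k + shift e)`. -/
structure PeriodicGraph (V E : Type*) where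
  src : E → V
  tgt : E → V
  shift : E → ℤ

namespace PeriodicGraph

variable {V E : Type*}

/-- The infinite graph `𝒢`. -/
def cover (G : PeriodicGraph V E) : EdgeGraph (V × ℤ) (E × ℤ) where
  src x := (G.src x.1, x.2)
  tgt x := (G.tgt x.1, x.2 + G.shift x.1)

/-- The quotient `𝒢_n = 𝒢/nℤ` (for `n ≥ 1`). -/
def quotient (G : PeriodicGraph V E) (n : ℕ) : EdgeGraph (V × ZMod n) (E × ZMod n) where
  src x := (G.src x.1, x.2)
  tgt x := (G.tgt x.1, x.2 + (G.shift x.1 : ZMod n))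

/-- An embedding of `𝒢` in the plane, equivariant for the translations `(x, y) ↦ (x + k, y)`: the
vertex `(v, k)` is drawn at `pt v + (k, 0)`, and the edge `(e, k)` as the arc `arc e + (k, 0)`. -/
structure PlanarEmbedding (G : PeriodicGraph V E) where
  pt : V → ℝ × ℝ
  arc : ∀ e, Path (pt (G.src e)) (pt (G.tgt e) + ((G.shift e : ℝ), 0))
  vertex_injective : ∀ (v v' : V) (k k' : ℤ),
    pt v + ((k : ℝ), 0) = pt v' + ((k' : ℝ), 0) → v = v' ∧ k = k'
  interior_injective : ∀ (e e' : E) (k k' : ℤ) (t t' : unitInterval),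
    t ∈ Set.Ioo 0 1 → t' ∈ Set.Ioo 0 1 →
    arc e t + ((k : ℝ), 0) = arc e' t' + ((k' : ℝ), 0) → e = e' ∧ k = k' ∧ t = t'
  interior_avoids_vertices : ∀ (e : E) (v : V) (k k' : ℤ) (t : unitInterval),
    t ∈ Set.Ioo 0 1 → arc e t + ((k : ℝ), 0) ≠ pt v + ((k' : ℝ), 0)

/-- A (connected) strip graph: `𝒢` is connected and has a translation-invariant embedding in the
plane.  Finiteness of the quotient is imposed by `Fintype V` and `Fintype E`. -/
def IsStripGraph (G : PeriodicGraph V E) : Prop :=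
  (G.cover.spanned Set.univ).Connected ∧ Nonempty G.PlanarEmbedding

/-- There are `k` pairwise vertex-disjoint bi-infinite (simple) paths in `𝒢`. -/
def HasDisjointPaths (G : PeriodicGraph V E) (k : ℕ) : Prop :=
  ∃ p : Fin k → ℤ → V × ℤ,
    (∀ a i, (G.cover.spanned Set.univ).Adj (p a i) (p a (i + 1))) ∧
    Function.Injective fun x : Fin k × ℤ => p x.1 x.2

/-- The width: the maximal number of pairwise vertex-disjoint bi-infinite paths in `𝒢`. -/
def width (G : PeriodicGraph V E) : ℕ := sSup {k | G.HasDisjointPaths k}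

/-! ### The characteristic polynomial -/

open LaurentPolynomial in
/-- The matrix of `d(z)` on `z`-periodic functions `f(v, k) = z ^ k f(v, 0)`; `z` is `T 1`. -/
def dMatrix [DecidableEq V] (G : PeriodicGraph V E) : Matrix E V (LaurentPolynomial ℝ) :=
  Matrix.of fun e v =>
    (if v = G.tgt e then T (G.shift e) else 0) - (if v = G.src e then 1 else 0)

/-- `Δ(z) = d(1/z)^* C d(z)`, where `C` is the diagonal matrix of conductances. -/
def laplacian [DecidableEq V] [Fintype E] [DecidableEq E] (G : PeriodicGraph V E) (c : E → ℝ) :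
    Matrix V V (LaurentPolynomial ℝ) :=
  (G.dMatrix.map LaurentPolynomial.invert).transpose *
    Matrix.diagonal (fun e => LaurentPolynomial.C (c e)) * G.dMatrix

/-- `P(z) = det Δ(z)`. -/
def charPoly [Fintype V] [DecidableEq V] [Fintype E] [DecidableEq E] (G : PeriodicGraph V E)
    (c : E → ℝ) : LaurentPolynomial ℝ :=
  (G.laplacian c).det

end PeriodicGraph

namespace LaurentPolynomial

/-- The polynomial `z ^ N f(z)`, where `-N` is the lowest exponent that occurs in `f`. -/
def numerator (f : LaurentPolynomial ℝ) : Polynomial ℝ :=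
  trunc (f * T (-sInf (f.coeff.support : Set ℤ)))

/-- The real roots of `f` larger than `1`, with multiplicity, in increasing order. -/
def rootsAboveOne (f : LaurentPolynomial ℝ) : List ℝ :=
  (f.numerator.roots.filter fun x => 1 < x).sort (· ≤ ·)

/-- The root `λ_i` for `i ≥ 2`, where `λ_2 ≤ λ_3 ≤ …` are the real roots of `f` larger than `1`. -/
def lam (f : LaurentPolynomial ℝ) (i : ℕ) : ℝ := f.rootsAboveOne.getD (i - 2) 0

end LaurentPolynomial

namespace PeriodicGraph

variable {V E : Type*}

/-! ### Weighted sums and growth rates -/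

/-- The weighted sum of a (finite) set of edge configurations, the weight of a configuration being
the product of the conductances of its edges.  In `E × R` the first coordinate is the image of the
edge in `𝒢₁`. -/
def weightedSum {R : Type*} (c : E → ℝ) (S : Set (Set (E × R))) : ℝ :=
  ∑ᶠ ω ∈ S, ∏ᶠ x ∈ ω, c x.1

/-- The essential spanning forests of `𝒢` with `j` components, all of them bi-infinite, i.e.
extending to infinity in both directions of the strip. -/
def esf (G : PeriodicGraph V E) (j : ℕ) : Set (Set (E × ℤ)) :=
  {F | G.cover.IsESF F ∧ G.cover.numComponents F = j ∧
    ∀ (K : (G.cover.spanned F).ConnectedComponent) (N : ℤ),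
      (∃ x ∈ K.supp, x.2 ≤ N) ∧ (∃ x ∈ K.supp, N ≤ x.2)}

/-- The edges in a window of length `n`, i.e. in `n` consecutive fundamental domains. -/
def window (E : Type*) (n : ℕ) : Set (E × ℤ) := {x | 0 ≤ x.2 ∧ x.2 < n}

/-- The weighted sum of the configurations that the forests in `esf j` show in a window of length
`n`. -/
def windowSum (G : PeriodicGraph V E) (c : E → ℝ) (j n : ℕ) : ℝ :=
  weightedSum c ((fun F => F ∩ window E n) '' G.esf j)

/-- The `nℤ`-periodic subset of the edges of `𝒢` above a set of edges of `𝒢_n`. -/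
def lift (n : ℕ) (F : Set (E × ZMod n)) : Set (E × ℤ) := {x | (x.1, (x.2 : ZMod n)) ∈ F}

/-- The cycle-rooted spanning forests of `𝒢_n` with `j` components, each winding once around the
cylinder: a component winds once iff it contains a closed path that lifts to a path from
`(v, k)` to `(v, k + n)`. -/
def crsf (G : PeriodicGraph V E) (j n : ℕ) : Set (Set (E × ZMod n)) :=
  {F | (G.quotient n).IsCRSF F ∧ (G.quotient n).numComponents F = j ∧
    ∀ (v : V) (k : ℤ), (G.cover.spanned (lift n F)).Reachable (v, k) (v, k + n)}

/-- The weighted sum of the cycle-rooted spanning forests in `crsf j n`. -/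
def crsfSum (G : PeriodicGraph V E) (c : E → ℝ) (j n : ℕ) : ℝ :=
  weightedSum c (G.crsf j n)

end PeriodicGraph

/-- `Z n` is positive for large `n`, and `(1/n) log (Z n) → a`. -/
def HasGrowthRate (Z : ℕ → ℝ) (a : ℝ) : Prop :=
  (∀ᶠ n in Filter.atTop, 0 < Z n) ∧
    Filter.Tendsto (fun n : ℕ => Real.log (Z n) / n) Filter.atTop (nhds a)

end

noncomputable section

open scoped Classical

set_option linter.unusedSectionVars false

/-! ### Connectivity of edge sets in multigraphs -/

namespace EdgeGraph

variable {V E V' E' X : Type*}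

/-! Planarity enters through a single property, `Annular`: a component of a set of edges that winds
around the cylinder contains a closed path winding exactly once. Indeed, a path from the top to the
bottom of the translated component must cross a long horizontal path of the component itself. The
property holds for 𝒢₁ and for every 𝒢_n, seen as a quotient of 𝒢 by nℤ (`power`).

Matrix-tree theorem. By Cauchy–Binet, P(z) is a sum over the sets F of |V| edges of the weight of F
times a minor of d(z) times its image under z ↦ 1/z. The minor is ±z^k (z - 1)^(number of components
of F) if every component of F winds, and 0 otherwise. Hence P(z) = Q(2 - z - 1/z), where the
coefficient of x^j in Q is the weighted sum of the cycle-rooted spanning forests (CRSFs) of 𝒢₁ with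
j components, each winding once (`charPoly_eq`). The same holds for 𝒢_n with a polynomial Q_n, so
N_j(n) is a coefficient of Q_n. The Floquet decomposition, a product over n-th roots of unity, shows
that a root 2 - r - 1/r of Q becomes the root 2 - r^n - r^(-n) of Q_n
(`forestPolyPower_map_eq_prod`).

Location of the roots. All roots of Q are in (-∞, 0] (`forestPoly_root_nonpos`). Since Q_n has
nonnegative coefficients and a degree independent of n, it has no root near the positive ray. A root
α of P near the positive ray but not on it would have a power α^n near the negative ray, and then 2
- α^n - α^(-n) would be a root of Q_n near the positive ray. So the roots of P in a fixed sector
around the positive ray lie on the ray. The conductances are deformed from a degenerate choice, for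
which the coefficients of Q decrease so fast that sign changes exhibit all the roots; during the
deformation no root can leave the ray. The root 0 of Q is simple because some CRSF has one
component. Therefore Q = |C_m| x ∏ (x + λ_i + 1/λ_i - 2), and the coefficients of Q_n are |C_m|^n
times elementary symmetric functions of the numbers λ_i^n + λ_i^(-n) - 2, dominated by the product
of the largest ones.

Width. The degree of Q is the maximal number of components of such a CRSF of 𝒢₁, and equally of 𝒢_n.
Components yield disjoint bi-infinite paths. Conversely, k disjoint paths are turned into a flow; by
pigeonhole it has the same local state at two places and closes up to a permutation of the vertices
of some 𝒢_n with total winding k. Its cycles wind at most once, so at least k of them wind, and they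
extend to a CRSF with at least k components (`width_eq_maxComponents`).

Essential spanning forests. The lift of a CRSF to 𝒢 is an essential spanning forest, which gives the
lower bound. For the upper bound, an essential spanning forest with j bi-infinite components carries
a flow of strength j. A piece of it between two equal states differs by a bounded number of edges
from a CRSF with at least j components, at the cost of a polynomial factor. Cutting a window at last
returns leaves a bounded number of such pieces (`exists_windowSum_le`). -/

theorem spanned_adj (H : EdgeGraph V E) {F : Set E} {u v : V} :
    (H.spanned F).Adj u v ↔ u ≠ v ∧ ∃ e ∈ F,
      (H.src e = u ∧ H.tgt e = v) ∨ (H.src e = v ∧ H.tgt e = u) := by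
  simp only [spanned, SimpleGraph.fromRel_adj]
  refine and_congr_right fun _ => ⟨?_, ?_⟩
  · rintro (⟨e, he, h⟩ | ⟨e, he, h⟩)
    exacts [⟨e, he, Or.inl h⟩, ⟨e, he, Or.inr h⟩]
  · rintro ⟨e, he, h | h⟩
    exacts [Or.inl ⟨e, he, h⟩, Or.inr ⟨e, he, h⟩]

theorem reachable_edge (H : EdgeGraph V E) {F : Set E} {e : E} (he : e ∈ F) :
    (H.spanned F).Reachable (H.src e) (H.tgt e) := by
  by_cases h : H.src e = H.tgt e
  · rw [h]
  · exact (H.spanned_adj.2 ⟨h, e, he, Or.inl ⟨rfl, rfl⟩⟩).reachable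

/-- Reachability is the smallest equivalence relation that relates the two ends of each edge. -/
theorem rel_of_reachable (H : EdgeGraph V E) {F : Set E} {r : V → V → Prop} (hr : Equivalence r)
    (h : ∀ e ∈ F, r (H.src e) (H.tgt e)) {u v : V} (huv : (H.spanned F).Reachable u v) :
    r u v := by
  obtain ⟨p⟩ := huv
  induction p with
  | nil => exact hr.refl _
  | cons hadj _ ih =>
    obtain ⟨-, e, he, ⟨rfl, rfl⟩ | ⟨rfl, rfl⟩⟩ := H.spanned_adj.1 hadj
    · exact hr.trans (h e he) ih
    · exact hr.trans (hr.symm (h e he)) ih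

theorem reachable_map (H : EdgeGraph V E) (H' : EdgeGraph V' E') {F : Set E} {F' : Set E'}
    (f : V → V')
    (h : ∀ e ∈ F, (H'.spanned F').Reachable (f (H.src e)) (f (H.tgt e))) {u v : V}
    (huv : (H.spanned F).Reachable u v) : (H'.spanned F').Reachable (f u) (f v) :=
  H.rel_of_reachable (r := fun a b => (H'.spanned F').Reachable (f a) (f b))
    ⟨fun _ => .refl _, fun h => h.symm, fun h h' => h.trans h'⟩ h huv

theorem eq_of_reachable (H : EdgeGraph V E) {F : Set E} (ψ : V → X)
    (h : ∀ e ∈ F, ψ (H.src e) = ψ (H.tgt e)) {u v : V}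
    (huv : (H.spanned F).Reachable u v) : ψ u = ψ v :=
  H.rel_of_reachable (r := fun a b => ψ a = ψ b)
    ⟨fun _ => rfl, fun h => h.symm, fun h h' => h.trans h'⟩ h huv

theorem reachable_mono (H : EdgeGraph V E) {F F' : Set E} (h : F ⊆ F') {u v : V}
    (huv : (H.spanned F).Reachable u v) : (H.spanned F').Reachable u v :=
  H.reachable_map H id (fun _ he => H.reachable_edge (h he)) huv

end EdgeGraph

/-! ### Winding, and the kernel of d(z) on a set of edges -/

namespace PeriodicGraph

variable {V E : Type*} (H : PeriodicGraph V E)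

/-- The quotient `𝒢/ℤ`. -/
def base : EdgeGraph V E where
  src := H.src
  tgt := H.tgt

/-- The graph on the vertices of `𝒢` formed by the edges above `F`. -/
abbrev coverGraph (F : Set E) : SimpleGraph (V × ℤ) := H.cover.spanned (Prod.fst ⁻¹' F)

/-- Each component of `F` contains a closed path that winds once around the cylinder. -/
def Winds (F : Set E) : Prop := ∀ v, (H.coverGraph F).Reachable (v, 0) (v, 1)

/-- A component of a set of edges that contains a path that winds around the cylinder contains a
closed path that winds once. -/
def Annular : Prop :=
  ∀ (F : Set E) (v : V) (g : ℤ), 1 ≤ g → (H.coverGraph F).Reachable (v, 0) (v, g) →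
    (H.coverGraph F).Reachable (v, 0) (v, 1)

variable {H}

theorem reachable_translate {F : Set E} {v w : V} {k l : ℤ}
    (h : (H.coverGraph F).Reachable (v, k) (w, l)) (t : ℤ) :
    (H.coverGraph F).Reachable (v, k + t) (w, l + t) := by
  refine H.cover.reachable_map H.cover (fun x : V × ℤ => (x.1, x.2 + t)) ?_ h
  rintro ⟨e, j⟩ he
  have := H.cover.reachable_edge (F := Prod.fst ⁻¹' F) (e := (e, j + t)) he
  simpa [cover, add_right_comm] using this

theorem reachable_base {F : Set E} {x y : V × ℤ} (h : (H.coverGraph F).Reachable x y) :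
    (H.base.spanned F).Reachable x.1 y.1 :=
  H.cover.reachable_map H.base Prod.fst (fun e he => H.base.reachable_edge (e := e.1) he) h

theorem exists_reachable_lift {F : Set E} {v w : V} (h : (H.base.spanned F).Reachable v w) :
    ∀ k, ∃ l, (H.coverGraph F).Reachable (v, k) (w, l) := by
  refine H.base.rel_of_reachable (r := fun v w => ∀ k, ∃ l, (H.coverGraph F).Reachable (v, k) (w, l))
    ⟨fun v k => ⟨k, .refl _⟩, fun {v w} h k => ?_, fun {u v w} h h' k => ?_⟩ ?_ h
  · obtain ⟨l, hl⟩ := h 0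
    refine ⟨k - l, ?_⟩
    simpa using (reachable_translate hl (k - l)).symm
  · obtain ⟨l, hl⟩ := h k
    obtain ⟨l', hl'⟩ := h' l
    exact ⟨l', hl.trans hl'⟩
  · intro e he k
    exact ⟨k + H.shift e, H.cover.reachable_edge (F := Prod.fst ⁻¹' F) (e := (e, k)) he⟩

theorem Winds.reachable_add_one {F : Set E} (h : H.Winds F) (v : V) (k : ℤ) :
    (H.coverGraph F).Reachable (v, k) (v, k + 1) := by
  simpa [add_comm] using reachable_translate (h v) k

theorem Winds.reachable {F : Set E} (h : H.Winds F) (v : V) (k l : ℤ) :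
    (H.coverGraph F).Reachable (v, k) (v, l) := by
  have key : ∀ (n : ℕ) (k : ℤ), (H.coverGraph F).Reachable (v, k) (v, k + n) := by
    intro n
    induction n with
    | zero => intro k; simp
    | succ n ih =>
      intro k
      have := (ih k).trans (h.reachable_add_one v (k + n))
      simpa [add_assoc] using this
  rcases le_total k l with hkl | hkl
  · have := key (l - k).toNat k
    rwa [Int.toNat_of_nonneg (by omega), add_sub_cancel] at this
  · have := key (k - l).toNat l
    rw [Int.toNat_of_nonneg (by omega), add_sub_cancel] at this
    exact this.symm

/-- When every component winds once, a whole fibre of the cover lies in one component, so the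
components above correspond to those below. -/
theorem Winds.reachable_iff {F : Set E} (h : H.Winds F) {x y : V × ℤ} :
    (H.coverGraph F).Reachable x y ↔ (H.base.spanned F).Reachable x.1 y.1 := by
  refine ⟨reachable_base, fun hxy => ?_⟩
  obtain ⟨l, hl⟩ := exists_reachable_lift hxy x.2
  exact hl.trans (h.reachable _ _ _)

section Incidence

variable {R S : Type*} [CommRing R] [CommRing S] [DecidableEq V]

/-- The matrix of `d(z)` over an arbitrary commutative ring. -/
def incidence (H : PeriodicGraph V E) (z : Rˣ) : Matrix E V R :=
  Matrix.of fun e v =>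
    (if v = H.tgt e then ((z ^ H.shift e : Rˣ) : R) else 0) - (if v = H.src e then 1 else 0)

theorem incidence_mulVec [Fintype V] (z : Rˣ) (f : V → R) (e : E) :
    (H.incidence z).mulVec f e = ((z ^ H.shift e : Rˣ) : R) * f (H.tgt e) - f (H.src e) := by
  simp [Matrix.mulVec, dotProduct, incidence, sub_mul, Finset.sum_sub_distrib]

theorem incidence_map (z : Rˣ) (φ : R →+* S) :
    (H.incidence z).map φ = H.incidence (Units.map (φ : R →* S) z) := by
  ext e v
  simp only [incidence, Matrix.map_apply, Matrix.of_apply, map_sub]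
  congr 1
  · split_ifs
    · rw [← map_zpow, Units.coe_map]; rfl
    · simp
  · split_ifs <;> simp

/-- A function in the kernel of `d(z)` is constant along the paths of the cover once it is extended
to a `z`-periodic function. -/
theorem zpow_mul_eq_of_reachable [Fintype V] {z : Rˣ} {F : Set E} {f : V → R}
    (hf : ∀ e ∈ F, (H.incidence z).mulVec f e = 0) {x y : V × ℤ}
    (h : (H.coverGraph F).Reachable x y) :
    ((z ^ x.2 : Rˣ) : R) * f x.1 = ((z ^ y.2 : Rˣ) : R) * f y.1 := by
  refine H.cover.eq_of_reachable (fun x : V × ℤ => ((z ^ x.2 : Rˣ) : R) * f x.1) ?_ h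
  rintro ⟨e, k⟩ he
  have := hf e he
  rw [incidence_mulVec, sub_eq_zero] at this
  simp only [cover]
  rw [← this, zpow_add, Units.val_mul, mul_assoc]

/-- The z-periodic extension of `f` is constant along paths, yet one turn around the cylinder
multiplies it by z. Hence (z - 1) f = 0. -/
theorem Winds.eq_zero_of_incidence {K : Type*} [Field K] [Fintype V] {z : Kˣ} (hz : (z : K) ≠ 1)
    {F : Set E} (hF : H.Winds F) {f : V → K}
    (hf : ∀ e ∈ F, (H.incidence z).mulVec f e = 0) : f = 0 := by
  funext v
  have := zpow_mul_eq_of_reachable hf (hF v)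
  simp only [zpow_zero, Units.val_one, one_mul, zpow_one] at this
  have h2 : ((z : K) - 1) * f v = 0 := by rw [sub_mul, one_mul, ← this, sub_self]
  simpa [sub_eq_zero, hz] using h2

/-- If some component of `F` carries no winding path, `d(z)` has a kernel over `F`. -/
theorem exists_kernel_of_not_winds [Fintype V] [Nontrivial R] (hH : H.Annular) {F : Set E}
    (hF : ¬ H.Winds F) (z : Rˣ) :
    ∃ f : V → R, f ≠ 0 ∧ ∀ e ∈ F, (H.incidence z).mulVec f e = 0 := by
  simp only [Winds, not_forall] at hF
  obtain ⟨v, hv⟩ := hF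
  have hloop : ∀ g : ℤ, (H.coverGraph F).Reachable (v, 0) (v, g) → g = 0 := by
    intro g hg
    rcases lt_trichotomy g 0 with h | h | h
    · refine absurd (hH F v (-g) (by omega) ?_) hv
      simpa using (reachable_translate hg (-g)).symm
    · exact h
    · exact absurd (hH F v g (by omega) hg) hv
  have huniq : ∀ (w : V) (k l : ℤ), (H.coverGraph F).Reachable (v, 0) (w, k) →
      (H.coverGraph F).Reachable (v, 0) (w, l) → k = l := by
    intro w k l hk hl
    have h3 := (reachable_translate hk (l - k))
    simp only [add_sub_cancel, zero_add] at h3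
    have := hloop (l - k) (hl.trans h3.symm)
    omega
  let f : V → R := fun w => if h : ∃ k, (H.coverGraph F).Reachable (v, 0) (w, k) then
    ((z ^ (-(h.choose)) : Rˣ) : R) else 0
  have hfk : ∀ w k, (H.coverGraph F).Reachable (v, 0) (w, k) → f w = ((z ^ (-k) : Rˣ) : R) := by
    intro w k hk
    have h : ∃ k, (H.coverGraph F).Reachable (v, 0) (w, k) := ⟨k, hk⟩
    simp only [f, dif_pos h]
    rw [huniq w _ _ h.choose_spec hk]
  refine ⟨f, fun h0 => ?_, fun e he => ?_⟩
  · have := hfk v 0 (.refl _)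
    simp [h0] at this
  · rw [incidence_mulVec, sub_eq_zero]
    have hedge : ∀ k, (H.coverGraph F).Reachable (H.src e, k) (H.tgt e, k + H.shift e) :=
      fun k => H.cover.reachable_edge (F := Prod.fst ⁻¹' F) (e := (e, k)) he
    by_cases h : ∃ k, (H.coverGraph F).Reachable (v, 0) (H.src e, k)
    · obtain ⟨k, hk⟩ := h
      rw [hfk _ _ hk, hfk _ _ (hk.trans (hedge k)), ← Units.val_mul, ← zpow_add]
      congr 2; ring
    · have h' : ¬ ∃ k, (H.coverGraph F).Reachable (v, 0) (H.tgt e, k) := by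
        rintro ⟨k, hk⟩
        refine h ⟨k - H.shift e, hk.trans ?_⟩
        simpa using (hedge (k - H.shift e)).symm
      simp only [f, dif_neg h, dif_neg h', mul_zero]

end Incidence

end PeriodicGraph

/-! ### Cauchy–Binet, and determinants that are units -/

namespace Matrix

variable {m n R : Type*} [Fintype m] [DecidableEq m] [Fintype n] [DecidableEq n] [CommRing R]

theorem det_mul_eq_sum_fun (A : Matrix m n R) (B : Matrix n m R) :
    (A * B).det = ∑ p : m → n, (∏ i, A i (p i)) * (B.submatrix p id).det := by
  have h1 : A * B = fun i => ∑ j, A i j • B j := by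
    ext i k
    simp [mul_apply, Finset.sum_apply]
  have h2 := (detRowAlternating (n := m) (R := R)).toMultilinearMap.map_sum
    (fun i (j : n) => A i j • B j)
  have h3 : (A * B).det = detRowAlternating (n := m) (R := R) (A * B) := rfl
  rw [h3, h1]
  refine h2.trans (Finset.sum_congr rfl fun p _ => ?_)
  exact (detRowAlternating (n := m) (R := R)).toMultilinearMap.map_smul_univ
    (fun i => A i (p i)) (fun i => B (p i))

/-- The Cauchy–Binet formula; `t F` is the product of the minors on the index set `F`. -/
theorem det_mul_eq_sum_powersetCard (A : Matrix m n R) (B : Matrix n m R)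
    (t : Finset n → R)
    (ht : ∀ φ : m → n, Function.Injective φ → t (Finset.univ.image φ) =
      (A.submatrix id φ).det * (B.submatrix φ id).det) :
    (A * B).det = ∑ F ∈ Finset.univ.powersetCard (Fintype.card m), t F := by
  rw [det_mul_eq_sum_fun]
  have h0 : ∀ p : m → n, p ∉ Finset.univ.filter Function.Injective →
      (∏ i, A i (p i)) * (B.submatrix p id).det = 0 := by
    intro p hp
    simp only [Finset.mem_filter, Finset.mem_univ, true_and, Function.Injective, not_forall] at hp
    obtain ⟨i, j, hij, hne⟩ := hp
    rw [det_zero_of_row_eq hne, mul_zero]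
    ext k
    simp [hij]
  rw [← Finset.sum_subset (Finset.filter_subset Function.Injective Finset.univ)
    fun p _ hp => h0 p hp]
  -- The injective index maps are grouped by their image. Those with the same image as `φ` are the
  -- maps `φ ∘ π`, and the signs of the permutations `π` assemble the minor of `A`.
  rw [← Finset.sum_fiberwise_of_maps_to (t := Finset.univ.powersetCard (Fintype.card m))
    (g := fun p : m → n => Finset.univ.image p)]
  · refine Finset.sum_congr rfl fun F hF => ?_
    rw [Finset.mem_powersetCard_univ] at hF
    obtain ⟨φ, hinj, himg⟩ : ∃ φ : m → n, Function.Injective φ ∧ Finset.univ.image φ = F := by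
      let e : m ≃ F := Fintype.equivOfCardEq (by simp [hF])
      refine ⟨fun v => e v, Subtype.val_injective.comp e.injective, ?_⟩
      ext x
      simp only [Finset.mem_image, Finset.mem_univ, true_and]
      exact ⟨fun ⟨v, hv⟩ => hv ▸ (e v).2, fun hx => ⟨e.symm ⟨x, hx⟩, by simp⟩⟩
    rw [← himg, ht φ hinj, himg, ← det_transpose (A.submatrix id φ), det_apply', Finset.sum_mul]
    symm
    refine Finset.sum_bij (fun (π : Equiv.Perm m) _ => φ ∘ π) ?_ ?_ ?_ ?_
    · intro π _
      simp only [Finset.mem_filter, Finset.mem_univ, true_and]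
      refine ⟨hinj.comp π.injective, ?_⟩
      rw [← Finset.image_image, Finset.image_univ_equiv, himg]
    · intro π _ π' _ h
      ext i
      exact hinj (congrFun h i)
    · intro p hp
      simp only [Finset.mem_filter, Finset.mem_univ, true_and] at hp
      have hex : ∀ i, ∃ j, φ j = p i := by
        intro i
        have : p i ∈ F := by rw [← hp.2]; exact Finset.mem_image_of_mem _ (Finset.mem_univ _)
        rw [← himg] at this
        simpa using this
      choose q hq using hex
      have hqinj : Function.Injective q := fun i j h => hp.1 (by rw [← hq, ← hq, h])
      refine ⟨Equiv.ofBijective q (Finite.injective_iff_bijective.1 hqinj), Finset.mem_univ _, ?_⟩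
      ext i
      exact hq i
    · intro π _
      have : B.submatrix (φ ∘ π) id = (B.submatrix φ id).submatrix π id := rfl
      rw [this, det_permute]
      simp only [transpose_apply, submatrix_apply, id_eq, Function.comp_apply]
      ring
  · intro p hp
    simp only [Finset.mem_filter, Finset.mem_univ, true_and] at hp
    rw [Finset.mem_powersetCard_univ, Finset.card_image_of_injective _ hp, Finset.card_univ]

/-- A square matrix that is injective over all residue fields has an invertible determinant. -/
theorem isUnit_det_of_forall_field {R : Type*} [CommRing R] (M : Matrix m m R)
    (h : ∀ (I : Ideal R) [I.IsMaximal] (f : m → R ⧸ I),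
      (M.map (Ideal.Quotient.mk I)).mulVec f = 0 → f = 0) : IsUnit M.det := by
  by_contra hdet
  obtain ⟨I, hI, hmem⟩ := exists_max_ideal_of_mem_nonunits hdet
  let _ : Field (R ⧸ I) := Ideal.Quotient.field I
  have h0 : (M.map (Ideal.Quotient.mk I)).det = 0 := by
    rw [← RingHom.mapMatrix_apply, ← RingHom.map_det]
    exact Ideal.Quotient.eq_zero_iff_mem.2 hmem
  obtain ⟨f, hf, hf0⟩ := exists_mulVec_eq_zero_iff.2 h0
  exact hf (h I f hf0)

end Matrix

namespace LaurentPolynomial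

/-- The units of ℤ[z, 1/z] are the monomials ±z^k. Integral coefficients are essential: over ℝ a
constant c is a unit, and c · c need not be 1. -/
theorem mul_invert_eq_one_of_isUnit {u : LaurentPolynomial ℤ} (hu : IsUnit u) :
    u * invert u = 1 := by
  obtain ⟨v, huv⟩ := hu.exists_right_inv
  obtain ⟨n, p, hp⟩ := exists_T_pow u
  obtain ⟨k, q, hq⟩ := exists_T_pow v
  have hpq : p * q = Polynomial.X ^ (n + k) := by
    apply Polynomial.toLaurent_injective
    rw [map_mul, hp, hq, Polynomial.toLaurent_X_pow]
    calc u * T n * (v * T k) = (u * v) * (T n * T k) := by ring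
      _ = _ := by rw [huv, one_mul, ← T_add]; push_cast; rfl
  obtain ⟨i, -, hi⟩ := (dvd_prime_pow Polynomial.prime_X (n + k)).1 (Dvd.intro _ hpq)
  obtain ⟨w, hw⟩ := hi.symm
  obtain ⟨a, ha, haw⟩ := Polynomial.isUnit_iff.1 w.isUnit
  have hu' : u = C a * T (i - n) := by
    have h1 : u = (u * T n) * T (-n) := by rw [mul_T_assoc]; simp
    rw [h1, ← hp, ← hw, ← haw, map_mul, Polynomial.toLaurent_X_pow, Polynomial.toLaurent_C,
      sub_eq_add_neg, T_add]
    ring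
  have ha2 : a * a = 1 := by
    rcases Int.isUnit_iff.1 ha with rfl | rfl <;> rfl
  rw [hu', map_mul, invert_C, invert_T]
  calc C a * T (i - n) * (C a * T (-(i - n))) = C (a * a) * (T (i - n) * T (-(i - n))) := by
        rw [map_mul]; ring
    _ = 1 := by rw [ha2, ← T_add]; simp

end LaurentPolynomial

/-- The `q`-analogue of an integer. -/
theorem exists_sub_one_mul_eq {R : Type*} [CommRing R] (z : Rˣ) (a : ℤ) :
    ∃ b : R, ((z : R) - 1) * b = ((z ^ a : Rˣ) : R) - 1 := by
  obtain ⟨n, rfl | rfl⟩ := a.eq_nat_or_neg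
  · obtain ⟨b, hb⟩ := sub_one_dvd_pow_sub_one (z : R) n
    exact ⟨b, by simpa using hb.symm⟩
  · obtain ⟨b, hb⟩ := sub_one_dvd_pow_sub_one (z : R) n
    refine ⟨-((z ^ (-(n : ℤ)) : Rˣ) : R) * b, ?_⟩
    have h : ((z ^ (-(n : ℤ)) : Rˣ) : R) * (z : R) ^ n = 1 := by
      rw [← Units.val_pow_eq_pow_val, ← Units.val_mul]; simp
    calc ((z : R) - 1) * (-((z ^ (-(n : ℤ)) : Rˣ) : R) * b)
        = -((z ^ (-(n : ℤ)) : Rˣ) : R) * (((z : R) - 1) * b) := by ring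
      _ = _ := by rw [← hb, mul_sub, neg_mul, h]; ring

namespace LaurentPolynomial

/-- The variable as a unit. -/
def unitT (R : Type*) [CommRing R] : (LaurentPolynomial R)ˣ where
  val := T 1
  inv := T (-1)
  val_inv := by rw [← T_add]; simp
  inv_val := by rw [← T_add]; simp

theorem coe_unitT_zpow {R : Type*} [CommRing R] (k : ℤ) :
    ((unitT R ^ k : (LaurentPolynomial R)ˣ) : LaurentPolynomial R) = T k := by
  obtain ⟨n, rfl | rfl⟩ := k.eq_nat_or_neg
  · rw [zpow_natCast, Units.val_pow_eq_pow_val]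
    simp [unitT, T_pow]
  · rw [zpow_neg, zpow_natCast, ← inv_pow, Units.val_pow_eq_pow_val]
    change (T (-1)) ^ n = _
    simp [T_pow]

end LaurentPolynomial

/-! ### Minors of d(z) and the matrix-tree theorem -/

namespace PeriodicGraph

open LaurentPolynomial

variable {V E : Type*} [Fintype V] [DecidableEq V] {H : PeriodicGraph V E}

/-- The kernel computation behind the determinant of `d(z)`: here `β k = (ζ ^ k - 1) / (ζ - 1)`, `r`
chooses a root in each component, and `h` lifts the components to the cover. -/
theorem Winds.eq_zero_of_deformed {V E K : Type*} {H : PeriodicGraph V E} [CommRing K] {F : Set E} (hF : H.Winds F) (ζ : Kˣ)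
    (β : ℤ → K) (hβ0 : β 0 = 0) (hβ1 : β 1 = 1)
    (hβadd : ∀ l a, β (l + a) = β l + ((ζ ^ l : Kˣ) : K) * β a) (r : V → V) (h : V → ℤ)
    (hh : ∀ v, (H.coverGraph F).Reachable (r v, 0) (v, h v)) (hrr : ∀ v, r (r v) = r v)
    (hhr : ∀ v, h (r v) = 0) (hre : ∀ e ∈ F, r (H.tgt e) = r (H.src e)) (f f' : V → K)
    (hf' : ∀ v, f' (r v) = 0)
    (hf : ∀ e ∈ F, ((ζ ^ (-h (H.src e)) : Kˣ) : K) *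
        β (H.shift e - h (H.tgt e) + h (H.src e)) * f (r (H.src e)) +
      (((ζ ^ H.shift e : Kˣ) : K) * f' (H.tgt e) - f' (H.src e)) = 0) :
    (∀ v, f (r v) = 0) ∧ ∀ v, f' v = 0 := by
  -- This function on the cover is constant along the edges of `F`; that is exactly what `hf` says.
  -- Comparing its values at (r v, 0) and (r v, 1) isolates f (r v), even when ζ = 1.
  have hU : ∀ x y : V × ℤ, (H.coverGraph F).Reachable x y →
      ((ζ ^ x.2 : Kˣ) : K) * f' x.1 + β (x.2 - h x.1) * f (r x.1) =
      ((ζ ^ y.2 : Kˣ) : K) * f' y.1 + β (y.2 - h y.1) * f (r y.1) := by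
    intro x y hxy
    refine H.cover.eq_of_reachable (fun x : V × ℤ =>
      ((ζ ^ x.2 : Kˣ) : K) * f' x.1 + β (x.2 - h x.1) * f (r x.1)) ?_ hxy
    rintro ⟨e, k⟩ he
    have h0 := hf e he
    simp only [cover]
    have h1 : k + H.shift e - h (H.tgt e) = (k - h (H.src e)) +
        (H.shift e - h (H.tgt e) + h (H.src e)) := by ring
    rw [h1, hβadd, hre e he, zpow_add, Units.val_mul, sub_eq_add_neg k, zpow_add, Units.val_mul]
    linear_combination -((ζ ^ k : Kˣ) : K) * h0
  have hroot : ∀ v, f (r v) = 0 := by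
    intro v
    have := hU (r v, 0) (r v, 1) (hF (r v))
    simp only [hf', hrr, hhr, sub_zero, hβ0, hβ1, mul_zero, zero_mul, zero_add, one_mul] at this
    exact this.symm
  refine ⟨hroot, fun v => ?_⟩
  have := hU (r v, 0) (v, h v) (hh v)
  simp only [hroot, mul_zero, add_zero, hf'] at this
  simpa using this.symm

/-- In each component the delta function at a root is replaced by the z-periodic function
transported along paths from the root. Around an edge this function fails to be transported
consistently only by a factor z^a - 1, so its column is divisible by z - 1. After dividing out one
factor per component, the remaining matrix is injective over every residue field, including those
where z = 1, so its determinant is a unit. -/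
theorem Winds.exists_det_incidence {φ : V → E} (hF : H.Winds (Set.range φ)) :
    ∃ u : LaurentPolynomial ℤ, IsUnit u ∧ ((H.incidence (unitT ℤ)).submatrix φ id).det =
      u * (T 1 - 1) ^ H.base.numComponents (Set.range φ) := by
  set F := Set.range φ with hFdef
  set G := H.base.spanned F with hG
  have hz1 : (T 1 - 1 : LaurentPolynomial ℤ) ≠ 0 := by
    intro h
    have := congrArg (fun f : LaurentPolynomial ℤ => f.coeff 1) h
    simp [← T_zero] at this
  set z := unitT ℤ with hz
  have hzT : (z : LaurentPolynomial ℤ) = T 1 := rfl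
  choose b hb using exists_sub_one_mul_eq z
  have hb0 : b 0 = 0 := by
    have := hb 0
    rw [hzT] at this
    simpa [hz1] using this
  have hb1 : b 1 = 1 := by
    have := hb 1
    rw [zpow_one, hzT] at this
    exact mul_left_cancel₀ hz1 (by rw [this, mul_one])
  have hbadd : ∀ l a, b (l + a) = b l + (z ^ l : (LaurentPolynomial ℤ)ˣ) * b a := by
    intro l a
    apply mul_left_cancel₀ hz1
    rw [← hzT, mul_add, mul_left_comm, hb, hb, hb, zpow_add, Units.val_mul]
    ring
  -- roots and heights
  let r : V → V := fun v => (G.connectedComponentMk v).out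
  have hr : ∀ v, G.Reachable (r v) v := fun v =>
    SimpleGraph.ConnectedComponent.exact (Quot.out_eq (G.connectedComponentMk v))
  have hr_eq : ∀ {v w}, G.Reachable v w → r v = r w := by
    intro v w h
    simp only [r]
    rw [SimpleGraph.ConnectedComponent.sound h]
  have hrr : ∀ v, r (r v) = r v := fun v => hr_eq (hr v)
  have hex : ∀ v, ∃ k, (H.coverGraph F).Reachable (r v, 0) (v, k) :=
    fun v => exists_reachable_lift (hr v) 0
  let h : V → ℤ := fun v => if r v = v then 0 else (hex v).choose
  have hh : ∀ v, (H.coverGraph F).Reachable (r v, 0) (v, h v) := by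
    intro v
    by_cases hv : r v = v
    · simp only [h, if_pos hv]; rw [hv]
    · simp only [h, if_neg hv]; exact (hex v).choose_spec
  have hhr : ∀ v, r v = v → h v = 0 := fun v hv => if_pos hv
  have hre : ∀ v, r (H.tgt (φ v)) = r (H.src (φ v)) := fun v =>
    (hr_eq (H.base.reachable_edge (F := F) (e := φ v) ⟨v, rfl⟩)).symm
  let a : E → ℤ := fun e => H.shift e - h (H.tgt e) + h (H.src e)
  -- `A` is the change of basis, `M` the matrix d(z) in the new basis with the factor z - 1 removed
  -- from the root columns, and `δ` records these factors.
  let A : Matrix V V (LaurentPolynomial ℤ) := Matrix.of fun w v =>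
    (if v = r w then ((z ^ (-h w) : (LaurentPolynomial ℤ)ˣ) : LaurentPolynomial ℤ) else 0) +
      (if v = w then (if r w = w then 0 else 1) else 0)
  let M : Matrix V V (LaurentPolynomial ℤ) := Matrix.of fun i v =>
    (if v = r (H.src (φ i)) then ((z ^ (-h (H.src (φ i))) :
      (LaurentPolynomial ℤ)ˣ) : LaurentPolynomial ℤ) * b (a (φ i)) else 0) +
    (H.incidence z) (φ i) v * (if r v = v then 0 else 1)
  let δ : V → LaurentPolynomial ℤ := fun v => if r v = v then T 1 - 1 else 1
  have hprod : (H.incidence z).submatrix φ id * A = M * Matrix.diagonal δ := by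
    ext1 i v
    rw [Matrix.mul_diagonal]
    have h1 : ((H.incidence z).submatrix φ id * A) i v =
        (H.incidence z).mulVec (fun w => A w v) (φ i) := rfl
    rw [h1, incidence_mulVec]
    simp only [A, M, δ, Matrix.of_apply]
    by_cases hv : r v = v
    · have h0 : ∀ w, (if v = w then (if r w = w then (0 : LaurentPolynomial ℤ) else 1) else 0) = 0 := by
        intro w
        split_ifs with h1 h2
        · rfl
        · exact absurd (h1 ▸ hv) h2
        · rfl
      simp only [if_pos hv, h0, mul_zero, add_zero]
      simp only [hre]
      split_ifs
      · rw [mul_assoc, mul_comm (b _), ← hzT, hb, mul_sub, mul_one, ← Units.val_mul,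
          ← Units.val_mul, ← zpow_add, ← zpow_add]
        congr 3
        simp only [a]; ring
      · simp
    · have h0 : ∀ w, v ≠ r w := fun w hw => hv (by rw [hw, hrr])
      have h1 : ∀ w, (if v = w then (if r w = w then (0 : LaurentPolynomial ℤ) else 1) else 0) =
          if v = w then 1 else 0 := by
        intro w
        split_ifs with h1 h2
        · exact absurd (h1 ▸ h2) hv
        · rfl
        · rfl
      simp only [if_neg hv, if_neg (h0 _), h1, mul_one, zero_add, incidence, Matrix.of_apply,
        mul_ite, mul_zero]
  have hdetδ : (Matrix.diagonal δ).det = (T 1 - 1) ^ H.base.numComponents F := by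
    rw [Matrix.det_diagonal]
    simp only [δ]
    rw [Finset.prod_ite, Finset.prod_const, Finset.prod_const_one, mul_one]
    congr 1
    rw [EdgeGraph.numComponents, ← Fintype.card_subtype, ← Nat.card_eq_fintype_card]
    refine Nat.card_congr ⟨fun v => G.connectedComponentMk v, fun K => ⟨K.out, ?_⟩, ?_, ?_⟩
    · simp only [r]
      congr 1
      exact Quot.out_eq K
    · intro v
      exact Subtype.ext v.2
    · intro K
      exact Quot.out_eq K
  have hAunit : IsUnit A.det := by
    refine A.isUnit_det_of_forall_field fun I _ f hf => ?_
    have hf' : ∀ w, (Ideal.Quotient.mk I ((z ^ (-h w) : (LaurentPolynomial ℤ)ˣ) :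
        LaurentPolynomial ℤ)) * f (r w) + (if r w = w then 0 else f w) = 0 := by
      intro w
      have := congrFun hf w
      simp only [Matrix.mulVec, dotProduct, A, Matrix.map_apply, Matrix.of_apply, map_add,
        add_mul, Finset.sum_add_distrib, apply_ite (Ideal.Quotient.mk I), map_zero, map_one,
        ite_mul, zero_mul, one_mul, Finset.sum_ite_eq', Finset.mem_univ, if_true,
        Pi.zero_apply] at this
      exact this
    have hroot : ∀ w, f (r w) = 0 := by
      intro w
      have := hf' (r w)
      rw [if_pos (hrr w), hhr _ (hrr w), hrr] at this
      simpa using this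
    funext w
    by_cases hw : r w = w
    · rw [← hw]; exact hroot w
    · have := hf' w
      rwa [hroot, mul_zero, zero_add, if_neg hw] at this
  -- Over a residue field `b k` plays the role of (ζ^k - 1)/(ζ - 1), which keeps its additivity when
  -- ζ = 1; this is why the kernel computation was stated with an abstract β.
  have hMunit : IsUnit M.det := by
    refine M.isUnit_det_of_forall_field fun I _ f hf => ?_
    let ζ := Units.map ((Ideal.Quotient.mk I : LaurentPolynomial ℤ →+* LaurentPolynomial ℤ ⧸ I) :
      LaurentPolynomial ℤ →* LaurentPolynomial ℤ ⧸ I) z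
    have hζ : ∀ k : ℤ, Ideal.Quotient.mk I ((z ^ k : (LaurentPolynomial ℤ)ˣ) :
        LaurentPolynomial ℤ) = ((ζ ^ k : (LaurentPolynomial ℤ ⧸ I)ˣ) : LaurentPolynomial ℤ ⧸ I) := by
      intro k
      simp only [ζ]
      rw [← map_zpow]; rfl
    let f' : V → LaurentPolynomial ℤ ⧸ I := fun v => if r v = v then 0 else f v
    obtain ⟨hroot, hf0⟩ := hF.eq_zero_of_deformed ζ (fun k => Ideal.Quotient.mk I (b k))
      (by simp only [hb0, map_zero]) (by simp only [hb1, map_one])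
      (fun l a => by rw [hbadd, map_add, map_mul, hζ]) r h hh hrr (fun v => hhr _ (hrr v))
      (by rintro _ ⟨i, rfl⟩; exact hre i) f f' (fun v => if_pos (hrr v)) (by
        rintro _ ⟨i, rfl⟩
        have := congrFun hf i
        rw [Pi.zero_apply] at this
        rw [← this, ← incidence_mulVec, ← incidence_map]
        simp only [Matrix.mulVec, dotProduct, M, Matrix.map_apply, Matrix.of_apply, map_add,
          add_mul, Finset.sum_add_distrib, apply_ite (Ideal.Quotient.mk I), map_zero, map_one,
          ite_mul, zero_mul, Finset.sum_ite_eq', Finset.mem_univ, if_true, map_mul, hζ]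
        congr 1
        refine Finset.sum_congr rfl fun v _ => ?_
        simp only [f']
        split_ifs <;> simp)
    funext v
    by_cases hv : r v = v
    · rw [← hv]; exact hroot v
    · simpa [f', hv] using hf0 v
  refine ⟨M.det * ↑hAunit.unit⁻¹, hMunit.mul (Units.isUnit _), ?_⟩
  have := congrArg Matrix.det hprod
  rw [Matrix.det_mul, Matrix.det_mul, hdetδ] at this
  rw [mul_right_comm, ← this, mul_assoc, IsUnit.mul_val_inv, mul_one]

theorem dMatrix_eq {V E : Type*} [DecidableEq V] (H : PeriodicGraph V E) :
    H.dMatrix = H.incidence (unitT ℝ) := by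
  ext1 e v
  simp only [dMatrix, incidence, Matrix.of_apply, coe_unitT_zpow]

/-- The unit cancels against its image under z ↦ 1/z, and (z - 1)(1/z - 1) = 2 - z - 1/z. -/
theorem det_incidence_mul_invert (hH : H.Annular) (φ : V → E) :
    ((H.incidence (unitT ℤ)).submatrix φ id).det *
      invert ((H.incidence (unitT ℤ)).submatrix φ id).det =
    if H.Winds (Set.range φ) then
      (2 - T 1 - T (-1)) ^ H.base.numComponents (Set.range φ) else 0 := by
  split_ifs with hF
  · obtain ⟨u, hu, hdet⟩ := hF.exists_det_incidence
    rw [hdet, map_mul, map_pow, map_sub, invert_T, map_one, mul_mul_mul_comm,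
      mul_invert_eq_one_of_isUnit hu, one_mul, ← mul_pow]
    congr 1
    calc (T 1 - 1 : LaurentPolynomial ℤ) * (T (-1) - 1) = T 1 * T (-1) - T 1 - T (-1) + 1 := by
          ring
      _ = _ := by rw [← T_add]; simp; ring
  · obtain ⟨f, hf, hf0⟩ := exists_kernel_of_not_winds hH hF (unitT ℤ)
    have : ((H.incidence (unitT ℤ)).submatrix φ id).det = 0 := by
      refine Matrix.exists_mulVec_eq_zero_iff.1 ⟨f, hf, ?_⟩
      funext i
      exact hf0 (φ i) ⟨i, rfl⟩
    rw [this, zero_mul]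

variable [Fintype E] [DecidableEq E]

/-- `F` is a cycle-rooted spanning forest all of whose cycles wind once. -/
def Good (H : PeriodicGraph V E) (F : Finset E) : Prop := F.card = Fintype.card V ∧ H.Winds F

/-- The characteristic polynomial in the variable `2 - z - 1/z`. -/
def forestPoly (H : PeriodicGraph V E) (c : E → ℝ) : Polynomial ℝ :=
  ∑ F : Finset E with H.Good F,
    Polynomial.C (∏ e ∈ F, c e) * Polynomial.X ^ H.base.numComponents (F : Set E)

/-- The matrix-tree theorem for the line bundle Laplacian. -/
theorem charPoly_eq (hH : H.Annular) (c : E → ℝ) :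
    H.charPoly c = Polynomial.aeval (2 - T 1 - T (-1)) (H.forestPoly c) := by
  rw [charPoly, laplacian, dMatrix_eq,
    Matrix.det_mul_eq_sum_powersetCard _ _ (fun F => C (∏ e ∈ F, c e) *
      if H.Winds (F : Set E) then (2 - T 1 - T (-1)) ^ H.base.numComponents (F : Set E) else 0)]
  · rw [forestPoly, map_sum, Finset.sum_filter]
    refine (Finset.sum_congr rfl fun F hF => ?_).trans
      ((Finset.sum_subset (Finset.subset_univ _) fun F _ hF => ?_))
    · rw [Finset.mem_powersetCard_univ] at hF
      simp only [Good, hF, true_and]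
      split_ifs
      · simp [Polynomial.aeval_C, ← C_eq_algebraMap]
      · simp
    · rw [Finset.mem_powersetCard_univ] at hF
      simp [Good, hF]
  · intro φ hφ
    have hr : ((Finset.univ.image φ : Finset E) : Set E) = Set.range φ := by simp
    -- The minors are evaluated over ℤ, where the units are ±z^k, and only then mapped to ℝ.
    let ι : LaurentPolynomial ℤ →+* LaurentPolynomial ℝ :=
      AddMonoidAlgebra.mapRingHom ℤ (Int.castRingHom ℝ)
    have hιT : ∀ k, ι (T k) = T k := fun k => by
      simp only [ι, T, AddMonoidAlgebra.mapRingHom_single, map_one]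
    have hιinv : ∀ f, ι (invert f) = invert (ι f) := fun f => by
      ext k
      simp [ι]
    have hιd : (H.incidence (unitT ℤ)).map ι = H.incidence (unitT ℝ) := by
      rw [incidence_map]
      congr 1
      ext1
      exact hιT 1
    have key := congrArg ι (det_incidence_mul_invert hH φ)
    rw [map_mul, hιinv, RingHom.map_det, apply_ite ι, map_zero, map_pow, map_sub, map_sub, hιT,
      hιT, map_ofNat, RingHom.mapMatrix_apply, ← Matrix.submatrix_map, hιd] at key
    have h1 : ((((H.incidence (unitT ℝ)).map ⇑invert).transpose *
        Matrix.diagonal fun e => C (c e)).submatrix id φ).det =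
        C (∏ e ∈ Finset.univ.image φ, c e) *
          invert ((H.incidence (unitT ℝ)).submatrix φ id).det := by
      have : ((((H.incidence (unitT ℝ)).map ⇑invert).transpose *
          Matrix.diagonal fun e => C (c e)).submatrix id φ) =
          (((H.incidence (unitT ℝ)).submatrix φ id).map ⇑invert).transpose *
            Matrix.diagonal fun v => C (c (φ v)) := by
        ext1 v w
        simp [Matrix.mul_diagonal]
      rw [this, Matrix.det_mul, Matrix.det_transpose, Matrix.det_diagonal,
        Finset.prod_image fun _ _ _ _ h => hφ h, map_prod, mul_comm]
      congr 1
      exact (RingHom.map_det (invert : LaurentPolynomial ℝ ≃ₐ[ℝ] _).toRingEquiv.toRingHom _).symm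
    rw [h1, mul_assoc, mul_comm (invert _), key, hr]

end PeriodicGraph

/-! ### Two paths crossing a rectangle in different directions meet -/

open Real

/-- If the paths did not meet, δ(t) - γ(s) would have a continuous argument θ on the whole (simply
connected) parameter plane. On each side of the unit square the hypotheses fix the sign of the sine
or the cosine of θ. Following three sides brings θ from (π/2, π] down to nonpositive values, while
on the fourth side the cosine is negative, so that θ cannot cross 0. -/
theorem exists_eq_of_crossing_real {γ δ : ℝ → ℝ × ℝ} (hγ : Continuous γ) (hδ : Continuous δ)
    (hl : ∀ s, (δ 0).1 < (γ s).1) (hr : ∀ s, (γ s).1 < (δ 1).1) (ht : ∀ t, (δ t).2 ≤ (γ 0).2)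
    (hb : ∀ t, (γ 1).2 ≤ (δ t).2) : ∃ s t, γ s = δ t := by
  by_contra! hne
  let f : ℝ × ℝ → ℂ := fun x =>
    ⟨(δ x.2).1 - (γ x.1).1, (δ x.2).2 - (γ x.1).2⟩
  have hf0 : ∀ x, f x ≠ 0 := by
    intro x h
    refine hne x.1 x.2 (Prod.ext ?_ ?_)
    · have := congrArg Complex.re h
      simp only [f, Complex.zero_re] at this
      linarith
    · have := congrArg Complex.im h
      simp only [f, Complex.zero_im] at this
      linarith
  have hfc : Continuous f := by
    have : f = fun x => (((δ x.2).1 - (γ x.1).1 : ℝ) : ℂ) +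
        (((δ x.2).2 - (γ x.1).2 : ℝ) : ℂ) * Complex.I := by
      funext x
      exact (Complex.mk_eq_add_mul_I _ _)
    rw [this]
    fun_prop
  let u : C(ℝ × ℝ, Circle) :=
    ⟨fun x => ⟨f x / (‖f x‖ : ℂ), by
      rw [Submonoid.unitSphere, Submonoid.mem_mk]
      simp [norm_ne_zero_iff.2 (hf0 x)]⟩, by
      refine Continuous.subtype_mk (hfc.div (by fun_prop) fun x => ?_) _
      simpa using hf0 x⟩
  have hu : ∀ x, (u x : ℂ) = f x / (‖f x‖ : ℂ) := fun _ => rfl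
  -- the argument at the corner `(1, 0)` is chosen in `(π / 2, π]`
  obtain ⟨θ, ⟨hθ0, hθ⟩, -⟩ := Circle.isCoveringMap_exp.existsUnique_continuousMap_lifts u (1, 0)
    (u (1, 0) : ℂ).arg (Circle.exp_arg _)
  have hexp : ∀ x, Complex.exp (θ x * Complex.I) = f x / (‖f x‖ : ℂ) := by
    intro x
    rw [← hu, ← congrFun hθ x]
    simp
  have hcos : ∀ x, cos (θ x) = ((δ x.2).1 - (γ x.1).1) / ‖f x‖ := by
    intro x
    have := congrArg Complex.re (hexp x)
    rwa [Complex.exp_ofReal_mul_I_re, Complex.div_ofReal_re] at this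
  have hsin : ∀ x, sin (θ x) = ((δ x.2).2 - (γ x.1).2) / ‖f x‖ := by
    intro x
    have := congrArg Complex.im (hexp x)
    rwa [Complex.exp_ofReal_mul_I_im, Complex.div_ofReal_im] at this
  have hpos : ∀ x, 0 < ‖f x‖ := fun x => norm_pos_iff.2 (hf0 x)
  have cl : ∀ s, cos (θ (s, 0)) < 0 := fun s => by
    rw [hcos]; exact div_neg_of_neg_of_pos (by simpa using hl s) (hpos _)
  have cr : ∀ s, 0 < cos (θ (s, 1)) := fun s => by
    rw [hcos]; exact div_pos (by simpa using hr s) (hpos _)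
  have s0 : ∀ t, sin (θ (0, t)) ≤ 0 := fun t => by
    rw [hsin]; exact div_nonpos_of_nonpos_of_nonneg (by simpa using ht t) (hpos _).le
  have s1 : ∀ t, 0 ≤ sin (θ (1, t)) := fun t => by
    rw [hsin]; exact div_nonneg (by simpa using hb t) (hpos _).le
  have hθc := θ.continuous
  have ivt : ∀ {g : ℝ → ℝ}, Continuous g → ∀ x y c, g x ≤ c → c ≤ g y → ∃ w, g w = c :=
    fun hg x y c h1 h2 => intermediate_value_univ x y hg ⟨h1, h2⟩
  have hpi := pi_pos
  have A1 : θ (1, 0) ≤ π := hθ0 ▸ Complex.arg_le_pi _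
  have A0 : -π < θ (1, 0) := hθ0 ▸ Complex.neg_pi_lt_arg _
  have A2 : π / 2 < θ (1, 0) := by
    by_contra! h
    rcases lt_or_ge (θ (1, 0)) 0 with h0 | h0
    · exact absurd (s1 0) (not_le.2 (sin_neg_of_neg_of_neg_pi_lt h0 A0))
    · exact absurd (cl 1) (not_lt.2 (cos_nonneg_of_neg_pi_div_two_le_of_le (by linarith) h))
  -- along the edge `s = 1`
  have hg1 : Continuous fun t => θ (1, t) := by fun_prop
  have B1 : θ (1, 1) ≤ π := by
    by_contra! h
    obtain ⟨w, hw⟩ := ivt hg1 0 1 (min (θ (1, 1)) (3 * π / 2)) (le_min (by linarith) (by linarith))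
      (min_le_left _ _)
    have h1 := s1 w
    rw [hw, ← sub_add_cancel (min (θ (1, 1)) (3 * π / 2)) π, sin_add_pi] at h1
    have h2 : 0 < min (θ (1, 1)) (3 * π / 2) - π := sub_pos.2 (lt_min h (by linarith))
    have h3 := sin_pos_of_pos_of_lt_pi h2 (by linarith [min_le_right (θ (1, 1)) (3 * π / 2)])
    linarith
  have B0 : 0 ≤ θ (1, 1) := by
    by_contra! h
    obtain ⟨w, hw⟩ := ivt hg1 1 0 (max (θ (1, 1)) (-(π / 2))) (le_max_left _ _)
      (max_le (by linarith) (by linarith))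
    have h1 := s1 w
    rw [hw] at h1
    have h3 := sin_neg_of_neg_of_neg_pi_lt (max_lt h (by linarith : -(π / 2) < 0))
      (by linarith [le_max_right (θ (1, 1)) (-(π / 2))])
    linarith
  have B2 : θ (1, 1) < π / 2 := by
    by_contra! h
    exact absurd (cr 1) (not_lt.2 (cos_nonpos_of_pi_div_two_le_of_le h (by linarith)))
  -- along the edge `t = 1`
  have hg2 : Continuous fun s => θ (s, 1) := by fun_prop
  have C1 : θ (0, 1) < π / 2 := by
    by_contra! h
    obtain ⟨w, hw⟩ := ivt hg2 1 0 (π / 2) B2.le h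
    have := cr w
    rw [hw, cos_pi_div_two] at this
    exact lt_irrefl _ this
  have C0 : -(π / 2) < θ (0, 1) := by
    by_contra! h
    obtain ⟨w, hw⟩ := ivt hg2 0 1 (-(π / 2)) h (by linarith)
    have := cr w
    rw [hw, cos_neg, cos_pi_div_two] at this
    exact lt_irrefl _ this
  have C2 : θ (0, 1) ≤ 0 := by
    by_contra! h
    exact absurd (s0 1) (not_le.2 (sin_pos_of_pos_of_lt_pi h (by linarith)))
  -- along the edge `s = 0`
  have hg3 : Continuous fun t => θ (0, t) := by fun_prop
  have D1 : θ (0, 0) ≤ 0 := by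
    by_contra! h
    obtain ⟨w, hw⟩ := ivt hg3 1 0 (min (θ (0, 0)) (π / 2)) (le_min (by linarith) (by linarith))
      (min_le_left _ _)
    have h1 := s0 w
    rw [hw] at h1
    have h3 := sin_pos_of_pos_of_lt_pi (lt_min h (by linarith : 0 < π / 2))
      (by linarith [min_le_right (θ (0, 0)) (π / 2)])
    linarith
  -- along the edge `t = 0`
  have hg4 : Continuous fun s => θ (s, 0) := by fun_prop
  obtain ⟨w, hw⟩ := ivt hg4 0 1 0 D1 (by linarith)
  have := cl w
  rw [hw, cos_zero] at this
  linarith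

/-- Two paths that cross a rectangle in the two directions meet. -/
theorem exists_eq_of_crossing {γ δ : unitInterval → ℝ × ℝ} (hγ : Continuous γ) (hδ : Continuous δ)
    (hl : ∀ s, (δ 0).1 < (γ s).1) (hr : ∀ s, (γ s).1 < (δ 1).1) (ht : ∀ t, (δ t).2 ≤ (γ 0).2)
    (hb : ∀ t, (γ 1).2 ≤ (δ t).2) : ∃ s t, γ s = δ t := by
  have h0 : Set.projIcc (0 : ℝ) 1 zero_le_one 0 = 0 := Set.projIcc_left _
  have h1 : Set.projIcc (0 : ℝ) 1 zero_le_one 1 = 1 := Set.projIcc_right _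
  obtain ⟨s, t, h⟩ := exists_eq_of_crossing_real
    (hγ.comp (continuous_projIcc (h := zero_le_one))) (hδ.comp (continuous_projIcc (h := zero_le_one)))
    (fun s => by simpa only [Function.comp, h0] using hl _)
    (fun s => by simpa only [Function.comp, h1] using hr _)
    (fun s => by simpa only [Function.comp, h0] using ht _)
    (fun s => by simpa only [Function.comp, h1] using hb _)
  exact ⟨_, _, h⟩

/-! ### Planarity implies `Annular` -/

namespace PeriodicGraph.PlanarEmbedding

variable {V E : Type*} {G : PeriodicGraph V E} (em : G.PlanarEmbedding)

/-- The point at which a vertex of the cover is drawn. -/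
def vtx (x : V × ℤ) : ℝ × ℝ := em.pt x.1 + ((x.2 : ℝ), 0)

/-- The arc along which an edge of the cover is drawn. -/
def edge (a : E × ℤ) (t : unitInterval) : ℝ × ℝ := em.arc a.1 t + ((a.2 : ℝ), 0)

theorem edge_zero (a : E × ℤ) : em.edge a 0 = em.vtx (G.cover.src a) := by
  simp [edge, vtx, cover]

theorem edge_one (a : E × ℤ) : em.edge a 1 = em.vtx (G.cover.tgt a) := by
  simp only [edge, vtx, cover, Path.target, add_assoc]
  congr 1
  ext <;> simp [add_comm]

theorem continuous_edge (a : E × ℤ) : Continuous (em.edge a) := by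
  unfold edge
  have := (em.arc a.1).continuous
  fun_prop

/-- The drawing of the component of `x` in `F`. -/
def drawing (F : Set (E × ℤ)) (x : V × ℤ) : Set (ℝ × ℝ) :=
  {p | (∃ y, (G.cover.spanned F).Reachable x y ∧ p = em.vtx y) ∨
    ∃ a ∈ F, (G.cover.spanned F).Reachable x (G.cover.src a) ∧ ∃ t, p = em.edge a t}

variable {em} {F : Set (E × ℤ)} {x y : V × ℤ}

theorem mem_drawing_cases {p : ℝ × ℝ} (hp : p ∈ em.drawing F x) :
    (∃ y, (G.cover.spanned F).Reachable x y ∧ p = em.vtx y) ∨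
    ∃ a ∈ F, (G.cover.spanned F).Reachable x (G.cover.src a) ∧
      ∃ t ∈ Set.Ioo (0 : unitInterval) 1, p = em.edge a t := by
  rcases hp with h | ⟨a, ha, hx, t, rfl⟩
  · exact Or.inl h
  · rcases eq_or_ne t 0 with rfl | h0
    · exact Or.inl ⟨_, hx, em.edge_zero a⟩
    rcases eq_or_ne t 1 with rfl | h1
    · exact Or.inl ⟨_, hx.trans (G.cover.reachable_edge ha), em.edge_one a⟩
    · exact Or.inr ⟨a, ha, hx, t, ⟨unitInterval.pos_iff_ne_zero.2 h0,
        unitInterval.lt_one_iff_ne_one.2 h1⟩, rfl⟩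

/-- The drawings of distinct vertices and of the interiors of distinct edges are disjoint, so
components whose drawings share a point share a vertex or an edge. -/
theorem reachable_of_mem_drawing {p : ℝ × ℝ} (hx : p ∈ em.drawing F x)
    (hy : p ∈ em.drawing F y) : (G.cover.spanned F).Reachable x y := by
  rcases mem_drawing_cases hx with ⟨u, hu, rfl⟩ | ⟨a, ha, hxa, t, ht, rfl⟩ <;>
  rcases mem_drawing_cases hy with ⟨w, hw, h⟩ | ⟨b, hb, hyb, s, hs, h⟩
  · obtain ⟨h1, h2⟩ := em.vertex_injective _ _ _ _ h
    have : u = w := Prod.ext h1 h2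
    exact hu.trans (this ▸ hw.symm)
  · exact absurd h.symm (em.interior_avoids_vertices _ _ _ _ _ hs)
  · exact absurd h (em.interior_avoids_vertices _ _ _ _ _ ht)
  · obtain ⟨h1, h2, -⟩ := em.interior_injective _ _ _ _ _ _ ht hs h
    have : a = b := Prod.ext h1 h2
    exact hxa.trans (this ▸ hyb.symm)

theorem drawing_eq (h : (G.cover.spanned F).Reachable x y) : em.drawing F x = em.drawing F y := by
  ext p
  constructor
  · rintro (⟨u, hu, hp⟩ | ⟨a, ha, hu, hp⟩)
    exacts [Or.inl ⟨u, h.symm.trans hu, hp⟩, Or.inr ⟨a, ha, h.symm.trans hu, hp⟩]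
  · rintro (⟨u, hu, hp⟩ | ⟨a, ha, hu, hp⟩)
    exacts [Or.inl ⟨u, h.trans hu, hp⟩, Or.inr ⟨a, ha, h.trans hu, hp⟩]

theorem vtx_mem_drawing : em.vtx x ∈ em.drawing F x := Or.inl ⟨x, .refl _, rfl⟩

theorem joinedIn_edge {a : E × ℤ} (ha : a ∈ F)
    (hx : (G.cover.spanned F).Reachable x (G.cover.src a)) (s t : unitInterval) :
    JoinedIn (em.drawing F x) (em.edge a s) (em.edge a t) := by
  have : PathConnectedSpace unitInterval := isPathConnected_iff_pathConnectedSpace.1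
    ((convex_Icc (0 : ℝ) 1).isPathConnected ⟨0, by simp⟩)
  have h1 : IsPathConnected (em.edge a '' Set.univ) :=
    (isPathConnected_univ).image (em.continuous_edge a)
  refine (h1.joinedIn _ ⟨s, trivial, rfl⟩ _ ⟨t, trivial, rfl⟩).mono ?_
  rintro _ ⟨t, -, rfl⟩
  exact Or.inr ⟨a, ha, hx, t, rfl⟩

theorem joinedIn_vtx (h : (G.cover.spanned F).Reachable x y) :
    JoinedIn (em.drawing F x) (em.vtx x) (em.vtx y) := by
  have key : (G.cover.spanned F).Reachable x y ∧
      JoinedIn (em.drawing F x) (em.vtx x) (em.vtx y) := by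
    refine G.cover.rel_of_reachable (r := fun x y => (G.cover.spanned F).Reachable x y ∧
      JoinedIn (em.drawing F x) (em.vtx x) (em.vtx y)) ⟨fun x => ?_, ?_, ?_⟩ ?_ h
    · exact ⟨.refl _, JoinedIn.refl vtx_mem_drawing⟩
    · rintro x y ⟨h1, h2⟩
      exact ⟨h1.symm, drawing_eq h1 ▸ h2.symm⟩
    · rintro x y z ⟨h1, h2⟩ ⟨h3, h4⟩
      exact ⟨h1.trans h3, h2.trans (drawing_eq h1 ▸ h4)⟩
    · intro a ha
      refine ⟨G.cover.reachable_edge ha, ?_⟩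
      have := joinedIn_edge (em := em) ha (.refl _) 0 1
      rwa [edge_zero, edge_one] at this
  exact key.2

theorem joinedIn_drawing {p q : ℝ × ℝ} (hp : p ∈ em.drawing F x) (hq : q ∈ em.drawing F x) :
    JoinedIn (em.drawing F x) p q := by
  have key : ∀ p ∈ em.drawing F x, JoinedIn (em.drawing F x) (em.vtx x) p := by
    rintro p (⟨y, hy, rfl⟩ | ⟨a, ha, hx, t, rfl⟩)
    · exact joinedIn_vtx hy
    · have := joinedIn_edge (em := em) ha hx 0 t
      rw [edge_zero] at this
      exact (joinedIn_vtx hx).trans this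
  exact (key p hp).symm.trans (key q hq)

/-- Horizontal translations preserve the height, so finitely many points and arcs account for all
heights. This provides a highest and a lowest point of an unbounded component. -/
theorem isCompact_snd_drawing [Finite V] [Finite E] : IsCompact (Prod.snd '' em.drawing F x) := by
  have : Prod.snd '' em.drawing F x =
      (⋃ v ∈ {v | ∃ k, (G.cover.spanned F).Reachable x (v, k)}, {(em.pt v).2}) ∪
      ⋃ e ∈ {e | ∃ k, (e, k) ∈ F ∧ (G.cover.spanned F).Reachable x (G.cover.src (e, k))},
        (fun t => (em.arc e t).2) '' Set.univ := by
    ext r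
    simp only [drawing, Set.mem_image, Set.mem_ofPred_eq, Set.mem_union, Set.mem_iUnion,
      Set.mem_singleton_iff, Set.mem_univ, true_and, exists_prop]
    constructor
    · rintro ⟨p, ⟨⟨v, k⟩, hy, rfl⟩ | ⟨⟨e, k⟩, ha, hx, t, rfl⟩, rfl⟩
      · exact Or.inl ⟨v, ⟨k, hy⟩, by simp [vtx]⟩
      · exact Or.inr ⟨e, ⟨k, ha, hx⟩, t, by simp [edge]⟩
    · rintro (⟨v, ⟨k, hy⟩, rfl⟩ | ⟨e, ⟨k, ha, hx⟩, t, rfl⟩)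
      · exact ⟨em.vtx (v, k), Or.inl ⟨_, hy, rfl⟩, by simp [vtx]⟩
      · exact ⟨em.edge (e, k) t, Or.inr ⟨_, ha, hx, t, rfl⟩, by simp [edge]⟩
  rw [this]
  refine IsCompact.union ?_ ?_
  · exact (Set.toFinite _).isCompact_biUnion fun v _ => isCompact_singleton
  · refine (Set.toFinite _).isCompact_biUnion fun e _ => isCompact_univ.image ?_
    have := (em.arc e).continuous
    fun_prop

theorem reachable_translate_of_periodic {n : ℤ} (hF : ∀ e k, (e, k) ∈ F ↔ (e, k + n) ∈ F)
    (h : (G.cover.spanned F).Reachable x y) :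
    (G.cover.spanned F).Reachable (x.1, x.2 + n) (y.1, y.2 + n) := by
  refine G.cover.reachable_map G.cover (fun x : V × ℤ => (x.1, x.2 + n)) ?_ h
  rintro ⟨e, j⟩ he
  have := G.cover.reachable_edge (F := F) (e := (e, j + n)) ((hF _ _).1 he)
  simpa [cover, add_right_comm] using this

theorem add_mem_drawing {n : ℤ} (hF : ∀ e k, (e, k) ∈ F ↔ (e, k + n) ∈ F) {p : ℝ × ℝ}
    (hp : p ∈ em.drawing F x) : p + ((n : ℝ), 0) ∈ em.drawing F (x.1, x.2 + n) := by
  rcases hp with ⟨y, hy, rfl⟩ | ⟨a, ha, hx, t, rfl⟩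
  · refine Or.inl ⟨_, reachable_translate_of_periodic hF hy, ?_⟩
    simp [vtx, add_assoc]
  · refine Or.inr ⟨(a.1, a.2 + n), (hF _ _).1 ha, reachable_translate_of_periodic hF hx, t, ?_⟩
    simp [edge, add_assoc]

/-- In a planar strip graph, a component of an `n`-periodic set of edges that contains a path from a
vertex to its translate by a positive multiple of `n` contains one to its translate by `n`. -/
theorem reachable_add_of_reachable (em : G.PlanarEmbedding) [Finite V] [Finite E] {n : ℤ} (hn : 0 < n)
    (hF : ∀ e k, (e, k) ∈ F ↔ (e, k + n) ∈ F) {v : V} {k g : ℤ} (hg : 1 ≤ g)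
    (h : (G.cover.spanned F).Reachable (v, k) (v, k + g * n)) :
    (G.cover.spanned F).Reachable (v, k) (v, k + n) := by
  have hFm : ∀ (m : ℤ) e k, (e, k) ∈ F ↔ (e, k + m * n) ∈ F := by
    intro m e
    induction m using Int.induction_on with
    | zero => simp
    | succ i ih =>
      intro k
      rw [ih k, hF, add_assoc]
      simp [add_mul]
    | pred i ih =>
      intro k
      rw [ih k, hF e (k + (-↑i - 1) * n), add_assoc]
      simp [sub_mul]
  have hreach : ∀ q : ℕ, (G.cover.spanned F).Reachable (v, k) (v, k + q * (g * n)) := by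
    intro q
    induction q with
    | zero => simp
    | succ q ih =>
      have := reachable_translate_of_periodic (n := q * (g * n))
        (fun e k => by rw [hFm (q * g), mul_assoc]) h
      refine ih.trans ?_
      convert this using 2
      push_cast; ring
  have hreach' : ∀ q : ℕ, (G.cover.spanned F).Reachable (v, k - q * (g * n)) (v, k) := by
    intro q
    have := reachable_translate_of_periodic (n := -(q * (g * n)))
        (fun e k => by rw [hFm (-(q * g)), neg_mul, mul_assoc]) (hreach q)
    simpa [sub_eq_add_neg] using this
  -- The path `γ` goes from the highest to the lowest point of the component translated by n; its
  -- heights bound those of the component itself.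
  obtain ⟨yM, ⟨pM, hpM, rfl⟩, hM⟩ := (isCompact_snd_drawing (em := em) (F := F) (x := (v, k))).exists_isGreatest
    ⟨_, _, vtx_mem_drawing, rfl⟩
  obtain ⟨ym, ⟨pm, hpm, rfl⟩, hm⟩ := (isCompact_snd_drawing (em := em) (F := F) (x := (v, k))).exists_isLeast
    ⟨_, _, vtx_mem_drawing, rfl⟩
  obtain ⟨γ, hγ⟩ := joinedIn_drawing (add_mem_drawing hF hpM) (add_mem_drawing hF hpm)
  obtain ⟨B, hB⟩ : ∃ B : ℝ, ∀ s, |(γ s).1| ≤ B := by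
    have : IsCompact (Set.range fun s => |(γ s).1|) := isCompact_range (by fun_prop)
    obtain ⟨B, hB⟩ := this.bddAbove
    exact ⟨B, fun s => hB ⟨s, rfl⟩⟩
  -- `q` is so large that the translates of the vertex by -q g n and q g n are to the left and to
  -- the right of `γ`; the path `δ` joins them inside the component and has to meet `γ`.
  obtain ⟨q, hq⟩ := exists_nat_gt (B + |(em.vtx (v, k)).1|)
  have hgn : (1 : ℝ) ≤ g * n := by exact_mod_cast (by nlinarith : (1 : ℤ) ≤ g * n)
  have hqg : (q : ℝ) ≤ q * (g * n) := le_mul_of_one_le_right (Nat.cast_nonneg _) hgn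
  obtain ⟨δ, hδ⟩ := joinedIn_drawing (em := em) (F := F) (x := (v, k))
    (p := em.vtx (v, k - q * (g * n))) (q := em.vtx (v, k + q * (g * n)))
    (Or.inl ⟨_, (hreach' q).symm, rfl⟩) (Or.inl ⟨_, hreach q, rfl⟩)
  have hv : ∀ l : ℤ, (em.vtx (v, l)).1 = (em.vtx (v, k)).1 + (l - k) := by
    intro l; simp [vtx]
  have habs := abs_le.1 (le_refl |(em.vtx (v, k)).1|)
  obtain ⟨s, t, hst⟩ := exists_eq_of_crossing γ.continuous δ.continuous
    (fun s => by
      rw [δ.source, hv]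
      push_cast
      have := abs_le.1 (hB s)
      linarith)
    (fun s => by
      rw [δ.target, hv]
      push_cast
      have := abs_le.1 (hB s)
      linarith)
    (fun t => by
      rw [γ.source]
      simpa using hM ⟨_, hδ t, rfl⟩)
    (fun t => by
      rw [γ.target]
      simpa using hm ⟨_, hδ t, rfl⟩)
  exact (reachable_of_mem_drawing (hγ s) (hst ▸ hδ t)).symm

end PeriodicGraph.PlanarEmbedding

/-! ### The action of nℤ: 𝒢 as a cover of 𝒢/nℤ -/

namespace PeriodicGraph

section Power

variable {V E : Type*} (G : PeriodicGraph V E) (n : ℕ) [NeZero n]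

/-- The graph `𝒢` with the action of `nℤ`, as a periodic graph with quotient `𝒢/nℤ`. -/
def power : PeriodicGraph (V × ZMod n) (E × ZMod n) where
  src x := (G.src x.1, x.2)
  tgt x := (G.tgt x.1, x.2 + (G.shift x.1 : ZMod n))
  -- With representatives of ℤ/nℤ in [0, n), this division is exact and counts the passages of the
  -- edge through the cut between n - 1 and n.
  shift x := ((x.2.val : ℤ) + G.shift x.1 - ((x.2 + (G.shift x.1 : ZMod n)).val : ℤ)) / n

theorem val_add_eq (k : ZMod n) (s : ℤ) :
    (k.val : ℤ) + s = ((k + (s : ZMod n)).val : ℤ) +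
      n * (((k.val : ℤ) + s - ((k + (s : ZMod n)).val : ℤ)) / n) := by
  have hdvd : (n : ℤ) ∣ (k.val : ℤ) + s - ((k + (s : ZMod n)).val : ℤ) := by
    rw [← ZMod.intCast_zmod_eq_zero_iff_dvd]
    push_cast
    simp
  rw [Int.mul_ediv_cancel' hdvd]
  ring

variable {n}

theorem power_shift (x : E × ZMod n) :
    ((G.power n).src x).2.val + G.shift x.1 =
      (((G.power n).tgt x).2.val : ℤ) + n * (G.power n).shift x :=
  val_add_eq n x.2 (G.shift x.1)

theorem base_power : (G.power n).base = G.quotient n := rfl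

/-- The vertices of the cover of `𝒢/nℤ` as vertices of `𝒢`. -/
def unroll {V : Type*} {n : ℕ} (x : (V × ZMod n) × ℤ) : V × ℤ := (x.1.1, x.1.2.val + n * x.2)

/-- The vertices of `𝒢` as vertices of the cover of `𝒢/nℤ`. -/
def roll {V : Type*} (n : ℕ) (x : V × ℤ) : (V × ZMod n) × ℤ := ((x.1, (x.2 : ZMod n)), x.2 / n)

theorem unroll_roll (x : V × ℤ) : unroll (roll n x) = x := by
  refine Prod.ext rfl ?_
  simp only [unroll, roll, ZMod.val_intCast]
  exact Int.emod_add_mul_ediv _ _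

theorem roll_unroll (x : (V × ZMod n) × ℤ) : roll n (unroll x) = x := by
  have hn : (0 : ℤ) < n := by exact_mod_cast NeZero.pos n
  refine Prod.ext (Prod.ext rfl ?_) ?_
  · simp [unroll, roll]
  · simp only [unroll, roll]
    rw [Int.add_mul_ediv_left _ _ hn.ne', Int.ediv_eq_zero_of_lt (by positivity)
      (by exact_mod_cast ZMod.val_lt _), zero_add]

theorem unroll_src (a : (E × ZMod n) × ℤ) :
    unroll ((G.power n).cover.src a) = G.cover.src (unroll a) := rfl

theorem unroll_tgt (a : (E × ZMod n) × ℤ) :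
    unroll ((G.power n).cover.tgt a) = G.cover.tgt (unroll a) := by
  refine Prod.ext rfl ?_
  have := G.power_shift a.1
  simp only [unroll, cover] at this ⊢
  rw [mul_add]
  change _ = (((G.power n).src a.1).2.val : ℤ) + n * a.2 + G.shift a.1.1
  linarith

theorem unroll_mem_lift {F : Set (E × ZMod n)} (a : (E × ZMod n) × ℤ) :
    unroll a ∈ lift n F ↔ a.1 ∈ F := by
  simp [unroll, lift]

variable {G}

theorem reachable_unroll {F : Set (E × ZMod n)} {x y : (V × ZMod n) × ℤ} :
    (G.cover.spanned (lift n F)).Reachable (unroll x) (unroll y) ↔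
      ((G.power n).coverGraph F).Reachable x y := by
  constructor
  · intro h
    rw [← roll_unroll x, ← roll_unroll y]
    refine G.cover.reachable_map (G.power n).cover (roll n) (fun a ha => ?_) h
    have h1 : (roll n a).1 ∈ F := by rwa [← unroll_mem_lift, unroll_roll]
    have := (G.power n).cover.reachable_edge (F := Prod.fst ⁻¹' F) (e := roll n a) h1
    rw [← roll_unroll ((G.power n).cover.src _), ← roll_unroll ((G.power n).cover.tgt _),
      unroll_src, unroll_tgt, unroll_roll] at this
    exact this
  · refine (G.power n).cover.reachable_map G.cover unroll (fun a ha => ?_)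
    rw [unroll_src, unroll_tgt]
    exact G.cover.reachable_edge ((unroll_mem_lift a).2 ha)

theorem lift_periodic (F : Set (E × ZMod n)) (e : E) (k : ℤ) :
    (e, k) ∈ lift n F ↔ (e, k + n) ∈ lift n F := by
  simp [lift]

theorem annular_of_planarEmbedding [Finite V] [Finite E] (em : G.PlanarEmbedding) : G.Annular := by
  intro F v g hg h
  have := em.reachable_add_of_reachable (F := Prod.fst ⁻¹' F) (n := 1) one_pos (by simp) (v := v)
    (k := 0) hg (by simpa using h)
  simpa using this

theorem annular_power [Finite V] [Finite E] (em : G.PlanarEmbedding) : (G.power n).Annular := by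
  have hn : (0 : ℤ) < n := by exact_mod_cast NeZero.pos n
  intro F v g hg h
  rw [← reachable_unroll] at h ⊢
  simp only [unroll, mul_zero, add_zero, mul_one] at h ⊢
  exact em.reachable_add_of_reachable hn (lift_periodic F) hg (by rwa [mul_comm])

theorem winds_power_iff {F : Set (E × ZMod n)} : (G.power n).Winds F ↔
    ∀ (v : V) (k : ℤ), (G.cover.spanned (lift n F)).Reachable (v, k) (v, k + n) := by
  constructor
  · intro h v k
    have := (reachable_unroll (G := G)).2 (h.reachable (v, (k : ZMod n)) (k / n) (k / n + 1))
    convert this using 1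
    · exact (unroll_roll (n := n) (v, k)).symm
    · rw [← unroll_roll (n := n) (v, k + n)]
      have hn : (n : ℤ) ≠ 0 := by exact_mod_cast NeZero.ne n
      simp [roll, Int.add_ediv_of_dvd_right, Int.ediv_self hn]
  · intro h v
    rw [← reachable_unroll]
    simpa [unroll] using h v.1 v.2.val

end Power

/-! ### Cycle-rooted spanning forests as coefficients -/

section Count

variable {V E : Type*} [Fintype V] [Fintype E] {H : PeriodicGraph V E}

/-- On functions supported in one component, d(2) is injective and only the edges of that component
matter. So there are at least as many edges as vertices. -/
theorem Winds.card_supp_le {F : Set E} (hF : H.Winds F)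
    (K : (H.base.spanned F).ConnectedComponent) :
    K.supp.ncard ≤ {e ∈ F | H.base.src e ∈ K.supp}.ncard := by
  let ext : (K.supp → ℝ) →ₗ[ℝ] (V → ℝ) := Function.ExtendByZero.linearMap ℝ Subtype.val
  let z : ℝˣ := Units.mk0 2 two_ne_zero
  let d : (K.supp → ℝ) →ₗ[ℝ] ({e ∈ F | H.base.src e ∈ K.supp} → ℝ) :=
    (LinearMap.funLeft ℝ ℝ Subtype.val).comp ((H.incidence z).mulVecLin.comp ext)
  have hext : ∀ (f : K.supp → ℝ) (v : K.supp), ext f v = f v := fun f v => by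
    simp [ext]
  have hext0 : ∀ (f : K.supp → ℝ) (v : V), v ∉ K.supp → ext f v = 0 := fun f v hv => by
    simp only [ext, Function.ExtendByZero.linearMap_apply]
    rw [Function.extend_apply']
    · rfl
    · rintro ⟨a, rfl⟩; exact hv a.2
  have hd : Function.Injective d := by
    rw [injective_iff_map_eq_zero]
    intro f hf
    have h0 : ext f = 0 := by
      refine hF.eq_zero_of_incidence (z := z) (by norm_num [z]) fun e he => ?_
      by_cases hK : H.base.src e ∈ K.supp
      · exact congrFun hf ⟨e, he, hK⟩
      · have h1 := H.base.reachable_edge he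
        have hK' : H.base.tgt e ∉ K.supp := by
          intro h
          apply hK
          rw [SimpleGraph.ConnectedComponent.mem_supp_iff] at h ⊢
          rw [← h]
          exact SimpleGraph.ConnectedComponent.sound h1
        rw [incidence_mulVec]
        change _ * ext f (H.base.tgt e) - ext f (H.base.src e) = 0
        rw [hext0 f _ hK', hext0 f _ hK]
        simp
    funext v
    rw [← hext f v, h0]; rfl
  have := LinearMap.finrank_le_finrank_of_injective hd
  rwa [Module.finrank_fintype_fun_eq_card, Module.finrank_fintype_fun_eq_card,
    ← Nat.card_eq_fintype_card, ← Nat.card_eq_fintype_card] at this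

/-- Each component has at least as many edges as vertices, so equality of the totals forces equality
in every component. -/
theorem isCRSF_iff_of_winds {F : Set E} (hF : H.Winds F) :
    H.base.IsCRSF F ↔ F.ncard = Fintype.card V := by
  have hV : ∑ K : (H.base.spanned F).ConnectedComponent, K.supp.ncard = Fintype.card V := by
    rw [← Finset.card_univ, Finset.card_eq_sum_card_fiberwise
      (f := (H.base.spanned F).connectedComponentMk) (t := Finset.univ) (by simp)]
    refine Finset.sum_congr rfl fun K _ => ?_
    rw [Set.ncard_eq_toFinset_card']
    congr 1
    ext v
    simp
  have hE : ∑ K : (H.base.spanned F).ConnectedComponent,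
      {e ∈ F | H.base.src e ∈ K.supp}.ncard = F.ncard := by
    rw [Set.ncard_eq_toFinset_card' F, Finset.card_eq_sum_card_fiberwise
      (f := fun e => (H.base.spanned F).connectedComponentMk (H.base.src e)) (t := Finset.univ)
      (by simp)]
    refine Finset.sum_congr rfl fun K _ => ?_
    rw [Set.ncard_eq_toFinset_card']
    congr 1
    ext v
    simp
  constructor
  · intro h
    rw [← hV, ← hE]
    exact Finset.sum_congr rfl fun K _ => h K
  · intro h K
    rw [← hV, ← hE] at h
    exact ((Finset.sum_eq_sum_iff_of_le fun K _ => hF.card_supp_le K).1 h.symm K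
      (Finset.mem_univ _)).symm

variable [DecidableEq V] [DecidableEq E]

theorem mem_crsf_iff {G : PeriodicGraph V E} {n : ℕ} [NeZero n] {j : ℕ}
    (F : Finset (E × ZMod n)) : (F : Set (E × ZMod n)) ∈ G.crsf j n ↔
      (G.power n).Good F ∧ (G.power n).base.numComponents (F : Set (E × ZMod n)) = j := by
  have h1 : (G.power n).Good F ↔
      (G.quotient n).IsCRSF (F : Set (E × ZMod n)) ∧ (G.power n).Winds F := by
    rw [Good, ← base_power]
    constructor
    · rintro ⟨h, hw⟩
      exact ⟨(isCRSF_iff_of_winds hw).2 (by rwa [Set.ncard_coe_finset]), hw⟩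
    · rintro ⟨h, hw⟩
      refine ⟨?_, hw⟩
      rw [← Set.ncard_coe_finset]
      exact (isCRSF_iff_of_winds hw).1 h
  rw [h1, winds_power_iff]
  simp only [crsf, Set.mem_ofPred_eq, base_power]
  tauto

theorem weightedSum_eq_sum {R : Type*} [Fintype R] [DecidableEq R] (c : E → ℝ)
    (S : Set (Set (E × R))) : weightedSum c S =
      ∑ F ∈ Finset.univ.filter (fun F : Finset (E × R) => (F : Set (E × R)) ∈ S),
        ∏ x ∈ F, c x.1 := by
  have h1 : weightedSum c S = ∑ᶠ F ∈ {F : Finset (E × R) | (F : Set (E × R)) ∈ S},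
      ∏ x ∈ F, c x.1 := by
    refine (finsum_mem_eq_of_bijOn (fun F : Finset (E × R) => (F : Set (E × R))) ⟨?_, ?_, ?_⟩
      ?_).symm
    · intro F hF; exact hF
    · intro F _ F' _ h; exact Finset.coe_injective h
    · intro ω hω
      exact ⟨ω.toFinset, by simpa using hω, by simp⟩
    · intro F _
      exact (finprod_mem_coe_finset _ _).symm
  rw [h1, finsum_mem_eq_finite_toFinset_sum _ (Set.toFinite _)]
  refine Finset.sum_congr ?_ fun _ _ => rfl
  ext F
  simp

theorem forestPoly_coeff (c : E → ℝ) (j : ℕ) : (H.forestPoly c).coeff j =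
    ∑ F : Finset E with H.Good F ∧ H.base.numComponents (F : Set E) = j, ∏ e ∈ F, c e := by
  rw [forestPoly, Polynomial.finsetSum_coeff, ← Finset.filter_filter, Finset.sum_filter (p := fun F : Finset E => H.base.numComponents (F : Set E) = j)]
  refine Finset.sum_congr rfl fun F _ => ?_
  rw [Polynomial.coeff_C_mul, Polynomial.coeff_X_pow]
  simp [eq_comm]

theorem crsfSum_eq_coeff (G : PeriodicGraph V E) (c : E → ℝ) (j n : ℕ) [NeZero n] :
    G.crsfSum c j n = ((G.power n).forestPoly fun x => c x.1).coeff j := by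
  rw [crsfSum, weightedSum_eq_sum, forestPoly_coeff]
  refine Finset.sum_congr ?_ fun _ _ => rfl
  ext F
  simp only [Finset.mem_filter, Finset.mem_univ, true_and]
  exact mem_crsf_iff F

end Count

end PeriodicGraph

/-! ### Floquet decomposition of the Laplacian of 𝒢/nℤ -/

namespace PeriodicGraph

open LaurentPolynomial

variable {V E : Type*} [Fintype V] [DecidableEq V] [Fintype E] [DecidableEq E]

/-- The Laplacian at a given point `z`. -/
def laplacianAt (H : PeriodicGraph V E) (c : E → ℝ) (z : ℂˣ) : Matrix V V ℂ :=
  (H.incidence z⁻¹).transpose * Matrix.diagonal (fun e => (c e : ℂ)) * H.incidence z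

variable (H : PeriodicGraph V E) (c : E → ℝ)

theorem eval₂_charPoly (z : ℂˣ) :
    eval₂ (algebraMap ℝ ℂ) z (H.charPoly c) = (H.laplacianAt c z).det := by
  have hz : Units.map ((eval₂ (algebraMap ℝ ℂ) z : LaurentPolynomial ℝ →+* ℂ) : LaurentPolynomial ℝ →* ℂ)
      (unitT ℝ) = z := by
    ext1
    exact (eval₂_T _ _ 1).trans (by simp)
  have hz' : Units.map (((eval₂ (algebraMap ℝ ℂ) z).comp
      (invert : LaurentPolynomial ℝ ≃ₐ[ℝ] _).toRingEquiv.toRingHom : LaurentPolynomial ℝ →+* ℂ) :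
        LaurentPolynomial ℝ →* ℂ) (unitT ℝ) =
      z⁻¹ := by
    ext1
    refine (congrArg (eval₂ (algebraMap ℝ ℂ) z) (invert_T (R := ℝ) 1)).trans ?_
    exact (eval₂_T _ _ (-1)).trans (by simp)
  rw [charPoly, RingHom.map_det]
  congr 1
  rw [laplacian, dMatrix_eq, RingHom.mapMatrix_apply, Matrix.map_mul, Matrix.map_mul, laplacianAt,
    incidence_map, hz, Matrix.diagonal_map (map_zero _), ← hz', ← incidence_map]
  congr 2
  simp only [eval₂_C]
  rfl

theorem det_laplacianAt_eq {H : PeriodicGraph V E} (hH : H.Annular) (z : ℂˣ) :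
    (H.laplacianAt c z).det = Polynomial.aeval (2 - (z : ℂ) - (z : ℂ)⁻¹) (H.forestPoly c) := by
  rw [← eval₂_charPoly, charPoly_eq hH]
  have h : ∀ Q : Polynomial ℝ, eval₂ (algebraMap ℝ ℂ) z
      (Polynomial.aeval (2 - T 1 - T (-1) : LaurentPolynomial ℝ) Q) =
      Polynomial.aeval (2 - (z : ℂ) - (z : ℂ)⁻¹) Q := by
    intro Q
    rw [Polynomial.aeval_def, Polynomial.hom_eval₂, Polynomial.aeval_def]
    congr 1
    · ext r
      simp [eval₂_C]
    · rw [map_sub, map_sub, map_ofNat, eval₂_T, eval₂_T]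
      simp
  exact h _

section Product

variable (G : PeriodicGraph V E) {n : ℕ} [NeZero n] (μ : ZMod n → ℂˣ)

/-- The change of basis to functions that are multiplied by `μ l` under translation. -/
def fourier (X : Type*) [DecidableEq X] : Matrix (X × ZMod n) (X × ZMod n) ℂ :=
  Matrix.of fun x y => if x.1 = y.1 then ((μ y.2 ^ (x.2.val : ℤ) : ℂˣ) : ℂ) else 0

theorem fourier_mul_blockDiagonal {X Y : Type*} [DecidableEq X] [Fintype X] [DecidableEq Y]
    (M : ZMod n → Matrix X Y ℂ) (x : X × ZMod n) (y : Y × ZMod n) :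
    (fourier μ X * Matrix.blockDiagonal M) x y =
      ((μ y.2 ^ (x.2.val : ℤ) : ℂˣ) : ℂ) * M y.2 x.1 y.1 := by
  rw [Matrix.mul_apply, Fintype.sum_prod_type]
  simp [fourier, Matrix.blockDiagonal_apply]

/-- A function multiplied by μ under translation by 1 is multiplied by μ^n = w under translation by
n. On such functions the operator of 𝒢/nℤ at w acts as that of 𝒢₁ at μ. -/
theorem incidence_power_mul_fourier {w : ℂˣ} (hμ : ∀ l, μ l ^ n = w) :
    (G.power n).incidence w * fourier μ V =
      fourier μ E * Matrix.blockDiagonal fun l => G.incidence (μ l) := by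
  ext x y
  rw [fourier_mul_blockDiagonal]
  have h1 : ((G.power n).incidence w * fourier μ V) x y =
      ((G.power n).incidence w).mulVec (fun v => fourier μ V v y) x := rfl
  rw [h1, incidence_mulVec]
  have hs := G.power_shift x
  have h2 : w ^ (G.power n).shift x * μ y.2 ^ (((G.power n).tgt x).2.val : ℤ) =
      μ y.2 ^ (x.2.val : ℤ) * μ y.2 ^ G.shift x.1 := by
    rw [← hμ y.2, ← zpow_natCast, ← zpow_mul, ← zpow_add, ← zpow_add]
    congr 1
    have : ((G.power n).src x).2 = x.2 := rfl
    rw [this] at hs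
    linarith
  simp only [fourier, Matrix.of_apply, incidence, mul_sub, mul_ite, mul_one, mul_zero]
  rw [← Units.val_mul, h2]
  have h3 : ((G.power n).tgt x).1 = G.tgt x.1 := rfl
  have h4 : (G.power n).src x = (G.src x.1, x.2) := rfl
  rw [h3, h4, Units.val_mul]
  simp only [eq_comm]

theorem incidence_power_transpose_mul_fourier {w : ℂˣ} (hμ : ∀ l, μ l ^ n = w) :
    ((G.power n).incidence w⁻¹).transpose * Matrix.diagonal (fun e : E × ZMod n => (c e.1 : ℂ)) *
        fourier μ E =
      fourier μ V * Matrix.blockDiagonal fun l =>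
        (G.incidence (μ l)⁻¹).transpose * Matrix.diagonal (fun e => (c e : ℂ)) := by
  ext x y
  rw [fourier_mul_blockDiagonal, Matrix.mul_apply, Fintype.sum_prod_type]
  simp only [Matrix.mul_diagonal, fourier, Matrix.of_apply, Matrix.transpose_apply, mul_ite,
    mul_zero]
  rw [Finset.sum_comm]
  simp only [Finset.sum_ite_eq', Finset.mem_univ, if_true]
  simp only [incidence, Matrix.of_apply, sub_mul, Finset.sum_sub_distrib, mul_sub]
  congr 1
  -- Among the translates of the edge only one has its target in the slab of `x`, namely the one
  -- that starts `G.shift y.1` slabs earlier.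
  · rw [Finset.sum_eq_single (x.2 - (G.shift y.1 : ZMod n))]
    · have h1 : (G.power n).tgt (y.1, x.2 - (G.shift y.1 : ZMod n)) = (G.tgt y.1, x.2) := by
        simp [power]
      have hs := G.power_shift (y.1, x.2 - (G.shift y.1 : ZMod n))
      rw [h1] at hs
      have h0 : ((G.power n).src (y.1, x.2 - (G.shift y.1 : ZMod n))).2 =
        x.2 - (G.shift y.1 : ZMod n) := rfl
      rw [h0] at hs
      rw [h1]
      have h2 : x = (G.tgt y.1, x.2) ↔ x.1 = G.tgt y.1 := by
        rw [Prod.ext_iff]; simp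
      simp only [h2]
      split_ifs
      · rw [mul_right_comm, ← Units.val_mul, ← mul_assoc, ← Units.val_mul]
        congr 2
        rw [← hμ y.2, ← zpow_natCast, inv_zpow, inv_zpow, ← zpow_mul, ← zpow_neg, ← zpow_neg,
          ← zpow_add, ← zpow_add]
        congr 1
        linarith
      · simp
    · intro i _ hi
      have : x ≠ (G.power n).tgt (y.1, i) := by
        rintro rfl
        simp [power] at hi
      simp [this]
    · simp
  · rw [Finset.sum_eq_single x.2]
    · have h2 : x = (G.power n).src (y.1, x.2) ↔ x.1 = G.src y.1 := by
        rw [Prod.ext_iff]; simp [power]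
      simp only [h2]
      split_ifs <;> simp [mul_comm]
    · intro i _ hi
      have : x ≠ (G.power n).src (y.1, i) := by
        rintro rfl
        simp [power] at hi
      simp [this]
    · simp

/-- Vandermonde: for each vertex of 𝒢₁, a row vector in the kernel is a polynomial of degree less
than n vanishing at the n distinct points μ l. -/
theorem det_fourier_ne_zero (hμ : Function.Injective μ) : (fourier μ V).det ≠ 0 := by
  intro h
  obtain ⟨a, ha, h0⟩ := Matrix.exists_vecMul_eq_zero_iff.2 h
  apply ha
  funext x
  let p : Polynomial ℂ := ∑ k : ZMod n, Polynomial.C (a (x.1, k)) * Polynomial.X ^ k.val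
  have hp : p = 0 := by
    refine Polynomial.eq_zero_of_natDegree_lt_card_of_eval_eq_zero p
      (f := fun l : ZMod n => ((μ l : ℂˣ) : ℂ)) (Units.val_injective.comp hμ) (fun l => ?_) ?_
    · have := congrFun h0 (x.1, l)
      simp only [Matrix.vecMul, dotProduct, fourier, Matrix.of_apply, Pi.zero_apply] at this
      rw [Fintype.sum_prod_type, Finset.sum_comm] at this
      simp only [mul_ite, mul_zero, Finset.sum_ite_eq', Finset.mem_univ, if_true,
        zpow_natCast, Units.val_pow_eq_pow_val] at this
      simpa only [p, Polynomial.eval_finsetSum, Polynomial.eval_mul, Polynomial.eval_C,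
        Polynomial.eval_pow, Polynomial.eval_X] using this
    · rw [ZMod.card]
      refine lt_of_le_of_lt (Polynomial.natDegree_sum_le _ _) ?_
      rw [Finset.fold_max_lt]
      refine ⟨NeZero.pos n, fun k _ => ?_⟩
      exact (Polynomial.natDegree_C_mul_X_pow_le _ _).trans_lt (ZMod.val_lt k)
  have hc := congrArg (fun q => Polynomial.coeff q x.2.val) hp
  simp only [p, Polynomial.finsetSum_coeff, Polynomial.coeff_C_mul, Polynomial.coeff_X_pow,
    Polynomial.coeff_zero] at hc
  rw [Finset.sum_eq_single x.2] at hc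
  · simpa using hc
  · intro k _ hk
    rw [if_neg, mul_zero]
    exact fun h => hk (ZMod.val_injective n h.symm)
  · simp

theorem det_laplacianAt_power {w : ℂˣ} (hμ : ∀ l, μ l ^ n = w) (hinj : Function.Injective μ) :
    ((G.power n).laplacianAt (fun x => c x.1) w).det = ∏ l, (G.laplacianAt c (μ l)).det := by
  have h : (G.power n).laplacianAt (fun x => c x.1) w * fourier μ V =
      fourier μ V * Matrix.blockDiagonal fun l => G.laplacianAt c (μ l) := by
    simp only [laplacianAt]
    rw [Matrix.mul_assoc, incidence_power_mul_fourier G μ hμ, ← Matrix.mul_assoc,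
      incidence_power_transpose_mul_fourier c G μ hμ, Matrix.mul_assoc,
      ← Matrix.blockDiagonal_mul]
  have h2 := congrArg Matrix.det h
  rw [Matrix.det_mul, Matrix.det_mul, Matrix.det_blockDiagonal, mul_comm] at h2
  exact mul_left_cancel₀ (det_fourier_ne_zero μ hinj) h2

end Product

end PeriodicGraph

/-! ### The linear matroid of d(z) -/

namespace PeriodicGraph

variable {V E : Type*} [Fintype V] [DecidableEq V] [Fintype E] [DecidableEq E]
  {K : Type*} [Field K] {H : PeriodicGraph V E}

/-- The row of `d(z)` at the edge `e`, as a linear form. -/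
def form (H : PeriodicGraph V E) (z : Kˣ) (e : E) : Module.Dual K (V → K) :=
  ((z ^ H.shift e : Kˣ) : K) • LinearMap.proj (H.tgt e) - LinearMap.proj (H.src e)

theorem form_apply (z : Kˣ) (e : E) (f : V → K) :
    H.form z e f = ((z ^ H.shift e : Kˣ) : K) * f (H.tgt e) - f (H.src e) := rfl

theorem form_eq_mulVec (z : Kˣ) (e : E) (f : V → K) :
    H.form z e f = (H.incidence z).mulVec f e := by
  rw [form_apply, incidence_mulVec]

/-- The functions annihilated by `d(z)` on the edges in `F`. -/
def nullspace (H : PeriodicGraph V E) (z : Kˣ) (F : Set E) : Submodule K (V → K) :=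
  (Submodule.span K (H.form z '' F)).dualCoannihilator

theorem mem_nullspace {z : Kˣ} {F : Set E} {f : V → K} :
    f ∈ H.nullspace z F ↔ ∀ e ∈ F, H.form z e f = 0 := by
  rw [nullspace, Submodule.mem_dualCoannihilator]
  constructor
  · exact fun h e he => h _ (Submodule.subset_span ⟨e, he, rfl⟩)
  · intro h φ hφ
    induction hφ using Submodule.span_induction with
    | mem x hx => obtain ⟨e, he, rfl⟩ := hx; exact h e he
    | zero => rfl
    | add x y _ _ hx hy => simp [hx, hy]
    | smul a x _ hx => simp [hx]

theorem finrank_span_add_finrank_nullspace (z : Kˣ) (F : Set E) :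
    Module.finrank K (Submodule.span K (H.form z '' F)) + Module.finrank K (H.nullspace z F) =
      Fintype.card V := by
  rw [nullspace, Subspace.finrank_add_finrank_dualCoannihilator_eq, Module.finrank_fintype_fun_eq_card]

/-- At z = 1 the forms represent the graphic matroid of 𝒢₁. Together with rank-nullity this
expresses numbers of components as ranks. -/
theorem finrank_nullspace_one (F : Set E) :
    Module.finrank K (H.nullspace (1 : Kˣ) F) = H.base.numComponents F := by
  let φ : ((H.base.spanned F).ConnectedComponent → K) →ₗ[K] (V → K) :=
    LinearMap.funLeft K K (H.base.spanned F).connectedComponentMk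
  have hφ : Function.Injective φ := by
    refine LinearMap.funLeft_injective_of_surjective K K _ ?_
    exact fun K => K.ind fun v => ⟨v, rfl⟩
  have hr : LinearMap.range φ = H.nullspace (1 : Kˣ) F := by
    ext f
    rw [mem_nullspace, LinearMap.mem_range]
    constructor
    · rintro ⟨g, rfl⟩ e he
      have h1 : (H.base.spanned F).connectedComponentMk (H.tgt e) =
          (H.base.spanned F).connectedComponentMk (H.src e) :=
        SimpleGraph.ConnectedComponent.sound (H.base.reachable_edge he).symm
      simp [form_apply, φ, LinearMap.funLeft_apply, h1]
    · intro h
      have h' : ∀ u v, (H.base.spanned F).Reachable u v → f u = f v := by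
        intro u v huv
        refine H.base.eq_of_reachable f (fun e he => ?_) huv
        have := h e he
        simp only [form_apply, one_zpow, Units.val_one, one_mul] at this
        exact (sub_eq_zero.1 this).symm
      refine ⟨fun K => K.lift f (fun u v p _ => h' u v p.reachable), ?_⟩
      rfl
  rw [← hr, LinearMap.finrank_range_of_inj hφ, Module.finrank_fintype_fun_eq_card,
    EdgeGraph.numComponents, Nat.card_eq_fintype_card]

theorem nullspace_eq_bot_iff (hH : H.Annular) {z : Kˣ} (hz : (z : K) ≠ 1) (F : Set E) :
    H.nullspace z F = ⊥ ↔ H.Winds F := by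
  constructor
  · intro h
    by_contra hF
    obtain ⟨f, hf, hf0⟩ := exists_kernel_of_not_winds hH hF z
    have : f ∈ H.nullspace z F := mem_nullspace.2 fun e he => by rw [form_eq_mulVec, hf0 e he]
    rw [h, Submodule.mem_bot] at this
    exact hf this
  · intro hF
    rw [eq_bot_iff]
    intro f hf
    rw [Submodule.mem_bot]
    exact hF.eq_zero_of_incidence hz fun e he => by
      rw [← form_eq_mulVec, mem_nullspace.1 hf e he]

theorem finrank_span_eq_card {z : Kˣ} {F : Finset E}
    (hF : LinearIndepOn K (H.form z) (F : Set E)) :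
    Module.finrank K (Submodule.span K (H.form z '' F)) = F.card := by
  have := _root_.finrank_span_eq_card hF.linearIndependent
  rw [← Set.image_eq_range] at this
  simpa using this

/-- The good sets are the bases of the linear matroid of `d(z)`. -/
theorem good_iff (hH : H.Annular) {z : Kˣ} (hz : (z : K) ≠ 1) (F : Finset E) :
    H.Good F ↔ F.card = Fintype.card V ∧ LinearIndepOn K (H.form z) (F : Set E) := by
  refine and_congr_right fun hc => ?_
  rw [← nullspace_eq_bot_iff hH hz, ← Submodule.finrank_eq_zero]
  have h1 := H.finrank_span_add_finrank_nullspace z (F : Set E)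
  constructor
  · intro h
    rw [h, add_zero] at h1
    rw [LinearIndepOn, linearIndependent_iff_card_eq_finrank_span, Set.finrank]
    rw [show (Set.range fun x : (F : Set E) => H.form z x) = H.form z '' F by
      rw [Set.image_eq_range], h1]
    simpa using hc
  · intro h
    rw [finrank_span_eq_card h] at h1
    omega

/-- By `nullspace_eq_bot_iff` a winding set spans all forms, so an independent subset extends within
it to a basis, and the bases are the good sets. -/
theorem exists_good_of_linearIndepOn (hH : H.Annular) {z : Kˣ} (hz : (z : K) ≠ 1) {I S : Set E}
    (hI : LinearIndepOn K (H.form z) I) (hIS : I ⊆ S) (hS : H.Winds S) :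
    ∃ F : Finset E, H.Good F ∧ I ⊆ F ∧ (F : Set E) ⊆ S := by
  obtain ⟨b, hb, hIb, hspan, hli⟩ := exists_linearIndepOn_extension hI hIS
  refine ⟨b.toFinset, ?_, by simpa using hIb, by simpa using hb⟩
  rw [good_iff hH hz]
  have hb' : ((b.toFinset : Finset E) : Set E) = b := by simp
  refine ⟨?_, by rwa [hb']⟩
  have h1 := H.finrank_span_add_finrank_nullspace z ((b.toFinset : Finset E) : Set E)
  rw [finrank_span_eq_card (by rwa [hb'])] at h1
  have h2 : H.nullspace z ((b.toFinset : Finset E) : Set E) = ⊥ := by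
    rw [← (nullspace_eq_bot_iff hH hz S).2 hS, hb', nullspace, nullspace]
    congr 1
    refine le_antisymm (Submodule.span_mono (Set.image_mono hb)) (Submodule.span_le.2 hspan)
  rw [h2, finrank_bot] at h1
  omega

theorem exists_good_subset (hH : H.Annular) {S : Set E} (hS : H.Winds S) :
    ∃ F : Finset E, H.Good F ∧ (F : Set E) ⊆ S := by
  obtain ⟨F, h1, -, h2⟩ := exists_good_of_linearIndepOn (K := ℝ) hH
    (z := Units.mk0 2 two_ne_zero) (by simp) (linearIndepOn_empty ℝ (H.form _))
    (Set.empty_subset S) hS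
  exact ⟨F, h1, h2⟩

theorem winds_univ (hH : (H.cover.spanned Set.univ).Connected) : H.Winds Set.univ :=
  fun _ => hH.preconnected _ _

/-- Independence at `z = 1` persists for `z` near `1`. -/
theorem exists_linearIndepOn_of_one {I : Set E}
    (hI : LinearIndepOn ℝ (H.form (1 : ℝˣ)) I) :
    ∃ z : ℝˣ, (z : ℝ) ≠ 1 ∧ LinearIndepOn ℝ (H.form z) I := by
  -- The forms in coordinates along the curve z = exp u. Linear independence of a finite family is
  -- an open condition, so it holds for some u ≠ 0.
  let r : ℝ → I → V → ℝ := fun u e v =>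
    (if v = H.tgt e then Real.exp u ^ H.shift e else 0) - (if v = H.src e then 1 else 0)
  let Z : ℝ → ℝˣ := fun u => Units.mk0 (Real.exp u) (Real.exp_ne_zero u)
  have hZ1 : Z 0 = 1 := by ext; simp [Z]
  let ψ : Module.Dual ℝ (V → ℝ) →ₗ[ℝ] (V → ℝ) :=
    LinearMap.pi fun v => LinearMap.applyₗ (Pi.single v 1)
  have hψ : Function.Injective ψ := by
    intro a b hab
    refine LinearMap.pi_ext' fun v => ?_
    ext
    simpa [ψ] using congrFun hab v
  have hr : ∀ u, r u = ψ ∘ fun e : I => H.form (Z u) e := by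
    intro u
    funext e v
    simp [r, ψ, Z, form_apply, Pi.single_apply, eq_comm]
  have hli : ∀ u, LinearIndependent ℝ (r u) ↔ LinearIndepOn ℝ (H.form (Z u)) I := by
    intro u
    rw [hr, LinearIndepOn]
    exact LinearMap.linearIndependent_iff ψ (LinearMap.ker_eq_bot.2 hψ)
  have hcont : Continuous r := by
    refine continuous_pi fun e => continuous_pi fun v => ?_
    simp only [r]
    have : Continuous fun u => Real.exp u ^ H.shift e :=
      Real.continuous_exp.zpow₀ _ fun u => Or.inl (Real.exp_ne_zero u)
    split_ifs <;> fun_prop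
  have hopen := (isOpen_setOfPred_linearIndependent (𝕜 := ℝ) (E := V → ℝ) (ι := I)).preimage hcont
  have h0 : ∀ᶠ u in nhds (0 : ℝ), LinearIndependent ℝ (r u) := by
    refine hopen.mem_nhds ?_
    show LinearIndependent ℝ (r 0)
    rw [hli, hZ1]
    exact hI
  have h1 : ∀ᶠ u in nhdsWithin (0 : ℝ) {0}ᶜ, LinearIndependent ℝ (r u) ∧ u ≠ 0 :=
    (h0.filter_mono nhdsWithin_le_nhds).and self_mem_nhdsWithin
  obtain ⟨u, hu, hu0⟩ := h1.exists
  refine ⟨Z u, ?_, (hli u).1 hu⟩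
  simpa [Z] using hu0

end PeriodicGraph

/-! ### The forest polynomial, and its roots for 𝒢₁ and 𝒢_n -/

theorem Complex.exists_unit_two_sub_sub_inv (x : ℂ) : ∃ w : ℂˣ, 2 - (w : ℂ) - (w : ℂ)⁻¹ = x := by
  obtain ⟨s, hs⟩ := IsAlgClosed.exists_pow_nat_eq ((2 - x) ^ 2 - 4) two_pos
  have h : ((2 - x) + s) / 2 * (((2 - x) - s) / 2) = 1 := by linear_combination (-1 / 4) * hs
  refine ⟨Units.mkOfMulEqOne _ _ h, ?_⟩
  rw [← Units.val_inv_eq_inv_val]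
  show 2 - ((2 - x) + s) / 2 - (((2 - x) - s) / 2) = x
  ring

theorem IsPrimitiveRoot.prod_zmod_sub_pow_mul {n : ℕ} [NeZero n] {ζ : ℂ}
    (hζ : IsPrimitiveRoot ζ n) (x y : ℂ) :
    ∏ l : ZMod n, (x - ζ ^ l.val * y) = x ^ n - y ^ n := by
  have h := congrArg (Polynomial.eval x) (X_pow_sub_C_eq_prod hζ (NeZero.pos n) (rfl : y ^ n = y ^ n))
  simp only [Polynomial.eval_sub, Polynomial.eval_pow, Polynomial.eval_X, Polynomial.eval_C,
    Polynomial.eval_prod] at h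
  rw [h]
  refine Finset.prod_nbij' (fun l : ZMod n => l.val) (fun k : ℕ => (k : ZMod n)) ?_ ?_ ?_ ?_ ?_
  · intro l _
    simpa using ZMod.val_lt l
  · simp
  · intro l _
    simp
  · intro k hk
    exact ZMod.val_cast_of_lt (by simpa using hk)
  · intro l _
    rfl

namespace PeriodicGraph

variable {V E : Type*} [Fintype V] [DecidableEq V] [Fintype E] [DecidableEq E]
  {H : PeriodicGraph V E} {c : E → ℝ}

theorem forestPoly_coeff_nonneg (hc : ∀ e, 0 < c e) (j : ℕ) : 0 ≤ (H.forestPoly c).coeff j := by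
  rw [forestPoly_coeff]
  exact Finset.sum_nonneg fun F _ => Finset.prod_nonneg fun e _ => (hc e).le

theorem forestPoly_coeff_pos_iff (hc : ∀ e, 0 < c e) {j : ℕ} :
    0 < (H.forestPoly c).coeff j ↔
      ∃ F : Finset E, H.Good F ∧ H.base.numComponents (F : Set E) = j := by
  rw [forestPoly_coeff]
  constructor
  · intro h
    obtain ⟨F, hF, -⟩ := Finset.exists_ne_zero_of_sum_ne_zero h.ne'
    exact ⟨F, by simpa using hF⟩
  · rintro ⟨F, hF⟩
    exact Finset.sum_pos (fun F _ => Finset.prod_pos fun e _ => hc e) ⟨F, by simpa using hF⟩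

theorem forestPoly_coeff_eq_zero_iff (hc : ∀ e, 0 < c e) {j : ℕ} :
    (H.forestPoly c).coeff j = 0 ↔
      ∀ F : Finset E, H.Good F → H.base.numComponents (F : Set E) ≠ j := by
  rw [← not_iff_not, ← ne_eq, ne_comm, ← (forestPoly_coeff_nonneg hc j).lt_iff_ne,
    forestPoly_coeff_pos_iff hc]
  push Not
  rfl

theorem numComponents_pos [Nonempty V] (F : Set E) : 0 < H.base.numComponents F := by
  rw [EdgeGraph.numComponents]
  exact Nat.card_pos

theorem numComponents_le (F : Set E) : H.base.numComponents F ≤ Fintype.card V := by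
  rw [EdgeGraph.numComponents, Nat.card_eq_fintype_card]
  exact Fintype.card_le_of_surjective (H.base.spanned F).connectedComponentMk
    fun K => K.ind fun v => ⟨v, rfl⟩

theorem forestPoly_coeff_zero [Nonempty V] (c : E → ℝ) : (H.forestPoly c).coeff 0 = 0 := by
  rw [forestPoly_coeff]
  refine Finset.sum_eq_zero fun F hF => ?_
  exact absurd (Finset.mem_filter.1 hF).2.2 (numComponents_pos _).ne'

/-- The maximal number of components of a good set. -/
def maxComponents (H : PeriodicGraph V E) : ℕ :=
  (Finset.univ.filter H.Good).sup fun F => H.base.numComponents (F : Set E)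

theorem le_maxComponents {F : Finset E} (hF : H.Good F) :
    H.base.numComponents (F : Set E) ≤ H.maxComponents :=
  Finset.le_sup (f := fun F : Finset E => H.base.numComponents (F : Set E)) (by simpa using hF)

theorem exists_good_eq_maxComponents (h : ∃ F, H.Good F) :
    ∃ F, H.Good F ∧ H.base.numComponents (F : Set E) = H.maxComponents := by
  obtain ⟨F, hF⟩ := h
  obtain ⟨F', hF', h⟩ := Finset.exists_mem_eq_sup (Finset.univ.filter H.Good) ⟨F, by simpa using hF⟩
    fun F => H.base.numComponents (F : Set E)
  exact ⟨F', by simpa using hF', h.symm⟩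

theorem natDegree_forestPoly (hc : ∀ e, 0 < c e) (h : ∃ F, H.Good F) :
    (H.forestPoly c).natDegree = H.maxComponents := by
  refine le_antisymm (Polynomial.natDegree_le_iff_coeff_eq_zero.2 fun j hj => ?_) ?_
  · exact (forestPoly_coeff_eq_zero_iff hc).2 fun F hF h => (hj.trans_le h.ge).not_ge (le_maxComponents hF)
  · exact Polynomial.le_natDegree_of_ne_zero
      ((forestPoly_coeff_pos_iff hc).2 (exists_good_eq_maxComponents h)).ne'

theorem forestPoly_ne_zero (hc : ∀ e, 0 < c e) (h : ∃ F, H.Good F) : H.forestPoly c ≠ 0 := by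
  intro h0
  have := (forestPoly_coeff_pos_iff hc).2 (exists_good_eq_maxComponents h)
  simp [h0] at this

theorem leadingCoeff_forestPoly_pos (hc : ∀ e, 0 < c e) (h : ∃ F, H.Good F) :
    0 < (H.forestPoly c).leadingCoeff := by
  rw [Polynomial.leadingCoeff, natDegree_forestPoly hc h, forestPoly_coeff_pos_iff hc]
  exact exists_good_eq_maxComponents h

section Product

variable {G : PeriodicGraph V E} {n : ℕ} [NeZero n]

/-- The forest polynomial of `𝒢_n`. -/
def forestPolyPower (G : PeriodicGraph V E) (c : E → ℝ) (n : ℕ) [NeZero n] : Polynomial ℝ :=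
  (G.power n).forestPoly fun x => c x.1

theorem aeval_forestPolyPower (hG : G.Annular) (hGn : (G.power n).Annular) {ζ : ℂ}
    (hζ : IsPrimitiveRoot ζ n) (z : ℂˣ) :
    Polynomial.aeval (2 - (z : ℂ) ^ n - ((z : ℂ) ^ n)⁻¹) (G.forestPolyPower c n) =
      ∏ l : ZMod n, Polynomial.aeval (2 - ζ ^ l.val * z - (ζ ^ l.val * z)⁻¹) (G.forestPoly c) := by
  obtain ⟨u, rfl⟩ := hζ.isUnit (NeZero.ne n)
  have hu : IsPrimitiveRoot u n := hζ.of_map_of_injective (f := Units.coeHom ℂ) Units.val_injective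
  have h := det_laplacianAt_power c G (fun l : ZMod n => u ^ l.val * z) (w := z ^ n) ?_ ?_
  · rw [det_laplacianAt_eq _ hGn] at h
    rw [forestPolyPower]
    simpa only [det_laplacianAt_eq _ hG, Units.val_pow_eq_pow_val, Units.val_mul] using h
  · intro l
    rw [mul_pow, ← pow_mul, mul_comm l.val, pow_mul, hu.pow_eq_one, one_pow, one_mul]
  · intro l l' hl
    exact ZMod.val_injective n (hu.pow_inj (ZMod.val_lt _) (ZMod.val_lt _) (mul_right_cancel hl))

theorem aeval_forestPolyPower_eq_zero (hG : G.Annular) (hGn : (G.power n).Annular) {z : ℂˣ}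
    (hz : Polynomial.aeval (2 - (z : ℂ) - (z : ℂ)⁻¹) (G.forestPoly c) = 0) :
    Polynomial.aeval (2 - (z : ℂ) ^ n - ((z : ℂ) ^ n)⁻¹) (G.forestPolyPower c n) = 0 := by
  rw [aeval_forestPolyPower hG hGn (Complex.isPrimitiveRoot_exp n (NeZero.ne n))]
  exact Finset.prod_eq_zero (Finset.mem_univ 0) (by simpa using hz)

/-- Every x is 2 - z^n - z^(-n) for some z, and there Q_n is the product of the values of Q at the
points ζ^l z. Multiplying the linear factors over l replaces r by its n-th power. -/
theorem forestPolyPower_map_eq_prod (hG : G.Annular) (hGn : (G.power n).Annular) {ι : Type*}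
    [Fintype ι] {a : ℂ} {r : ι → ℂˣ}
    (h : (G.forestPoly c).map (algebraMap ℝ ℂ) = Polynomial.C a *
      ∏ i, (Polynomial.X - Polynomial.C (2 - (r i : ℂ) - (r i : ℂ)⁻¹))) :
    (G.forestPolyPower c n).map (algebraMap ℝ ℂ) = Polynomial.C (a ^ n) *
      ∏ i, (Polynomial.X - Polynomial.C (2 - (r i : ℂ) ^ n - ((r i : ℂ) ^ n)⁻¹)) := by
  refine Polynomial.funext fun x => ?_
  obtain ⟨w, rfl⟩ := Complex.exists_unit_two_sub_sub_inv x
  obtain ⟨z, hz⟩ := IsAlgClosed.exists_pow_nat_eq (w : ℂ) (NeZero.pos n)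
  have hz0 : z ≠ 0 := by
    rintro rfl
    rw [zero_pow (NeZero.ne n)] at hz
    exact w.ne_zero hz.symm
  rw [← hz]
  have hζ := Complex.isPrimitiveRoot_exp n (NeZero.ne n)
  set ζ := Complex.exp (2 * Real.pi * Complex.I / n)
  have hζ0 : ζ ≠ 0 := hζ.ne_zero (NeZero.ne n)
  have key := aeval_forestPolyPower (c := c) hG hGn hζ (Units.mk0 z hz0)
  simp only [Units.val_mk0] at key
  rw [Polynomial.eval_map_algebraMap, key]
  -- The splitting (2 - z - 1/z) - (2 - r - 1/r) = (r - z)(1 - 1/(z r)) makes the product over l a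
  -- product of two cyclotomic identities.
  have h1 : ∀ l : ZMod n, Polynomial.aeval (2 - ζ ^ l.val * z - (ζ ^ l.val * z)⁻¹) (G.forestPoly c) =
      a * ∏ i, (((r i : ℂ) - ζ ^ l.val * z) * (1 - ζ⁻¹ ^ l.val * (z * r i)⁻¹)) := by
    intro l
    rw [← Polynomial.eval_map_algebraMap, h, Polynomial.eval_mul, Polynomial.eval_C,
      Polynomial.eval_prod]
    congr 1
    refine Finset.prod_congr rfl fun i _ => ?_
    have := (r i).ne_zero
    simp only [Polynomial.eval_sub, Polynomial.eval_X, Polynomial.eval_C, inv_pow]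
    field_simp
    ring
  simp only [h1]
  rw [Finset.prod_mul_distrib, Finset.prod_const, Finset.card_univ, ZMod.card, Finset.prod_comm,
    Polynomial.eval_mul, Polynomial.eval_C, Polynomial.eval_prod]
  congr 1
  refine Finset.prod_congr rfl fun i _ => ?_
  rw [Finset.prod_mul_distrib, hζ.prod_zmod_sub_pow_mul, hζ.inv.prod_zmod_sub_pow_mul]
  have := (r i).ne_zero
  simp only [Polynomial.eval_sub, Polynomial.eval_X, Polynomial.eval_C]
  rw [one_pow, inv_pow, mul_pow]
  field_simp
  ring

/-- The factorization for 𝒢_n has as many linear factors as that for 𝒢₁, and its leading coefficient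
is the n-th power of a nonzero number. So the maximal number of components is the same for all n. -/
theorem natDegree_forestPolyPower (hG : G.Annular) (hGn : (G.power n).Annular)
    (h0 : G.forestPoly c ≠ 0) :
    (G.forestPolyPower c n).natDegree = (G.forestPoly c).natDegree := by
  set p := (G.forestPoly c).map (algebraMap ℝ ℂ) with hp
  have hsp := (IsAlgClosed.splits p).eq_prod_roots
  have hdeg : p.natDegree = (G.forestPoly c).natDegree := Polynomial.natDegree_map _
  have hlead : p.leadingCoeff ≠ 0 := by
    rw [Ne, Polynomial.leadingCoeff_eq_zero]
    exact (Polynomial.map_ne_zero_iff (algebraMap ℝ ℂ).injective).2 h0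
  choose w hw using Complex.exists_unit_two_sub_sub_inv
  let r : Fin p.roots.toList.length → ℂˣ := fun i => w (p.roots.toList.get i)
  have h1 : p = Polynomial.C p.leadingCoeff *
      ∏ i, (Polynomial.X - Polynomial.C (2 - (r i : ℂ) - (r i : ℂ)⁻¹)) := by
    conv_lhs => rw [hsp]
    congr 1
    simp only [r, hw]
    conv_lhs => rw [← Multiset.coe_toList p.roots, Multiset.map_coe, Multiset.prod_coe]
    exact (Fin.prod_univ_fun_getElem p.roots.toList
      fun x => Polynomial.X - Polynomial.C x).symm
  have h2 := forestPolyPower_map_eq_prod hG hGn h1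
  have h3 := congrArg Polynomial.natDegree h2
  rw [Polynomial.natDegree_map, Polynomial.natDegree_C_mul (pow_ne_zero _ hlead),
    Polynomial.natDegree_finsetProd_X_sub_C_eq_card] at h3
  rw [h3, ← hdeg, Finset.card_univ, Fintype.card_fin, Multiset.length_toList]
  exact (IsAlgClosed.splits p).natDegree_eq_card_roots.symm

end Product

end PeriodicGraph

/-! ### Roots near the positive ray -/

theorem Complex.norm_pow_sub_one_lt {y : ℂ} {m j : ℕ} (hm : 1 ≤ m) (hy : ‖y - 1‖ ≤ 1 / (2 * m))
    (hj : j ≤ m) : ‖y ^ j - 1‖ < 1 := by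
  have hm' : (0 : ℝ) < m := by exact_mod_cast hm
  have h1 : ∀ j : ℕ, ‖y ^ j - 1‖ ≤ (1 + 1 / (2 * (m : ℝ))) ^ j - 1 := by
    intro j
    induction j with
    | zero => simp
    | succ j ih =>
      have hyn : ‖y‖ ≤ 1 + 1 / (2 * (m : ℝ)) := by
        calc ‖y‖ = ‖1 + (y - 1)‖ := by ring_nf
          _ ≤ ‖(1 : ℂ)‖ + ‖y - 1‖ := norm_add_le _ _
          _ ≤ _ := by rw [norm_one]; gcongr
      calc ‖y ^ (j + 1) - 1‖ = ‖(y ^ j - 1) * y + (y - 1)‖ := by ring_nf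
        _ ≤ ‖y ^ j - 1‖ * ‖y‖ + ‖y - 1‖ := by
            rw [← norm_mul]; exact norm_add_le _ _
        _ ≤ ((1 + 1 / (2 * (m : ℝ))) ^ j - 1) * (1 + 1 / (2 * (m : ℝ))) + 1 / (2 * (m : ℝ)) := by
            gcongr
            exact sub_nonneg.2 (one_le_pow₀ (by simp))
        _ = _ := by ring
  refine (h1 j).trans_lt ?_
  have h2 : (1 + 1 / (2 * (m : ℝ))) ^ j ≤ (1 + 1 / (2 * (m : ℝ))) ^ m :=
    pow_le_pow_right₀ (by simp) hj
  have h3 : (1 + 1 / (2 * (m : ℝ))) ^ m ≤ Real.exp (1 / 2) := by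
    calc (1 + 1 / (2 * (m : ℝ))) ^ m ≤ (Real.exp (1 / (2 * m))) ^ m := by
          gcongr
          rw [add_comm]
          exact Real.add_one_le_exp _
      _ = Real.exp (1 / 2) := by
          rw [← Real.exp_nat_mul]
          congr 1
          field_simp
  have h4 : Real.exp (1 / 2) < 2 := by
    have h5 : Real.exp (1 / 2) ^ 2 = Real.exp 1 := by rw [← Real.exp_nat_mul]; norm_num
    have := Real.exp_one_lt_d9
    nlinarith [Real.exp_pos (1 / 2)]
  linarith

/-- For such y the powers y^j with j ≤ m have positive real part, so all the terms have nonnegative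
real part and the leading one a positive one. -/
theorem Polynomial.aeval_ne_zero_of_near_one {m : ℕ} (hm : 1 ≤ m) {Q : Polynomial ℝ}
    (hQ : ∀ j, 0 ≤ Q.coeff j) (hQ0 : Q ≠ 0) (hdeg : Q.natDegree ≤ m) {R : ℝ} (hR : 0 < R) {y : ℂ}
    (hy : ‖y - 1‖ ≤ 1 / (2 * m)) : Polynomial.aeval ((R : ℂ) * y) Q ≠ 0 := by
  intro h0
  rw [Polynomial.aeval_eq_sum_range' (Nat.lt_succ_of_le hdeg)] at h0
  have h1 := congrArg Complex.re h0
  rw [Complex.re_sum, Complex.zero_re] at h1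
  have hre : ∀ j ≤ m, 0 < (y ^ j).re := by
    intro j hj
    have h2 := Complex.norm_pow_sub_one_lt hm hy hj
    have h3 := (abs_lt.1 ((Complex.abs_re_le_norm _).trans_lt h2)).1
    simp at h3
    linarith
  have hterm : ∀ j, (Q.coeff j • ((R : ℂ) * y) ^ j).re = Q.coeff j * (R ^ j * (y ^ j).re) := by
    intro j
    rw [mul_pow, ← Complex.ofReal_pow, Complex.smul_re, Complex.re_ofReal_mul, smul_eq_mul]
  simp only [hterm] at h1
  have hnn : ∀ j ∈ Finset.range (m + 1), 0 ≤ Q.coeff j * (R ^ j * (y ^ j).re) := fun j hj =>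
    mul_nonneg (hQ j) (mul_nonneg (by positivity) (hre j (by simpa [Nat.lt_succ_iff] using hj)).le)
  have h2 := (Finset.sum_eq_zero_iff_of_nonneg hnn).1 h1 Q.natDegree
    (Finset.mem_range.2 (Nat.lt_succ_of_le hdeg))
  have h3 := hre _ hdeg
  have : Q.leadingCoeff ≠ 0 := Polynomial.leadingCoeff_ne_zero.2 hQ0
  exact (mul_ne_zero this (mul_ne_zero (pow_ne_zero _ hR.ne') h3.ne')) h2

/-- The multiples of |a| pass every odd multiple of π, and the first one beyond it overshoots by at
most |a|. -/
theorem Complex.exists_norm_exp_add_one_le {a : ℝ} (ha : a ≠ 0) (N : ℕ) :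
    ∃ n, N ≤ n ∧ ‖Complex.exp (a * Complex.I) ^ n + 1‖ ≤ |a| := by
  have ha' : 0 < |a| := abs_pos.2 ha
  obtain ⟨k, hk⟩ := exists_nat_ge (N * |a|)
  let X : ℝ := (2 * k + 1) * Real.pi
  have hX : 0 ≤ X := by positivity
  let n := ⌈X / |a|⌉₊
  have h1 : X ≤ n * |a| := by
    have := Nat.le_ceil (X / |a|)
    rwa [div_le_iff₀ ha'] at this
  have h2 : n * |a| ≤ X + |a| := by
    have := (Nat.ceil_lt_add_one (div_nonneg hX ha'.le)).le
    calc n * |a| ≤ (X / |a| + 1) * |a| := by gcongr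
      _ = X + |a| := by field_simp
  refine ⟨n, ?_, ?_⟩
  · have h3 : (N : ℝ) * |a| ≤ n * |a| := by
      refine hk.trans (le_trans ?_ h1)
      have := Real.pi_gt_three
      simp only [X]
      nlinarith [(Nat.cast_nonneg k : (0 : ℝ) ≤ k)]
    exact_mod_cast le_of_mul_le_mul_right h3 ha'
  · have hexp : ∀ s : ℝ, (s = 1 ∨ s = -1) → a = s * |a| →
        ‖Complex.exp (a * Complex.I) ^ n + 1‖ ≤ |a| := by
      intro s hs has
      have hm1 : Complex.exp ((s * X : ℝ) * Complex.I) = -1 := by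
        have hp : Complex.exp ((X : ℝ) * Complex.I) = -1 := by
          have : ((X : ℝ) : ℂ) * Complex.I = Real.pi * Complex.I + k * (2 * Real.pi * Complex.I) := by
            simp only [X]
            push_cast
            ring
          rw [this, Complex.exp_add, Complex.exp_pi_mul_I, Complex.exp_nat_mul_two_pi_mul_I,
            mul_one]
        rcases hs with rfl | rfl
        · simpa using hp
        · have : ((-1 * X : ℝ) : ℂ) * Complex.I = -((X : ℝ) * Complex.I) := by push_cast; ring
          rw [this, Complex.exp_neg, hp]
          norm_num
      have h4 : Complex.exp (a * Complex.I) ^ n + 1 =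
          -(Complex.exp (Complex.I * (s * (n * |a| - X) : ℝ)) - 1) := by
        have : Complex.exp (a * Complex.I) ^ n =
            Complex.exp ((s * X : ℝ) * Complex.I) *
              Complex.exp (Complex.I * (s * (n * |a| - X) : ℝ)) := by
          rw [← Complex.exp_nat_mul, ← Complex.exp_add]
          congr 1
          conv_lhs => rw [has]
          push_cast
          ring
        rw [this, hm1]
        ring
      rw [h4, norm_neg]
      refine (Real.norm_exp_I_mul_ofReal_sub_one_le).trans ?_
      have hs1 : |s| = 1 := by rcases hs with rfl | rfl <;> simp
      rw [Real.norm_eq_abs, abs_mul, hs1, one_mul, abs_le]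
      constructor <;> linarith
    rcases le_total 0 a with h | h
    · exact hexp 1 (Or.inl rfl) (by rw [abs_of_nonneg h]; ring)
    · exact hexp (-1) (Or.inr rfl) (by rw [abs_of_nonpos h]; ring)

/-- If the argument a of α were nonzero, some large power α^n would be within relative distance |a|
of the negative ray. Then 2 - α^n - α^(-n) would be too close to the positive ray for a root of a
polynomial of degree at most m with nonnegative coefficients. -/
theorem Complex.eq_norm_of_forall_aeval_eq_zero {m : ℕ} (hm : 1 ≤ m) {α : ℂ} (hα : 1 < ‖α‖)
    (hδ : ‖α - ‖α‖‖ ≤ ‖α‖ / (8 * m))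
    (hQ : ∀ n : ℕ, 1 ≤ n → ∃ Q : Polynomial ℝ, (∀ j, 0 ≤ Q.coeff j) ∧ Q ≠ 0 ∧ Q.natDegree ≤ m ∧
      Polynomial.aeval (2 - α ^ n - (α ^ n)⁻¹) Q = 0) :
    α = ‖α‖ := by
  have hm' : (0 : ℝ) < m := by exact_mod_cast hm
  have hα0 : 0 < ‖α‖ := by linarith
  have hpolar := Complex.norm_mul_exp_arg_mul_I α
  set a := Complex.arg α with ha_def
  by_cases ha : a = 0
  · rw [ha] at hpolar
    simpa using hpolar.symm
  exfalso
  have hnorm : (‖α‖ : ℂ) ≠ 0 := by exact_mod_cast hα0.ne'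
  have hu : Complex.exp (a * Complex.I) = α / ‖α‖ := by
    rw [eq_div_iff hnorm, mul_comm]
    exact hpolar
  have hangle : |a| ≤ 1 / (4 * m) := by
    have h1 : ‖Complex.exp (a * Complex.I) - 1‖ ≤ 1 / (8 * m) := by
      rw [hu, div_sub_one hnorm, norm_div, Complex.norm_real, norm_norm, div_le_iff₀ hα0]
      calc _ ≤ _ := hδ
        _ = _ := by ring
    have hne : Complex.exp (a * Complex.I) ≠ 0 := Complex.exp_ne_zero _
    have h2 := Complex.angle_le_mul_norm_sub (x := Complex.exp (a * Complex.I)) (y := 1)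
      (Complex.norm_exp_ofReal_mul_I a) (by simp)
    rw [Complex.angle_eq_abs_arg hne one_ne_zero, div_one, Complex.arg_exp_mul_I,
      toIocMod_eq_self Real.two_pi_pos |>.2] at h2
    · have := Real.pi_lt_four
      have h3 : Real.pi / 2 * ‖Complex.exp (a * Complex.I) - 1‖ ≤ 2 * (1 / (8 * m)) := by
        gcongr
        linarith
      calc |a| ≤ _ := h2
        _ ≤ _ := h3
        _ = _ := by field_simp; norm_num
    · have := Complex.arg_mem_Ioc α
      rw [← ha_def] at this
      constructor <;> linarith [this.1, this.2]
  -- The tolerance 1/(2m) is shared equally: |u + 1| ≤ |a| ≤ 1/(4m) for the direction, and 2q + q² ≤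
  -- 3q ≤ 1/(4m) for the terms that are small because q = |α|^(-n) is.
  have hsmall : ∃ N : ℕ, 1 ≤ N ∧ ∀ n, N ≤ n → (‖α‖⁻¹) ^ n ≤ 1 / (12 * m) := by
    have := (tendsto_pow_atTop_nhds_zero_of_lt_one (inv_nonneg.2 hα0.le)
      (inv_lt_one_of_one_lt₀ hα)).eventually (ge_mem_nhds (show (0 : ℝ) < 1 / (12 * m) by positivity))
    obtain ⟨N, hN⟩ := Filter.eventually_atTop.1 this
    exact ⟨max N 1, le_max_right _ _, fun n hn => hN n ((le_max_left _ _).trans hn)⟩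
  obtain ⟨N, hN1, hN⟩ := hsmall
  obtain ⟨n, hn, hexp⟩ := Complex.exists_norm_exp_add_one_le ha N
  obtain ⟨Q, hQ1, hQ2, hQ3, hQ4⟩ := hQ n (hN1.trans hn)
  let q : ℝ := (‖α‖⁻¹) ^ n
  have hq : q ≤ 1 / (12 * m) := hN n hn
  have hq0 : 0 < q := by positivity
  have hq1 : q ≤ 1 := pow_le_one₀ (inv_nonneg.2 hα0.le) (inv_le_one_of_one_le₀ hα.le)
  let u := Complex.exp (a * Complex.I) ^ n
  have hun : ‖u‖ = 1 := by simp [u, Complex.norm_exp_ofReal_mul_I]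
  have hu0 : u ≠ 0 := by rw [← norm_pos_iff, hun]; norm_num
  let y : ℂ := 2 * q - u - q ^ 2 * u⁻¹
  have hqc : (q : ℂ) ≠ 0 := by exact_mod_cast hq0.ne'
  have hαn : α ^ n = (q⁻¹ : ℝ) * u := by
    simp only [u, q]
    rw [hu, div_pow]
    push_cast
    rw [inv_pow, inv_inv]
    field_simp
  have hx : 2 - α ^ n - (α ^ n)⁻¹ = ((q⁻¹ : ℝ) : ℂ) * y := by
    rw [hαn]
    simp only [y]
    push_cast
    field_simp
  rw [hx] at hQ4
  refine Polynomial.aeval_ne_zero_of_near_one hm hQ1 hQ2 hQ3 (inv_pos.2 hq0) ?_ hQ4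
  calc ‖y - 1‖ = ‖-(u + 1) + (2 * q - q ^ 2 * u⁻¹)‖ := by simp only [y]; ring_nf
    _ ≤ ‖u + 1‖ + (‖2 * (q : ℂ)‖ + ‖(q : ℂ) ^ 2 * u⁻¹‖) := by
        refine (norm_add_le _ _).trans ?_
        rw [norm_neg]
        gcongr
        exact norm_sub_le _ _
    _ = ‖u + 1‖ + (2 * q + q ^ 2) := by
        simp [norm_inv, hun, abs_of_pos hq0]
    _ ≤ 1 / (4 * m) + 3 * (1 / (12 * m)) := by
        have : ‖u + 1‖ ≤ 1 / (4 * m) := hexp.trans hangle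
        nlinarith
    _ = 1 / (2 * m) := by field_simp; norm_num

/-- The roots come in pairs `α`, `α⁻¹`, are not on the unit circle unless `α = 1`, and those
that are close to the positive ray are on the positive ray. -/
theorem Complex.eq_norm_of_near_positive {m : ℕ} (hm : 1 ≤ m) {α : ℂ} (hα0 : α ≠ 0)
    (hδ : ‖α - ‖α‖‖ ≤ ‖α‖ / (8 * m))
    (hQ : ∀ n : ℕ, 1 ≤ n → ∃ Q : Polynomial ℝ, (∀ j, 0 ≤ Q.coeff j) ∧ Q ≠ 0 ∧ Q.natDegree ≤ m ∧
      Polynomial.aeval (2 - α ^ n - (α ^ n)⁻¹) Q = 0) :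
    α = ‖α‖ := by
  have hpos : 0 < ‖α‖ := norm_pos_iff.2 hα0
  rcases lt_trichotomy ‖α‖ 1 with h | h | h
  · have hinv : α⁻¹ = ‖α⁻¹‖ := by
      refine Complex.eq_norm_of_forall_aeval_eq_zero hm ?_ ?_ ?_
      · rw [norm_inv]
        exact (one_lt_inv₀ hpos).2 h
      · have hc : (‖α‖ : ℂ) ≠ 0 := by exact_mod_cast hpos.ne'
        have : α⁻¹ - (‖α⁻¹‖ : ℝ) = -(α - ‖α‖) / (α * ‖α‖) := by
          rw [norm_inv]
          push_cast
          field_simp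
          ring
        rw [this, norm_div, norm_neg, norm_mul, Complex.norm_real, norm_norm, norm_inv,
          div_le_iff₀ (by positivity)]
        calc _ ≤ _ := hδ
          _ = _ := by field_simp
      · intro n hn
        obtain ⟨Q, h1, h2, h3, h4⟩ := hQ n hn
        refine ⟨Q, h1, h2, h3, ?_⟩
        rw [inv_pow, inv_inv, ← h4]
        congr 1
        ring_nf
    rw [norm_inv, Complex.ofReal_inv] at hinv
    exact inv_injective hinv
  -- On the unit circle 2 - α - 1/α = 2 - 2 Re α is real and nonnegative. It cannot be a positive
  -- root, so α = 1.
  · obtain ⟨Q, h1, h2, h3, h4⟩ := hQ 1 le_rfl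
    rw [pow_one] at h4
    have hconj : α⁻¹ = (starRingEnd ℂ) α := Complex.inv_eq_conj h
    have hx : 2 - α - α⁻¹ = ((2 - 2 * α.re : ℝ) : ℂ) := by
      rw [hconj, sub_sub, Complex.add_conj]
      push_cast
      ring
    have hre : α.re ≤ 1 := by
      have := Complex.re_le_norm α
      rwa [h] at this
    have hre1 : α.re = 1 := by
      by_contra hne
      have hlt : 0 < 2 - 2 * α.re := by
        have := lt_of_le_of_ne hre hne
        linarith
      refine Polynomial.aeval_ne_zero_of_near_one hm h1 h2 h3 hlt (y := 1) (by simp) ?_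
      rw [mul_one, ← hx, h4]
    have him : α.im = 0 := by
      have := Complex.normSq_apply α
      rw [Complex.normSq_eq_norm_sq, h, hre1] at this
      nlinarith
    rw [h]
    exact Complex.ext (by simp [hre1]) (by simp [him])
  · exact Complex.eq_norm_of_forall_aeval_eq_zero hm h hδ hQ

/-! ### Deformation of polynomials with roots on the negative axis -/

theorem Complex.eq_norm_of_two_sub_sub_inv {z : ℂ} (hz : z ≠ 0) {s : ℝ} (hs : 0 ≤ s)
    (h : 2 - z - z⁻¹ = -(s : ℂ)) : z = ‖z‖ := by
  let D := Real.sqrt ((2 + s) ^ 2 - 4)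
  have hD : D ^ 2 = (2 + s) ^ 2 - 4 := Real.sq_sqrt (by nlinarith)
  have hD0 : 0 ≤ D := Real.sqrt_nonneg _
  have hDlt : D < 2 + s := by nlinarith
  have hq : z ^ 2 - (2 + s) * z + 1 = 0 := by
    field_simp at h
    linear_combination -h
  have hDc : (D : ℂ) ^ 2 = (2 + s) ^ 2 - 4 := by exact_mod_cast hD
  have hf : (z - ((2 + s + D) / 2 : ℝ)) * (z - ((2 + s - D) / 2 : ℝ)) = 0 := by
    push_cast
    linear_combination hq - hDc / 4
  have key : ∀ r : ℝ, 0 ≤ r → z - (r : ℂ) = 0 → z = ‖z‖ := by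
    intro r hr hzr
    rw [sub_eq_zero.1 hzr, Complex.norm_real, Real.norm_of_nonneg hr]
  rcases mul_eq_zero.1 hf with h1 | h1
  · exact key _ (by linarith) h1
  · exact key _ (by linarith) h1

theorem Complex.two_sub_sub_inv_eq_neg_norm {z : ℂ} (hz : z ≠ 0) (h : z = ‖z‖) :
    2 - z - z⁻¹ = -(‖2 - z - z⁻¹‖ : ℂ) := by
  have hpos : 0 < ‖z‖ := norm_pos_iff.2 hz
  have h1 : 2 - z - z⁻¹ = -(((1 - ‖z‖) ^ 2 / ‖z‖ : ℝ) : ℂ) := by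
    have hc : (‖z‖ : ℂ) ≠ 0 := by exact_mod_cast hpos.ne'
    conv_lhs => rw [h]
    push_cast
    field_simp
    ring
  rw [h1, norm_neg, Complex.norm_real, Real.norm_of_nonneg (by positivity)]

/-- Up to a factor 2, the point -‖x‖ is a nearest point to x on the negative axis. This bounds a
polynomial with roots on that axis from below, uniformly in the roots. -/
theorem Complex.norm_add_norm_div_two_le {x y : ℂ} (hy : y = -(‖y‖ : ℂ)) :
    ‖x + ‖x‖‖ / 2 ≤ ‖x - y‖ := by
  have h1 : ‖x + ‖x‖‖ ≤ ‖x - y‖ + ‖((‖x‖ - ‖y‖ : ℝ) : ℂ)‖ := by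
    have : x + ‖x‖ = (x - y) + ((‖x‖ - ‖y‖ : ℝ) : ℂ) := by
      push_cast
      linear_combination hy
    rw [this]
    exact norm_add_le _ _
  rw [Complex.norm_real, Real.norm_eq_abs] at h1
  have := abs_norm_sub_norm_le x y
  linarith

namespace Polynomial

/-- Continuity argument: the roots cannot leave the negative axis. -/
theorem forall_root_nonpos_of_deformation {m : ℕ} (hm : 1 ≤ m) {Q : unitInterval → Polynomial ℝ}
    (hcont : ∀ j, Continuous fun t => (Q t).coeff j) (hdeg : ∀ t, (Q t).natDegree = m)
    (hlead : ∀ t, 0 < (Q t).coeff m)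
    (hsector : ∀ t (z : ℂ), z ≠ 0 → aeval (2 - z - z⁻¹) (Q t) = 0 →
      ‖z - ‖z‖‖ ≤ ‖z‖ / (8 * m) → z = ‖z‖)
    (h0 : ∀ x : ℂ, aeval x (Q 0) = 0 → x = -(‖x‖ : ℂ)) :
    ∀ t (x : ℂ), aeval x (Q t) = 0 → x = -(‖x‖ : ℂ) := by
  let A : Set unitInterval := {t | ∀ x : ℂ, aeval x (Q t) = 0 → x = -(‖x‖ : ℂ)}
  have heval : ∀ t (x : ℂ), aeval x (Q t) = ∑ j ∈ Finset.range (m + 1), ((Q t).coeff j : ℂ) * x ^ j := by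
    intro t x
    rw [aeval_eq_sum_range' (Nat.lt_succ_of_le (hdeg t).le)]
    simp
  -- The condition on the roots is rewritten as inequalities between functions continuous in t,
  -- which makes `A` closed without following individual roots.
  have hA : A = {t | ∀ x : ℂ, (Q t).coeff m * (‖x + ‖x‖‖ / 2) ^ m ≤ ‖aeval x (Q t)‖} := by
    ext t
    constructor
    · intro ht x
      have hsplit := IsAlgClosed.splits ((Q t).map (algebraMap ℝ ℂ))
      have hroots := hsplit.natDegree_eq_card_roots
      rw [natDegree_map, hdeg] at hroots
      rw [← eval_map_algebraMap, hsplit.eval_eq_prod_roots, norm_mul, leadingCoeff_map,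
        leadingCoeff, hdeg]
      have h1 : ‖algebraMap ℝ ℂ ((Q t).coeff m)‖ = (Q t).coeff m := by
        rw [norm_algebraMap', Real.norm_of_nonneg (hlead t).le]
      rw [h1]
      refine mul_le_mul_of_nonneg_left ?_ (hlead t).le
      have hnorm : ‖(((Q t).map (algebraMap ℝ ℂ)).roots.map (x - ·)).prod‖ =
          (((Q t).map (algebraMap ℝ ℂ)).roots.map fun y => ‖x - y‖).prod :=
        (Multiset.prod_hom' _ (normHom : ℂ →*₀ ℝ) _).symm
      rw [hnorm]
      have hroot : ∀ y ∈ ((Q t).map (algebraMap ℝ ℂ)).roots, ‖x + ‖x‖‖ / 2 ≤ ‖x - y‖ := by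
        intro y hy
        refine Complex.norm_add_norm_div_two_le (ht y ?_)
        rw [← eval_map_algebraMap]
        exact (mem_roots'.1 hy).2
      have h2 := Multiset.prod_map_le_prod_map₀ (s := ((Q t).map (algebraMap ℝ ℂ)).roots)
        (fun _ => ‖x + ‖x‖‖ / 2) (fun y => ‖x - y‖) (fun y _ => by positivity) hroot
      rw [Multiset.map_const', Multiset.prod_replicate, ← hroots] at h2
      exact h2
    · intro ht x hx
      have h1 := ht x
      rw [hx, norm_zero] at h1
      have h2 : (‖x + ‖x‖‖ / 2) ^ m ≤ 0 := nonpos_of_mul_nonpos_right h1 (hlead t)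
      have h3 : ‖x + ‖x‖‖ / 2 = 0 :=
        eq_zero_of_pow_eq_zero (le_antisymm h2 (by positivity))
      have h4 : x + ‖x‖ = 0 := by
        rw [← norm_eq_zero]
        linarith
      exact eq_neg_of_add_eq_zero_left h4
  have hAclosed : IsClosed A := by
    rw [hA]
    have : {t | ∀ x : ℂ, (Q t).coeff m * (‖x + ‖x‖‖ / 2) ^ m ≤ ‖aeval x (Q t)‖} =
        ⋂ x : ℂ, {t | (Q t).coeff m * (‖x + ‖x‖‖ / 2) ^ m ≤ ‖aeval x (Q t)‖} := by
      ext t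
      simp
    rw [this]
    refine isClosed_iInter fun x => isClosed_le ((hcont m).mul continuous_const) ?_
    simp only [heval]
    refine continuous_norm.comp (continuous_finsetSum _ fun j _ => ?_)
    exact (Complex.continuous_ofReal.comp (hcont j)).mul continuous_const
  -- This is z^m Q_t(2 - z - 1/z), which extends continuously to z = 0 with nonzero value ± the
  -- leading coefficient. As z and 1/z give the same x, roots in the closed unit disc suffice.
  let g : unitInterval × ℂ → ℂ := fun p =>
    ∑ j ∈ Finset.range (m + 1), ((Q p.1).coeff j : ℂ) * (2 * p.2 - p.2 ^ 2 - 1) ^ j * p.2 ^ (m - j)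
  have hg : Continuous g := by
    refine continuous_finsetSum _ fun j _ => ?_
    refine Continuous.mul (Continuous.mul ?_ (by fun_prop)) (by fun_prop)
    exact Complex.continuous_ofReal.comp ((hcont j).comp continuous_fst)
  have hgz : ∀ t (z : ℂ), z ≠ 0 → g (t, z) = z ^ m * aeval (2 - z - z⁻¹) (Q t) := by
    intro t z hz
    rw [heval, Finset.mul_sum]
    refine Finset.sum_congr rfl fun j hj => ?_
    have hjm : j ≤ m := Nat.lt_succ_iff.1 (Finset.mem_range.1 hj)
    have h1 : 2 * z - z ^ 2 - 1 = z * (2 - z - z⁻¹) := by field_simp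
    simp only [h1, mul_pow]
    rw [← Nat.sub_add_cancel hjm, pow_add]
    simp only [Nat.add_sub_cancel]
    ring
  have hg0 : ∀ t, g (t, 0) ≠ 0 := by
    intro t
    simp only [g]
    rw [Finset.sum_eq_single m]
    · simp [(hlead t).ne']
    · intro j hj hjm
      have : m - j ≠ 0 := by
        have := Finset.mem_range.1 hj
        omega
      simp [this]
    · simp
  -- The sector hypothesis replaces "not on the ray" by the closed condition "outside the open
  -- sector". The bad parameters are then the projection of a compact set, so `A` is also open.
  let Z : Set (unitInterval × ℂ) :=
    (Set.univ ×ˢ Metric.closedBall 0 1) ∩ ({p | g p = 0} ∩ {p | ‖p.2‖ / (8 * m) ≤ ‖p.2 - ‖p.2‖‖})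
  have hZ : IsCompact Z := by
    refine (isCompact_univ.prod (isCompact_closedBall _ _)).inter_right ?_
    refine (isClosed_eq hg continuous_const).inter (isClosed_le ?_ ?_)
    · fun_prop
    · exact continuous_norm.comp (continuous_snd.sub
        (Complex.continuous_ofReal.comp (continuous_norm.comp continuous_snd)))
  have hm' : (0 : ℝ) < m := by exact_mod_cast hm
  have hAc : Aᶜ = Prod.fst '' Z := by
    ext t
    constructor
    · intro ht
      simp only [A, Set.mem_compl_iff, Set.mem_ofPred_eq, not_forall] at ht
      obtain ⟨x, hx, hxn⟩ := ht
      have : ∃ z : ℂ, z ≠ 0 ∧ ‖z‖ ≤ 1 ∧ 2 - z - z⁻¹ = x := by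
        obtain ⟨w, hw⟩ := Complex.exists_unit_two_sub_sub_inv x
        rcases le_total ‖(w : ℂ)‖ 1 with h | h
        · exact ⟨w, w.ne_zero, h, hw⟩
        · refine ⟨(w : ℂ)⁻¹, inv_ne_zero w.ne_zero, ?_, ?_⟩
          · rw [norm_inv]
            exact inv_le_one_of_one_le₀ h
          · rw [inv_inv, ← hw]
            ring
      obtain ⟨z, hz0, hz1, rfl⟩ := this
      refine ⟨(t, z), ⟨⟨Set.mem_univ _, by simpa using hz1⟩, ?_, ?_⟩, rfl⟩
      · show g (t, z) = 0
        rw [hgz t z hz0, hx, mul_zero]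
      · by_contra hlt
        replace hlt : ‖z - ‖z‖‖ < ‖z‖ / (8 * m) := not_le.1 hlt
        exact hxn (Complex.two_sub_sub_inv_eq_neg_norm hz0 (hsector t z hz0 hx hlt.le))
    · rintro ⟨⟨t', z⟩, ⟨-, hz, hzn⟩, rfl⟩ ht
      have hz0 : z ≠ 0 := by
        rintro rfl
        exact hg0 _ hz
      replace hz : g (t', z) = 0 := hz
      replace hzn : ‖z‖ / (8 * m) ≤ ‖z - ‖z‖‖ := hzn
      rw [hgz _ _ hz0] at hz
      have hx := (mul_eq_zero.1 hz).resolve_left (pow_ne_zero _ hz0)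
      have h1 := Complex.eq_norm_of_two_sub_sub_inv hz0 (norm_nonneg _) (ht _ hx)
      rw [← h1, sub_self, norm_zero] at hzn
      have : 0 < ‖z‖ / (8 * m) := div_pos (norm_pos_iff.2 hz0) (by positivity)
      linarith
  have hclopen : IsClopen A := ⟨hAclosed, by
    rw [← isClosed_compl_iff, hAc]
    exact (hZ.image continuous_fst).isClosed⟩
  have huniv : A = Set.univ := hclopen.eq_univ ⟨0, h0⟩
  intro t
  have : t ∈ A := huniv ▸ Set.mem_univ t
  exact this

/-- A real polynomial of degree `m` without constant term whose coefficients decrease fast has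
`m` distinct roots on the negative axis. -/
theorem forall_root_nonpos_of_coeff_bounds {m : ℕ} (hm : 1 ≤ m) {Q : Polynomial ℝ}
    (hdeg : Q.natDegree = m) (hQ0 : Q.coeff 0 = 0) {t K : ℝ} (ht : 0 < t) (ht1 : t < 1)
    (hK : m * K * t < 1)
    (hlow : ∀ k < m, t ^ (4 * (2 ^ k - 1)) ≤ Q.coeff (m - k))
    (hup : ∀ k < m, Q.coeff (m - k) ≤ K * t ^ (4 * (2 ^ k - 1))) {x : ℂ} (hx : aeval x Q = 0) :
    x = -(‖x‖ : ℂ) := by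
  have hK0 : 0 < K := by
    have h1 := (hlow 0 hm).trans (hup 0 hm)
    simp at h1
    linarith
  -- The ratios of consecutive coefficients before and after the one of x^(m - k) have sizes
  -- t^(2·2^k) and t^(4·2^k), up to `K`. At a point of intermediate size t^(3·2^k), the term of
  -- degree m - k dominates and determines the sign.
  let p : ℕ → ℝ := fun k => -t ^ (3 * 2 ^ k)
  have hQne : Q ≠ 0 := by
    rintro rfl
    simp at hdeg
    omega
  have hsum : ∀ y : ℝ, Q.eval y = ∑ k ∈ Finset.range m, Q.coeff (m - k) * y ^ (m - k) := by
    intro y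
    rw [eval_eq_sum_range' (Nat.lt_succ_of_le hdeg.le), Finset.sum_range_succ', hQ0, zero_mul,
      add_zero, ← Finset.sum_range_reflect]
    refine Finset.sum_congr rfl fun k hk => ?_
    have : m - 1 - k + 1 = m - k := by
      have := Finset.mem_range.1 hk
      omega
    rw [this]
  -- The exponent of t in the i-th term at `p k` is convex in i with its strict minimum at i = k, so
  -- every other term has at least one more factor t.
  have hexp : ∀ k < m, ∀ i < m, i ≠ k →
      4 * (2 ^ k - 1) + 3 * 2 ^ k * (m - k) + 1 ≤ 4 * (2 ^ i - 1) + 3 * 2 ^ k * (m - i) := by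
    intro k hk i hi hik
    have hk1 : 1 ≤ 2 ^ k := Nat.one_le_two_pow
    have hi1 : 1 ≤ 2 ^ i := Nat.one_le_two_pow
    zify [hk1, hi1, hk.le, hi.le]
    rcases lt_or_gt_of_ne hik with h | h
    · obtain ⟨d, rfl⟩ := Nat.exists_eq_add_of_lt h
      have h2 : (d : ℤ) + 1 ≤ 2 ^ d := by
        exact_mod_cast Nat.lt_two_pow_self
      rw [pow_succ, pow_add]
      push_cast
      have h3 : (1 : ℤ) ≤ 2 ^ i := by exact_mod_cast hi1
      have h4 : (0 : ℤ) ≤ d := by positivity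
      have h5 : (2 : ℤ) ^ i ≤ 2 ^ i * 2 ^ d := le_mul_of_one_le_right (by positivity) (by linarith)
      rcases Nat.eq_zero_or_pos d with rfl | hd
      · push_cast
        nlinarith
      · have h6 : (1 : ℤ) ≤ d := by exact_mod_cast hd
        have h7 : (2 : ℤ) ^ i * 2 ^ d ≤ 2 ^ i * 2 ^ d * d := le_mul_of_one_le_right (by positivity) h6
        nlinarith
    · obtain ⟨d, rfl⟩ := Nat.exists_eq_add_of_lt h
      have h2 : (d : ℤ) + 1 ≤ 2 ^ d := by
        exact_mod_cast Nat.lt_two_pow_self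
      rw [pow_succ, pow_add]
      push_cast
      have h3 : (1 : ℤ) ≤ 2 ^ k := by exact_mod_cast hk1
      have h4 : (0 : ℤ) ≤ d := by positivity
      nlinarith
  have hsign : ∀ k < m, 0 < (-1) ^ (m - k) * Q.eval (p k) := by
    intro k hk
    rw [hsum, Finset.mul_sum, ← Finset.add_sum_erase _ _ (Finset.mem_range.2 hk)]
    let M := t ^ (4 * (2 ^ k - 1) + 3 * 2 ^ k * (m - k))
    have hM : 0 < M := by positivity
    have h1 : M ≤ (-1) ^ (m - k) * (Q.coeff (m - k) * p k ^ (m - k)) := by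
      have : (-1 : ℝ) ^ (m - k) * (Q.coeff (m - k) * p k ^ (m - k)) =
          Q.coeff (m - k) * t ^ (3 * 2 ^ k * (m - k)) := by
        simp only [p]
        rw [neg_pow (t ^ _), ← pow_mul]
        have h := Even.neg_one_pow (n := (m - k) + (m - k)) ⟨_, rfl⟩ (α := ℝ)
        rw [pow_add] at h
        linear_combination (Q.coeff (m - k) * t ^ (3 * 2 ^ k * (m - k))) * h
      rw [this]
      simp only [M, pow_add]
      exact mul_le_mul_of_nonneg_right (hlow k hk) (by positivity)
    have h2 : ∀ i ∈ (Finset.range m).erase k,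
        -(K * (M * t)) ≤ (-1) ^ (m - k) * (Q.coeff (m - i) * p k ^ (m - i)) := by
      intro i hi
      rw [Finset.mem_erase, Finset.mem_range] at hi
      have h3 : |(-1) ^ (m - k) * (Q.coeff (m - i) * p k ^ (m - i))| ≤ K * (M * t) := by
        have hnn : 0 ≤ Q.coeff (m - i) := (by positivity : (0:ℝ) ≤ _).trans (hlow i hi.2)
        rw [abs_mul, abs_pow, abs_neg, abs_one, one_pow, one_mul, abs_mul, abs_pow,
          abs_of_nonneg hnn]
        simp only [p]
        rw [abs_neg, abs_of_pos (by positivity), ← pow_mul]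
        calc Q.coeff (m - i) * t ^ (3 * 2 ^ k * (m - i)) ≤
            K * t ^ (4 * (2 ^ i - 1)) * t ^ (3 * 2 ^ k * (m - i)) := by
              gcongr
              exact hup i hi.2
          _ = K * t ^ (4 * (2 ^ i - 1) + 3 * 2 ^ k * (m - i)) := by ring
          _ ≤ K * t ^ (4 * (2 ^ k - 1) + 3 * 2 ^ k * (m - k) + 1) := by
              gcongr ?_ * ?_
              exact pow_le_pow_of_le_one ht.le ht1.le (hexp k hk i hi.2 hi.1)
          _ = K * (M * t) := by simp only [M]; ring
      exact (abs_le.1 h3).1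
    have h4 := Finset.card_nsmul_le_sum _ _ _ h2
    rw [Finset.card_erase_of_mem (Finset.mem_range.2 hk), Finset.card_range, nsmul_eq_mul] at h4
    have h5 : ((m - 1 : ℕ) : ℝ) ≤ m := by exact_mod_cast Nat.sub_le m 1
    have h6 : ((m - 1 : ℕ) : ℝ) * (K * (M * t)) ≤ M * (m * K * t) := by
      calc ((m - 1 : ℕ) : ℝ) * (K * (M * t)) ≤ m * (K * (M * t)) := by gcongr
        _ = _ := by ring
    nlinarith
  have hp : StrictMono p := by
    refine strictMono_nat_of_lt_succ fun k => ?_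
    simp only [p]
    refine neg_lt_neg (pow_lt_pow_right_of_lt_one₀ ht ht1 ?_)
    rw [pow_succ]
    have : 0 < 2 ^ k := by positivity
    omega
  have hp0 : ∀ k, p k < 0 := fun k => by simp only [p]; linarith [pow_pos ht (3 * 2 ^ k)]
  have hroot : ∀ k, k + 1 < m → ∃ y, p k < y ∧ y < p (k + 1) ∧ Q.eval y = 0 := by
    intro k hk
    have h1 := hsign k (by omega)
    have h2 := hsign (k + 1) hk
    have h3 : m - k = m - (k + 1) + 1 := by omega
    rw [h3, pow_succ] at h1
    have hc : ContinuousOn (fun y => (-1) ^ (m - (k + 1)) * Q.eval y) (Set.Icc (p k) (p (k + 1))) :=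
      (continuous_const.mul Q.continuous).continuousOn
    obtain ⟨y, hy, hy0⟩ := intermediate_value_Ioo (hp (Nat.lt_succ_self k)).le hc
      (show (0 : ℝ) ∈ _ from ⟨by linarith, h2⟩)
    refine ⟨y, hy.1, hy.2, ?_⟩
    exact (mul_eq_zero.1 hy0).resolve_left (pow_ne_zero _ (by norm_num))
  choose! y hy1 hy2 hy0 using hroot
  -- The sign changes give m - 1 negative roots; the m-th root is 0, since the constant term
  -- vanishes. No other root is possible in degree m.
  let r : Fin m → ℝ := fun k => if (k : ℕ) + 1 < m then y k else 0
  have hr : StrictMono r := by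
    intro i j hij
    have hij' : (i : ℕ) < j := hij
    have hi : (i : ℕ) + 1 < m := by have := j.isLt; omega
    simp only [r, hi, if_true]
    split_ifs with hj
    · exact (hy2 i hi).trans_le ((hp.monotone hij').trans (hy1 j hj).le)
    · exact (hy2 i hi).trans (hp0 _)
  have hr0 : ∀ i, r i ≤ 0 := by
    intro i
    simp only [r]
    split_ifs with hi
    · exact ((hy2 i hi).trans (hp0 _)).le
    · exact le_rfl
  have hrQ : ∀ i, Q.eval (r i) = 0 := by
    intro i
    simp only [r]
    split_ifs with hi
    · exact hy0 i hi
    · rw [← coeff_zero_eq_eval_zero, hQ0]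
  by_cases hxr : ∃ i, x = r i
  · obtain ⟨i, rfl⟩ := hxr
    rw [Complex.norm_real, Real.norm_of_nonpos (hr0 i)]
    simp
  · exfalso
    push Not at hxr
    let f : Option (Fin m) → ℂ := fun o => o.elim x fun i => (r i : ℂ)
    have hf : Function.Injective f := by
      rintro (_ | i) (_ | j) h
      · rfl
      · exact absurd h (hxr j)
      · exact absurd h.symm (hxr i)
      · have : r i = r j := Complex.ofReal_injective h
        rw [hr.injective this]
    have := eq_zero_of_natDegree_lt_card_of_eval_eq_zero (Q.map (algebraMap ℝ ℂ)) hf ?_ ?_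
    · exact hQne ((Polynomial.map_eq_zero_iff (algebraMap ℝ ℂ).injective).1 this)
    · rintro (_ | i)
      · rw [eval_map_algebraMap]
        exact hx
      · have h1 : f (some i) = algebraMap ℝ ℂ (r i) := rfl
        rw [h1, eval_map_apply, hrQ, map_zero]
    · rw [natDegree_map, hdeg]
      simp

end Polynomial

/-- Among k distinct exponents the largest is at least k - 1; remove it and use induction. This
bounds the weight of any forest with k or more edges outside a given one. -/
theorem Finset.two_pow_sub_one_le_sum {k : ℕ} {S : Finset ℕ} (hS : k ≤ S.card) :
    2 ^ k - 1 ≤ ∑ i ∈ S, 2 ^ i := by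
  induction k generalizing S with
  | zero => simp
  | succ k ih =>
    have hne : S.Nonempty := Finset.card_pos.1 (by omega)
    have hmax : k ≤ S.max' hne := by
      have : S ⊆ Finset.range (S.max' hne + 1) := fun i hi =>
        Finset.mem_range.2 (Nat.lt_succ_of_le (S.le_max' i hi))
      have := Finset.card_le_card this
      rw [Finset.card_range] at this
      omega
    rw [← Finset.add_sum_erase _ _ (S.max'_mem hne)]
    have h1 := ih (S := S.erase (S.max' hne)) (by
      rw [Finset.card_erase_of_mem (S.max'_mem hne)]; omega)
    have h2 : 2 ^ k ≤ 2 ^ S.max' hne := Nat.pow_le_pow_right two_pos hmax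
    rw [pow_succ]
    omega

/-! ### All the roots of the forest polynomial are nonpositive -/

namespace PeriodicGraph

variable {V E : Type*} [Fintype V] [DecidableEq V] [Fintype E] [DecidableEq E]
  {H : PeriodicGraph V E}

theorem Winds.mono {F F' : Set E} (hF : H.Winds F) (h : F ⊆ F') : H.Winds F' := fun v =>
  H.cover.reachable_mono (Set.preimage_mono h) (hF v)

/-- Each edge added to `B` raises the rank at z = 1 by at most one, so it lowers the number of
components by at most one. -/
theorem numComponents_le_add_card (B F : Finset E) :
    H.base.numComponents (B : Set E) ≤ H.base.numComponents (F : Set E) + (F \ B).card := by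
  have h1 := H.finrank_span_add_finrank_nullspace (1 : ℝˣ) (B : Set E)
  have h2 := H.finrank_span_add_finrank_nullspace (1 : ℝˣ) (F : Set E)
  rw [finrank_nullspace_one] at h1 h2
  have h3 : Submodule.span ℝ (H.form (1 : ℝˣ) '' F) ≤
      Submodule.span ℝ (H.form (1 : ℝˣ) '' B) ⊔
        Submodule.span ℝ (((F \ B).image (H.form (1 : ℝˣ)) : Finset _) : Set _) := by
    rw [← Submodule.span_union]
    refine Submodule.span_mono ?_
    rw [Finset.coe_image, ← Set.image_union]
    refine Set.image_mono fun e he => ?_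
    by_cases heB : e ∈ B
    · exact Or.inl heB
    · exact Or.inr (by simpa using ⟨he, heB⟩)
  have h4 := (Submodule.finrank_mono h3).trans (Submodule.finrank_add_le_finrank_add_finrank _ _)
  have h5 := (finrank_span_finset_le_card (R := ℝ) ((F \ B).image (H.form (1 : ℝˣ)))).trans
    Finset.card_image_le
  rw [Set.finrank] at h5
  omega

theorem numComponents_add_card_le {I F : Finset E} (hI : LinearIndepOn ℝ (H.form (1 : ℝˣ)) (I : Set E))
    (h : I ⊆ F) : H.base.numComponents (F : Set E) + I.card ≤ Fintype.card V := by
  have h2 := H.finrank_span_add_finrank_nullspace (1 : ℝˣ) (F : Set E)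
  rw [finrank_nullspace_one] at h2
  rw [← finrank_span_eq_card hI]
  have := Submodule.finrank_mono (Submodule.span_mono (R := ℝ)
    (Set.image_mono (f := H.form (1 : ℝˣ)) (Finset.coe_subset.2 h)))
  omega

theorem numComponents_univ (hconn : (H.cover.spanned Set.univ).Connected) :
    H.base.numComponents (Set.univ : Set E) = 1 := by
  have : (H.base.spanned Set.univ).Preconnected := by
    intro u v
    exact reachable_base (F := Set.univ) (hconn.preconnected (u, 0) (v, 0))
  rw [EdgeGraph.numComponents, Nat.card_eq_one_iff_unique]
  obtain ⟨⟨v, -⟩⟩ := hconn.nonempty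
  exact ⟨this.subsingleton_connectedComponent, ⟨(H.base.spanned Set.univ).connectedComponentMk v⟩⟩

/-- Starting from a good set `B`, connecting edges can be added one at a time. -/
theorem exists_good_chain (hH : H.Annular) (hconn : (H.cover.spanned Set.univ).Connected)
    {B : Finset E} (hB : H.Good B) :
    ∃ idx : E → ℕ, Function.Injective idx ∧ ∀ k < H.base.numComponents (B : Set E),
      ∃ F : Finset E, H.Good F ∧ H.base.numComponents (F : Set E) =
        H.base.numComponents (B : Set E) - k ∧ ∀ e ∈ F \ B, idx e < k := by
  set m := H.base.numComponents (B : Set E) with hm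
  -- `I₀` is a spanning forest of `B` and `I` a spanning tree of 𝒢₁ that contains it. The m - 1
  -- edges of `I \ I₀` join the components of `B` one after the other; `idx` numbers them first.
  obtain ⟨I₀, hI₀B, -, hI₀span, hI₀⟩ := exists_linearIndepOn_extension
    (linearIndepOn_empty ℝ (H.form (1 : ℝˣ))) (Set.empty_subset (B : Set E))
  obtain ⟨I, -, hI₀I, hIspan, hI⟩ := exists_linearIndepOn_extension hI₀ (Set.subset_univ I₀)
  lift I₀ to Finset E using Set.toFinite _
  lift I to Finset E using Set.toFinite _
  have hc₀ : I₀.card + m = Fintype.card V := by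
    have h1 := H.finrank_span_add_finrank_nullspace (1 : ℝˣ) (B : Set E)
    rw [finrank_nullspace_one] at h1
    rw [← finrank_span_eq_card hI₀, ← h1, hm,
      le_antisymm (Submodule.span_mono (Set.image_mono hI₀B)) (Submodule.span_le.2 hI₀span)]
  have hc : I.card + 1 = Fintype.card V := by
    have h1 := H.finrank_span_add_finrank_nullspace (1 : ℝˣ) (Set.univ : Set E)
    rw [finrank_nullspace_one, numComponents_univ hconn] at h1
    rw [← finrank_span_eq_card hI, ← h1,
      le_antisymm (Submodule.span_mono (Set.image_mono (Set.subset_univ (I : Set E))))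
      (Submodule.span_le.2 hIspan)]
  rw [Finset.coe_subset] at hI₀I
  let I' := I \ I₀
  have hI' : I'.card + 1 = m := by
    have := Finset.card_sdiff_add_card_eq_card hI₀I
    simp only [I']
    omega
  let idx : E → ℕ := fun e =>
    if h : e ∈ I' then (I'.equivFin ⟨e, h⟩).val else I'.card + (Fintype.equivFin E e).val
  have hidx : Function.Injective idx := by
    intro e e' h
    simp only [idx] at h
    split_ifs at h with h1 h2 h2
    · have := I'.equivFin.injective (Fin.ext h)
      simpa using this
    · have := (I'.equivFin ⟨e, h1⟩).isLt
      omega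
    · have := (I'.equivFin ⟨e', h2⟩).isLt
      omega
    · exact (Fintype.equivFin E).injective (Fin.ext (by omega))
  refine ⟨idx, hidx, fun k hk => ?_⟩
  let J := I'.filter fun e => idx e < k
  have hJle : J.card ≤ k := by
    have : (J.image idx).card ≤ (Finset.range k).card := Finset.card_le_card fun i hi => by
      obtain ⟨e, he, rfl⟩ := Finset.mem_image.1 hi
      exact Finset.mem_range.2 (Finset.mem_filter.1 he).2
    rwa [Finset.card_image_of_injective _ hidx, Finset.card_range] at this
  have hJge : k ≤ J.card := by
    let f : Fin k → E := fun i => (I'.equivFin.symm ⟨i, by omega⟩ : I').1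
    have hf : Function.Injective f := by
      intro i j hij
      have := I'.equivFin.symm.injective (Subtype.ext hij)
      exact Fin.ext (by simpa using this)
    have : (Finset.univ.image f).card ≤ J.card := Finset.card_le_card fun e he => by
      obtain ⟨i, -, rfl⟩ := Finset.mem_image.1 he
      have h1 : f i ∈ I' := (I'.equivFin.symm ⟨i, by omega⟩ : I').2
      refine Finset.mem_filter.2 ⟨h1, ?_⟩
      simp only [idx, h1, dif_pos]
      have h2 : (⟨f i, h1⟩ : I') = I'.equivFin.symm ⟨i, by omega⟩ := rfl
      rw [h2, Equiv.apply_symm_apply]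
      exact i.isLt
    rwa [Finset.card_image_of_injective _ hf, Finset.card_univ, Fintype.card_fin] at this
  have hIJ : I₀ ∪ J ⊆ I := Finset.union_subset hI₀I
    ((Finset.filter_subset _ _).trans Finset.sdiff_subset)
  have hIJli : LinearIndepOn ℝ (H.form (1 : ℝˣ)) ((I₀ ∪ J : Finset E) : Set E) :=
    hI.mono (Finset.coe_subset.2 hIJ)
  -- Being independent at z = 1, the set I₀ ∪ J is also independent at some nearby z and extends to
  -- a good set `F` inside B ∪ J. Containing I₀ ∪ J, it has at most m - k components; adding at most
  -- k edges to `B`, it has at least m - k.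
  obtain ⟨z, hz, hzli⟩ := exists_linearIndepOn_of_one hIJli
  obtain ⟨F, hF, hIF, hFS⟩ := exists_good_of_linearIndepOn hH hz hzli
    (S := ((B ∪ J : Finset E) : Set E)) (by
      rw [Finset.coe_union, Finset.coe_union]
      exact Set.union_subset_union_left _ hI₀B)
    (hB.2.mono (Finset.coe_subset.2 Finset.subset_union_left))
  rw [Finset.coe_subset] at hIF hFS
  have hFB : F \ B ⊆ J := by
    intro e he
    rw [Finset.mem_sdiff] at he
    exact (Finset.mem_union.1 (hFS he.1)).resolve_left he.2
  refine ⟨F, hF, ?_, fun e he => (Finset.mem_filter.1 (hFB he)).2⟩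
  have h1 := numComponents_le_add_card (H := H) B F
  have h2 := Finset.card_le_card hFB
  have h3 := numComponents_add_card_le hIJli hIF
  have h4 : (I₀ ∪ J).card = I₀.card + J.card := by
    refine Finset.card_union_of_disjoint (Finset.disjoint_left.2 fun e he hJ => ?_)
    exact (Finset.mem_sdiff.1 (Finset.mem_filter.1 hJ).1).2 he
  omega

/-- For a suitable choice of conductances all the roots are on the negative axis. -/
theorem exists_conductance_root_nonpos (hH : H.Annular)
    (hconn : (H.cover.spanned Set.univ).Connected) :
    ∃ c : E → ℝ, (∀ e, 0 < c e) ∧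
      ∀ x : ℂ, Polynomial.aeval x (H.forestPoly c) = 0 → x = -(‖x‖ : ℂ) := by
  obtain ⟨⟨v₀, -⟩⟩ := hconn.nonempty
  have : Nonempty V := ⟨v₀⟩
  have hex : ∃ F, H.Good F := by
    obtain ⟨F, hF, -⟩ := exists_good_subset hH (winds_univ hconn)
    exact ⟨F, hF⟩
  obtain ⟨B, hB, hBm⟩ := exists_good_eq_maxComponents hex
  set m := H.maxComponents with hm
  have hm1 : 1 ≤ m := by
    rw [← hBm]
    exact numComponents_pos _
  obtain ⟨idx, hidx, hchain⟩ := exists_good_chain hH hconn hB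
  rw [hBm] at hchain
  let K : ℝ := Fintype.card (Finset E)
  have hK : 0 < K := by
    exact Nat.cast_pos.2 Fintype.card_pos
  have hmpos : (0 : ℝ) < m := by exact_mod_cast hm1
  -- Small enough that the m terms, each a sum over at most `K` edge sets, cannot outweigh the
  -- dominant one.
  let t : ℝ := 1 / (2 * m * K + 1)
  have ht : 0 < t := by positivity
  have ht1 : t < 1 := by
    rw [div_lt_one (by positivity)]
    have : 0 < 2 * m * K := by positivity
    linarith
  have hmKt : m * K * t < 1 := by
    simp only [t]
    rw [mul_one_div, div_lt_one (by positivity)]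
    have : 0 < m * K := by positivity
    linarith
  -- A forest with m - k components has at least k edges outside `B`, so its weight is at most
  -- t^(4(2^k - 1)). Up to the number of forests this bound is attained, by the chain.
  let c : E → ℝ := fun e => if e ∈ B then 1 else t ^ (4 * 2 ^ idx e)
  have hc : ∀ e, 0 < c e := fun e => by
    simp only [c]
    split_ifs <;> positivity
  have hprod : ∀ F : Finset E, ∏ e ∈ F, c e = t ^ (4 * ∑ i ∈ (F \ B).image idx, 2 ^ i) := by
    intro F
    rw [Finset.sum_image fun _ _ _ _ h => hidx h, Finset.mul_sum, ← Finset.prod_pow_eq_pow_sum]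
    rw [← Finset.prod_subset (Finset.sdiff_subset : F \ B ⊆ F)]
    · refine Finset.prod_congr rfl fun e he => ?_
      simp only [c]
      rw [if_neg (Finset.mem_sdiff.1 he).2]
    · intro e he he'
      simp only [Finset.mem_sdiff, not_and, not_not] at he'
      simp only [c]
      rw [if_pos (he' he)]
  refine ⟨c, hc, fun x hx => ?_⟩
  refine Polynomial.forall_root_nonpos_of_coeff_bounds hm1 (natDegree_forestPoly hc hex)
    (forestPoly_coeff_zero c) ht ht1 hmKt ?_ ?_ hx
  · intro k hk
    obtain ⟨F, hF, hFk, hFidx⟩ := hchain k hk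
    rw [forestPoly_coeff]
    have h1 : ∏ e ∈ F, c e ≤ ∑ F : Finset E with H.Good F ∧ H.base.numComponents (F : Set E) = m - k,
        ∏ e ∈ F, c e :=
      Finset.single_le_sum (f := fun F : Finset E => ∏ e ∈ F, c e)
        (fun F _ => Finset.prod_nonneg fun e _ => (hc e).le) (by simpa using ⟨hF, hFk⟩)
    refine le_trans ?_ h1
    rw [hprod]
    refine pow_le_pow_of_le_one ht.le ht1.le (Nat.mul_le_mul_left 4 ?_)
    have h2 : (F \ B).image idx ⊆ Finset.range k := fun i hi => by
      obtain ⟨e, he, rfl⟩ := Finset.mem_image.1 hi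
      exact Finset.mem_range.2 (hFidx e he)
    have h3 := Finset.sum_le_sum_of_subset (f := fun i => 2 ^ i) h2
    have h4 := Nat.geomSum_eq (le_refl 2) k
    simp at h4
    omega
  · intro k hk
    rw [forestPoly_coeff]
    refine (Finset.sum_le_card_nsmul _ _ (t ^ (4 * (2 ^ k - 1))) ?_).trans ?_
    · intro F hF
      obtain ⟨-, hF, hFk⟩ := Finset.mem_filter.1 hF
      rw [hprod]
      refine pow_le_pow_of_le_one ht.le ht1.le (Nat.mul_le_mul_left 4 ?_)
      refine Finset.two_pow_sub_one_le_sum ?_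
      rw [Finset.card_image_of_injective _ hidx]
      have := numComponents_le_add_card (H := H) B F
      omega
    · rw [nsmul_eq_mul]
      refine mul_le_mul_of_nonneg_right ?_ (by positivity)
      simp only [K]
      exact_mod_cast Finset.card_le_univ _

/-- All the roots of the forest polynomial are on the negative axis. -/
theorem forestPoly_root_nonpos {G : PeriodicGraph V E} (hG : G.Annular)
    (hGn : ∀ (n : ℕ) [NeZero n], (G.power n).Annular)
    (hconn : (G.cover.spanned Set.univ).Connected) {c : E → ℝ} (hc : ∀ e, 0 < c e) (x : ℂ)
    (hx : Polynomial.aeval x (G.forestPoly c) = 0) : x = -(‖x‖ : ℂ) := by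
  obtain ⟨⟨v₀, -⟩⟩ := hconn.nonempty
  have : Nonempty V := ⟨v₀⟩
  have hex : ∃ F, G.Good F := by
    obtain ⟨F, hF, -⟩ := exists_good_subset hG (winds_univ hconn)
    exact ⟨F, hF⟩
  obtain ⟨B, hB, hBm⟩ := exists_good_eq_maxComponents hex
  have hm1 : 1 ≤ G.maxComponents := by
    rw [← hBm]
    exact numComponents_pos _
  obtain ⟨c₀, hc₀, hroot⟩ := exists_conductance_root_nonpos hG hconn
  -- The conductances move along a segment from the degenerate choice to the given ones and stay
  -- positive. The degree and the sector property therefore hold all along.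
  let γ : unitInterval → E → ℝ := fun t e => (1 - (t : ℝ)) * c₀ e + t * c e
  have hγ : ∀ t e, 0 < γ t e := by
    intro t e
    have h0 := t.2.1
    have h1 := t.2.2
    simp only [γ]
    rcases h0.eq_or_lt with h | h
    · rw [← h]
      simpa using hc₀ e
    · have := mul_pos h (hc e)
      have := mul_nonneg (sub_nonneg.2 h1) (hc₀ e).le
      linarith
  have key := Polynomial.forall_root_nonpos_of_deformation hm1 (Q := fun t => G.forestPoly (γ t))
    ?_ (fun t => natDegree_forestPoly (hγ t) hex)
    (fun t => (forestPoly_coeff_pos_iff (hγ t)).2 ⟨B, hB, hBm⟩) ?_ ?_ 1 x ?_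
  · exact key
  · intro j
    simp only [forestPoly_coeff]
    refine continuous_finsetSum _ fun F _ => continuous_finsetProd _ fun e _ => ?_
    simp only [γ]
    fun_prop
  · intro t z hz hQz hδ
    refine Complex.eq_norm_of_near_positive hm1 hz hδ fun n hn => ?_
    have : NeZero n := ⟨by omega⟩
    have hdeg : (G.forestPolyPower (γ t) n).natDegree = G.maxComponents := by
      rw [natDegree_forestPolyPower hG (hGn n) (forestPoly_ne_zero (hγ t) hex),
        natDegree_forestPoly (hγ t) hex]
    refine ⟨G.forestPolyPower (γ t) n, forestPoly_coeff_nonneg fun x => hγ t x.1, ?_, hdeg.le, ?_⟩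
    · intro h0
      rw [h0] at hdeg
      simp at hdeg
      omega
    · exact aeval_forestPolyPower_eq_zero hG (hGn n) (z := Units.mk0 z hz) hQz
  · have : γ 0 = c₀ := by
      funext e
      simp [γ]
    simpa only [this] using hroot
  · have : γ 1 = c := by
      funext e
      simp [γ]
    simpa only [this] using hx

end PeriodicGraph

/-! ### From the roots of Q to the roots of P -/

namespace LaurentPolynomial

theorem coeff_mul_T (f : LaurentPolynomial ℝ) (k n : ℤ) : (f * T k).coeff n = f.coeff (n - k) := by
  rw [T, AddMonoidAlgebra.coeff_mul_single_apply, mul_one, sub_eq_add_neg]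

theorem coeff_toLaurent_natCast (p : Polynomial ℝ) (k : ℕ) :
    (Polynomial.toLaurent p).coeff (k : ℤ) = p.coeff k := by
  rw [coeff_toLaurent]
  exact Finsupp.mapDomain_apply Nat.cast_injective _ _

theorem coeff_toLaurent_of_neg (p : Polynomial ℝ) {k : ℤ} (hk : k < 0) :
    (Polynomial.toLaurent p).coeff k = 0 := by
  rw [coeff_toLaurent]
  refine Finsupp.mapDomain_of_notMem_range _ _ ?_
  rintro ⟨n, rfl⟩
  have : (0 : ℤ) ≤ (n : ℤ) := by positivity
  exact absurd hk (not_lt.2 this)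

theorem numerator_toLaurent_mul_T {p : Polynomial ℝ} (hp : p.coeff 0 ≠ 0) (k : ℤ) :
    numerator (Polynomial.toLaurent p * T k) = p := by
  have hinf : sInf ((Polynomial.toLaurent p * T k).coeff.support : Set ℤ) = k := by
    refine IsLeast.csInf_eq ⟨?_, ?_⟩
    · rw [Finset.mem_coe, Finsupp.mem_support_iff, coeff_mul_T, sub_self]
      have := coeff_toLaurent_natCast p 0
      rw [Nat.cast_zero] at this
      rwa [this]
    · intro n hn
      rw [Finset.mem_coe, Finsupp.mem_support_iff, coeff_mul_T] at hn
      by_contra hlt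
      exact hn (coeff_toLaurent_of_neg p (by linarith))
  rw [numerator, hinf, mul_T_assoc, add_neg_cancel, T_zero, mul_one, Polynomial.trunc_toLaurent]

theorem degree_toLaurent_mul_T {p : Polynomial ℝ} (hp : p ≠ 0) (k : ℤ) :
    (Polynomial.toLaurent p * T k).degree = ((p.natDegree + k : ℤ) : WithBot ℤ) := by
  refine le_antisymm (Finset.max_le fun n hn => ?_) (Finset.le_max ?_)
  · rw [Finsupp.mem_support_iff, coeff_mul_T] at hn
    rw [WithBot.coe_le_coe]
    by_cases h : n - k < 0
    · exact absurd (coeff_toLaurent_of_neg p h) hn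
    · obtain ⟨i, hi⟩ := Int.eq_ofNat_of_zero_le (not_lt.1 h)
      rw [hi, coeff_toLaurent_natCast] at hn
      have := Polynomial.le_natDegree_of_ne_zero hn
      omega
  · rw [Finsupp.mem_support_iff, coeff_mul_T, add_sub_cancel_right, coeff_toLaurent_natCast]
    exact Polynomial.leadingCoeff_ne_zero.2 hp

/-- For one factor, (2 - z - 1/z + l + 1/l - 2) z = -(z - l)(z - 1/l). -/
theorem aeval_prod_mul_T (Λ : Multiset ℝ) (hΛ : ∀ l ∈ Λ, l ≠ 0) :
    Polynomial.aeval (2 - T 1 - T (-1) : LaurentPolynomial ℝ)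
        (Λ.map fun l => Polynomial.X + Polynomial.C (l + l⁻¹ - 2)).prod * T (Multiset.card Λ) =
      Polynomial.toLaurent (Λ.map fun l =>
        -((Polynomial.X - Polynomial.C l) * (Polynomial.X - Polynomial.C l⁻¹))).prod := by
  induction Λ using Multiset.induction_on with
  | empty => simp
  | cons l Λ ih =>
    have ih := ih fun l hl => hΛ l (Multiset.mem_cons_of_mem hl)
    have hl : l ≠ 0 := hΛ l (Multiset.mem_cons_self l Λ)
    rw [Multiset.map_cons, Multiset.prod_cons, Multiset.map_cons, Multiset.prod_cons, map_mul,
      map_mul, Multiset.card_cons, Nat.cast_add, Nat.cast_one, add_comm, T_add, ← ih]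
    have h1 : (T (-1) : LaurentPolynomial ℝ) * T 1 = 1 := by rw [← T_add]; simp
    have h2 : (C l * C l⁻¹ : LaurentPolynomial ℝ) = 1 := by
      rw [← map_mul, mul_inv_cancel₀ hl, map_one]
    have h3 : Polynomial.aeval (2 - T 1 - T (-1) : LaurentPolynomial ℝ)
        (Polynomial.X + Polynomial.C (l + l⁻¹ - 2)) * T 1 =
        Polynomial.toLaurent (-((Polynomial.X - Polynomial.C l) *
          (Polynomial.X - Polynomial.C l⁻¹))) := by
      simp only [map_add, map_sub, map_neg, map_mul, Polynomial.aeval_X, Polynomial.aeval_C,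
        Polynomial.toLaurent_X, Polynomial.toLaurent_C, ← C_eq_algebraMap]
      have : (C (2 : ℝ) : LaurentPolynomial ℝ) = 2 := map_ofNat _ _
      rw [this]
      linear_combination -h1 + h2
    rw [← h3]
    ring_nf

end LaurentPolynomial

/-- The solution `l ≥ 1` of `l + l⁻¹ = 2 + b`. -/
theorem Real.exists_add_inv_eq {b : ℝ} (hb : 0 < b) : ∃ l : ℝ, 1 < l ∧ l + l⁻¹ - 2 = b := by
  let D := Real.sqrt ((2 + b) ^ 2 - 4)
  have hD : D ^ 2 = (2 + b) ^ 2 - 4 := Real.sq_sqrt (by nlinarith)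
  have hD0 : 0 ≤ D := Real.sqrt_nonneg _
  have hl : 1 < (2 + b + D) / 2 := by linarith
  refine ⟨(2 + b + D) / 2, hl, ?_⟩
  have : (2 + b + D) / 2 ≠ 0 := by linarith
  field_simp
  nlinarith

namespace Polynomial

open LaurentPolynomial in
/-- Factorization of a polynomial in `2 - z - z⁻¹` with nonpositive roots. -/
theorem laurent_of_roots_nonpos {m : ℕ} {Q : Polynomial ℝ} (hdeg : Q.natDegree = m)
    (hlead : 0 < Q.coeff m) (h0 : Q.coeff 0 = 0) (h1 : Q.coeff 1 ≠ 0)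
    (hroot : ∀ x : ℂ, aeval x Q = 0 → x = -(‖x‖ : ℂ)) :
    (aeval (2 - T 1 - T (-1) : LaurentPolynomial ℝ) Q).degree = ((m : ℤ) : WithBot ℤ) ∧
    |(aeval (2 - T 1 - T (-1) : LaurentPolynomial ℝ) Q).coeff (m : ℤ)| = Q.coeff m ∧
    (aeval (2 - T 1 - T (-1) : LaurentPolynomial ℝ) Q).rootsAboveOne.length + 1 = m ∧
    Q = C (Q.coeff m) * X *
      ((aeval (2 - T 1 - T (-1) : LaurentPolynomial ℝ) Q).rootsAboveOne.map
        fun l => X + C (l + l⁻¹ - 2)).prod := by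
  set a := Q.coeff m with ha
  have hsplit := IsAlgClosed.splits (Q.map (algebraMap ℝ ℂ))
  set R := (Q.map (algebraMap ℝ ℂ)).roots with hR
  have hQ0 : Q ≠ 0 := by
    rintro rfl
    simp at h1
  have hreal : Q = C a * ((R.map norm).map fun b => X + C b).prod := by
    apply Polynomial.map_injective _ (algebraMap ℝ ℂ).injective
    conv_lhs => rw [hsplit.eq_prod_roots]
    rw [leadingCoeff_map, leadingCoeff, hdeg, Polynomial.map_mul, map_C, Polynomial.map_multiset_prod,
      Multiset.map_map, Multiset.map_map]
    congr 2
    refine Multiset.map_congr rfl fun x hx => ?_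
    have hx' : x = -(‖x‖ : ℂ) := hroot x (by
      rw [← eval_map_algebraMap]
      exact (mem_roots'.1 hx).2)
    simp only [Function.comp_apply, Polynomial.map_add, map_X, map_C]
    conv_lhs => rw [hx']
    simp
  have hcard : Multiset.card (R.map norm) = m := by
    rw [Multiset.card_map, hR, ← hsplit.natDegree_eq_card_roots, natDegree_map, hdeg]
  have hzero : (0 : ℝ) ∈ R.map norm := by
    have : (0 : ℂ) ∈ R := by
      rw [hR, mem_roots']
      refine ⟨(Polynomial.map_ne_zero_iff (algebraMap ℝ ℂ).injective).2 hQ0, ?_⟩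
      rw [IsRoot, ← coeff_zero_eq_eval_zero, coeff_map, h0, map_zero]
    exact Multiset.mem_map.2 ⟨0, this, norm_zero⟩
  obtain ⟨S, hS⟩ := Multiset.exists_cons_of_mem hzero
  have hnn : ∀ b ∈ S, 0 ≤ b := by
    intro b hb
    have : b ∈ R.map norm := hS ▸ Multiset.mem_cons_of_mem hb
    obtain ⟨x, -, rfl⟩ := Multiset.mem_map.1 this
    exact norm_nonneg x
  rw [hS, Multiset.map_cons, Multiset.prod_cons, map_zero, add_zero, ← mul_assoc] at hreal
  rw [hS, Multiset.card_cons] at hcard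
  -- The coefficient of x in `Q` is nonzero, so 0 is a simple root and only one factor x has been
  -- split off.
  have hpos : ∀ b ∈ S, 0 < b := by
    intro b hb
    refine lt_of_le_of_ne (hnn b hb) fun hb0 => h1 ?_
    subst hb0
    obtain ⟨S', rfl⟩ := Multiset.exists_cons_of_mem hb
    rw [hreal, Multiset.map_cons, Multiset.prod_cons, map_zero, add_zero]
    have : C a * X * (X * (S'.map fun b => X + C b).prod) =
        C a * (S'.map fun b => X + C b).prod * X ^ 2 := by ring
    rw [this, coeff_mul_X_pow']
    simp
  choose! lf hlf1 hlf2 using fun (b : ℝ) (hb : 0 < b) => Real.exists_add_inv_eq hb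
  let Λ := S.map lf
  have hΛ1 : ∀ l ∈ Λ, 1 < l := by
    intro l hl
    obtain ⟨b, hb, rfl⟩ := Multiset.mem_map.1 hl
    exact hlf1 b (hpos b hb)
  have hΛc : Multiset.card Λ + 1 = m := by rw [Multiset.card_map, hcard]
  have hΛS : (S.map fun b => X + C b) = Λ.map fun l => X + C (l + l⁻¹ - 2) := by
    rw [Multiset.map_map]
    refine Multiset.map_congr rfl fun b hb => ?_
    rw [Function.comp_apply, hlf2 b (hpos b hb)]
  rw [hΛS] at hreal
  -- The additional entry 1 stands for the factor x of `Q`. It contributes (z - 1)², hence no root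
  -- larger than 1.
  let p₁ : Polynomial ℝ := ((1 ::ₘ Λ).map fun l => ((X - C l) * (X - C l⁻¹))).prod
  let p : Polynomial ℝ := C ((-1) ^ m * a) * p₁
  have hmonic : p₁.Monic := monic_multiset_prod_of_monic _ _ fun l _ =>
    (monic_X_sub_C _).mul (monic_X_sub_C _)
  have ha0 : (-1) ^ m * a ≠ 0 := mul_ne_zero (pow_ne_zero _ (by norm_num)) hlead.ne'
  have hf : aeval (2 - T 1 - T (-1) : LaurentPolynomial ℝ) Q = toLaurent p * T (-(m : ℤ)) := by
    have h2 := LaurentPolynomial.aeval_prod_mul_T (1 ::ₘ Λ) (by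
      intro l hl
      rcases Multiset.mem_cons.1 hl with rfl | hl
      · norm_num
      · linarith [hΛ1 l hl])
    rw [Multiset.card_cons, hΛc] at h2
    have h3 : ((1 ::ₘ Λ).map fun l => -((X - C l) * (X - C l⁻¹))).prod = C ((-1) ^ m) * p₁ := by
      have : ∀ S : Multiset ℝ, (S.map fun l => -((X - C l) * (X - C l⁻¹))).prod =
          C ((-1) ^ (Multiset.card S)) * (S.map fun l => ((X - C l) * (X - C l⁻¹))).prod := by
        intro S
        have h4 := Multiset.prod_map_neg (S.map fun l => ((X - C l) * (X - C l⁻¹)))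
        rw [Multiset.map_map, Multiset.card_map] at h4
        simpa using h4
      rw [this, Multiset.card_cons, hΛc]
    rw [h3, Multiset.map_cons, Multiset.prod_cons] at h2
    have h5 : (1 : ℝ) + 1⁻¹ - 2 = 0 := by norm_num
    rw [h5, map_zero, add_zero] at h2
    have h6 : aeval (2 - T 1 - T (-1) : LaurentPolynomial ℝ) Q * T m = toLaurent p := by
      conv_lhs => rw [hreal, mul_assoc, map_mul, mul_assoc, h2]
      rw [aeval_C, ← LaurentPolynomial.C_eq_algebraMap, ← toLaurent_C, ← map_mul]
      congr 1
      simp only [p, map_mul]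
      ring
    rw [← h6, LaurentPolynomial.mul_T_assoc]
    simp
  have hp0 : p.coeff 0 ≠ 0 := by
    rw [coeff_C_mul, coeff_zero_eq_eval_zero]
    refine mul_ne_zero ha0 ?_
    simp only [p₁]
    rw [eval_multiset_prod, Multiset.map_map]
    refine Multiset.prod_ne_zero fun h => ?_
    obtain ⟨l, hl, hl0⟩ := Multiset.mem_map.1 h
    have : l ≠ 0 := by
      rcases Multiset.mem_cons.1 hl with rfl | hl
      · norm_num
      · linarith [hΛ1 l hl]
    simp [this] at hl0
  have hpne : p ≠ 0 := by
    intro h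
    simp [h] at hp0
  have hpdeg : p.natDegree = 2 * m := by
    rw [natDegree_C_mul ha0]
    simp only [p₁]
    rw [natDegree_multiset_prod_of_monic _ (by
      intro q hq
      obtain ⟨l, -, rfl⟩ := Multiset.mem_map.1 hq
      exact (monic_X_sub_C _).mul (monic_X_sub_C _)), Multiset.map_map]
    have : ∀ l : ℝ, (natDegree ∘ fun l : ℝ => (X - C l) * (X - C l⁻¹)) l = 2 := by
      intro l
      rw [Function.comp_apply, (monic_X_sub_C _).natDegree_mul (monic_X_sub_C _)]
      simp
    rw [Multiset.map_congr rfl fun l _ => this l, Multiset.map_const', Multiset.sum_replicate,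
      Multiset.card_cons, hΛc]
    simp [mul_comm]
  have hroots : p.roots.filter (fun x => 1 < x) = Λ := by
    have hpr : p = C ((-1) ^ m * a) *
        (((1 ::ₘ Λ) + (1 ::ₘ Λ).map fun l => l⁻¹).map fun l => X - C l).prod := by
      simp only [p, p₁]
      rw [Multiset.prod_map_mul, Multiset.map_add, Multiset.prod_add, Multiset.map_map]
      rfl
    rw [hpr, roots_C_mul _ ha0, roots_multiset_prod_X_sub_C, Multiset.filter_add,
      Multiset.filter_cons_of_neg _ (lt_irrefl 1), Multiset.filter_eq_self.2 hΛ1,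
      Multiset.filter_eq_nil.2, add_zero]
    intro l hl
    obtain ⟨l', hl', rfl⟩ := Multiset.mem_map.1 hl
    rcases Multiset.mem_cons.1 hl' with rfl | hl'
    · norm_num
    · exact not_lt.2 (inv_le_one_of_one_le₀ (hΛ1 _ hl').le)
  have hrao : ((aeval (2 - T 1 - T (-1) : LaurentPolynomial ℝ) Q).rootsAboveOne : Multiset ℝ) = Λ := by
    rw [LaurentPolynomial.rootsAboveOne, Multiset.sort_eq, hf,
      LaurentPolynomial.numerator_toLaurent_mul_T hp0]
    convert hroots using 2
  refine ⟨?_, ?_, ?_, ?_⟩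
  · rw [hf, LaurentPolynomial.degree_toLaurent_mul_T hpne, hpdeg]
    congr 1
    push_cast
    ring
  · rw [hf, LaurentPolynomial.coeff_mul_T]
    have : (m : ℤ) - -(m : ℤ) = ((2 * m : ℕ) : ℤ) := by push_cast; ring
    rw [this, LaurentPolynomial.coeff_toLaurent_natCast, ← hpdeg]
    have : p.coeff p.natDegree = (-1) ^ m * a := by
      rw [natDegree_C_mul ha0, coeff_C_mul, hmonic.coeff_natDegree, mul_one]
    rw [this, abs_mul, abs_pow, abs_neg, abs_one, one_pow, one_mul, abs_of_pos hlead]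
  · rw [← hΛc, ← hrao, Multiset.coe_card]
  · conv_lhs => rw [hreal, ← hrao, Multiset.map_coe, Multiset.prod_coe]

end Polynomial

/-! ### Growth rates and coefficients of products of linear factors -/

theorem HasGrowthRate.of_bounds {Z : ℕ → ℝ} {ρ A B : ℝ} {D : ℕ} (hρ : 0 < ρ) (hA : 0 < A)
    (hB : 0 < B) (hlow : ∀ᶠ n in Filter.atTop, A * ρ ^ n ≤ Z n)
    (hup : ∀ᶠ n : ℕ in Filter.atTop, Z n ≤ B * (n : ℝ) ^ D * ρ ^ n) :
    HasGrowthRate Z (Real.log ρ) := by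
  refine ⟨hlow.mono fun n hn => lt_of_lt_of_le (by positivity) hn, ?_⟩
  have hlim1 : Filter.Tendsto (fun n : ℕ => Real.log A / n + Real.log ρ) Filter.atTop
      (nhds (Real.log ρ)) := by
    simpa using (tendsto_const_div_atTop_nhds_zero_nat (Real.log A)).add_const (Real.log ρ)
  have hlogn : Filter.Tendsto (fun n : ℕ => Real.log n / n) Filter.atTop (nhds 0) := by
    have := Real.isLittleO_log_id_atTop.tendsto_div_nhds_zero
    exact this.comp tendsto_natCast_atTop_atTop
  have hlim2 : Filter.Tendsto (fun n : ℕ => Real.log B / n + D * (Real.log n / n) + Real.log ρ)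
      Filter.atTop (nhds (Real.log ρ)) := by
    have h := ((tendsto_const_div_atTop_nhds_zero_nat (Real.log B)).add
      (hlogn.const_mul (D : ℝ))).add_const (Real.log ρ)
    simpa using h
  refine tendsto_of_tendsto_of_tendsto_of_le_of_le' hlim1 hlim2 ?_ ?_
  · filter_upwards [hlow, Filter.eventually_gt_atTop 0] with n hn hn0
    have hn' : (0 : ℝ) < n := by exact_mod_cast hn0
    have h1 := Real.log_le_log (by positivity) hn
    rw [Real.log_mul hA.ne' (by positivity), Real.log_pow] at h1
    rw [le_div_iff₀ hn']
    calc (Real.log A / n + Real.log ρ) * n = Real.log A + n * Real.log ρ := by field_simp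
      _ ≤ _ := h1
  · filter_upwards [hlow, hup, Filter.eventually_gt_atTop 0] with n hn hn2 hn0
    have hn' : (0 : ℝ) < n := by exact_mod_cast hn0
    have hZ : 0 < Z n := lt_of_lt_of_le (by positivity) hn
    have h1 := Real.log_le_log hZ hn2
    rw [Real.log_mul (by positivity) (by positivity), Real.log_mul (by positivity) (by positivity),
      Real.log_pow, Real.log_pow] at h1
    rw [div_le_iff₀ hn']
    calc _ ≤ _ := h1
      _ = _ := by field_simp

namespace Polynomial

theorem coeff_list_prod_nonneg (L : List ℝ) (x : ℝ → ℝ) (hx : ∀ l ∈ L, 0 ≤ x l) (k : ℕ) :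
    0 ≤ ((L.map fun l => X + C (x l)).prod).coeff k := by
  induction L generalizing k with
  | nil =>
    simp only [List.map_nil, List.prod_nil, coeff_one]
    split_ifs <;> norm_num
  | cons l L ih =>
    have ih := ih fun l hl => hx l (List.mem_cons_of_mem _ hl)
    have hl := hx l List.mem_cons_self
    rw [List.map_cons, List.prod_cons, add_mul, coeff_add, coeff_C_mul]
    cases k with
    | zero => simpa using mul_nonneg hl (ih 0)
    | succ k =>
      rw [coeff_X_mul]
      exact add_nonneg (ih k) (mul_nonneg hl (ih _))

theorem natDegree_list_prod_X_add_C (L : List ℝ) (x : ℝ → ℝ) :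
    ((L.map fun l => X + C (x l)).prod).natDegree ≤ L.length := by
  refine (natDegree_list_prod_le _).trans ?_
  rw [List.map_map]
  refine (List.sum_le_card_nsmul _ 1 ?_).trans (by simp)
  intro d hd
  obtain ⟨l, -, rfl⟩ := List.mem_map.1 hd
  simp

/-- The coefficient is a sum of at most 2^length products of all but k of the numbers x l. Each is
at most the product of the largest entries, which are the last ones since the list is increasing. -/
theorem coeff_list_prod_le (L : List ℝ) (hL : L.Pairwise (· ≤ ·)) (hL0 : ∀ l ∈ L, 0 ≤ l) (x : ℝ → ℝ)
    (hx : ∀ l ∈ L, 0 ≤ x l) (hxl : ∀ l ∈ L, x l ≤ l) (k : ℕ) :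
    ((L.map fun l => X + C (x l)).prod).coeff k ≤ 2 ^ L.length * (L.drop k).prod := by
  induction L generalizing k with
  | nil =>
    simp only [List.map_nil, List.prod_nil, coeff_one, List.drop_nil]
    split_ifs <;> norm_num
  | cons l L ih =>
    rw [List.pairwise_cons] at hL
    have hm : ∀ l' ∈ L, l' ∈ l :: L := fun l' hl' => List.mem_cons_of_mem _ hl'
    have ih := ih hL.2 (fun l hl => hL0 l (hm l hl)) (fun l hl => hx l (hm l hl))
      (fun l hl => hxl l (hm l hl))
    have hl := hx l List.mem_cons_self
    have hll := hxl l List.mem_cons_self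
    have hl0 := hL0 l List.mem_cons_self
    have hnn := coeff_list_prod_nonneg L x fun l hl => hx l (hm l hl)
    have hdrop : ∀ k, 0 ≤ (L.drop k).prod := fun k =>
      List.prod_nonneg fun l' hl' => hL0 l' (hm l' (List.mem_of_mem_drop hl'))
    rw [List.map_cons, List.prod_cons, add_mul, coeff_add, coeff_C_mul, List.length_cons, pow_succ]
    cases k with
    | zero =>
      rw [coeff_X_mul_zero, zero_add, List.drop_zero, List.prod_cons]
      have h0 := ih 0
      rw [List.drop_zero] at h0
      have hd := hdrop 0
      rw [List.drop_zero] at hd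
      calc _ ≤ l * (2 ^ L.length * L.prod) := mul_le_mul hll h0 (hnn 0) hl0
        _ ≤ 2 * (l * (2 ^ L.length * L.prod)) := by
            have : 0 ≤ l * (2 ^ L.length * L.prod) := by positivity
            linarith
        _ = _ := by ring
    | succ k =>
      rw [coeff_X_mul, List.drop_succ_cons]
      have h1 := ih k
      have h2 : x l * ((L.map fun l => X + C (x l)).prod).coeff (k + 1) ≤
          2 ^ L.length * (L.drop k).prod := by
        by_cases hk : k < L.length
        · rw [List.drop_eq_getElem_cons hk, List.prod_cons]
          calc _ ≤ l * (2 ^ L.length * (L.drop (k + 1)).prod) :=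
                mul_le_mul hll (ih _) (hnn _) hl0
            _ ≤ L[k] * (2 ^ L.length * (L.drop (k + 1)).prod) := by
                refine mul_le_mul_of_nonneg_right (hL.1 _ (List.getElem_mem hk)) ?_
                have := hdrop (k + 1)
                positivity
            _ = _ := by ring
        · rw [coeff_eq_zero_of_natDegree_lt, mul_zero]
          · have := hdrop k
            positivity
          · exact (natDegree_list_prod_X_add_C L x).trans_lt (by omega)
      linarith

/-- The right side is an elementary symmetric function of nonnegative numbers, and the left side is
one of its terms. -/
theorem le_coeff_list_prod (L : List ℝ) (x : ℝ → ℝ) (hx : ∀ l ∈ L, 0 ≤ x l) {k : ℕ}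
    (hk : k ≤ L.length) :
    ((L.drop k).map x).prod ≤ ((L.map fun l => X + C (x l)).prod).coeff k := by
  induction L generalizing k with
  | nil =>
    obtain rfl : k = 0 := by simpa using hk
    simp
  | cons l L ih =>
    have hm : ∀ l' ∈ L, l' ∈ l :: L := fun l' hl' => List.mem_cons_of_mem _ hl'
    have ih := @ih fun l hl => hx l (hm l hl)
    have hl := hx l List.mem_cons_self
    have hnn := coeff_list_prod_nonneg L x fun l hl => hx l (hm l hl)
    rw [List.map_cons, List.prod_cons, add_mul, coeff_add, coeff_C_mul]
    cases k with
    | zero =>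
      rw [coeff_X_mul_zero, zero_add, List.drop_zero, List.map_cons, List.prod_cons]
      have h0 := @ih 0 (Nat.zero_le _)
      rw [List.drop_zero] at h0
      exact mul_le_mul_of_nonneg_left h0 hl
    | succ k =>
      rw [coeff_X_mul, List.drop_succ_cons]
      have h1 := @ih k (by simpa using hk)
      have h2 := mul_nonneg hl (hnn (k + 1))
      linarith

end Polynomial

/-- The numbering of the roots starts at 2, so the root with number i is at position i - 2, and the
sum starting at j + 1 leaves out the first j - 1 entries. -/
theorem List.log_prod_drop {L : List ℝ} (hL : ∀ l ∈ L, 0 < l) {j : ℕ} (hj : 1 ≤ j) :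
    ∑ i ∈ Finset.Icc (j + 1) (L.length + 1), Real.log (L.getD (i - 2) 0) =
      Real.log (L.drop (j - 1)).prod := by
  have h1 : ∀ M : List ℝ, (∀ l ∈ M, 0 < l) → Real.log M.prod = (M.map Real.log).sum := by
    intro M hM
    induction M with
    | nil => simp
    | cons l M ih =>
      have ih := ih fun l hl => hM l (List.mem_cons_of_mem _ hl)
      rw [List.prod_cons, List.map_cons, List.sum_cons, ← ih, Real.log_mul]
      · exact (hM l List.mem_cons_self).ne'
      · exact (List.prod_pos fun l hl => hM l (List.mem_cons_of_mem _ hl)).ne'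
  rw [h1 _ fun l hl => hL l (List.mem_of_mem_drop hl), ← Fin.sum_univ_fun_getElem]
  have h2 : ∀ i : Fin (L.drop (j - 1)).length, Real.log ((L.drop (j - 1))[i.1]) =
      (fun i : ℕ => Real.log (L.getD (j - 1 + i) 0)) i := by
    intro i
    have hi := i.isLt
    have hlen := List.length_drop (i := j - 1) (l := L)
    simp only [List.getElem_drop]
    rw [List.getD_eq_getElem _ _ (by omega)]
  rw [Finset.sum_congr rfl fun i _ => h2 i,
    Fin.sum_univ_eq_sum_range (fun i : ℕ => Real.log (L.getD (j - 1 + i) 0)), List.length_drop]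
  rw [← Finset.Ico_add_one_right_eq_Icc, Finset.sum_Ico_eq_sum_range]
  refine Finset.sum_congr ?_ fun i _ => ?_
  · congr 1
    omega
  · congr 2
    omega

/-! ### Growth rate of the cycle-rooted spanning forests -/

namespace PeriodicGraph

variable {V E : Type*} [Fintype V] [DecidableEq V] [Fintype E] [DecidableEq E]
  {G : PeriodicGraph V E} {c : E → ℝ}

-- A factor with parameter l becomes one with parameter l^n; the factor x, with parameter 1, is
-- unchanged.
open Polynomial in
theorem forestPolyPower_eq_of_list {n : ℕ} [NeZero n] (hG : G.Annular) (hGn : (G.power n).Annular)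
    {L : List ℝ} {a : ℝ} (hL : ∀ l ∈ L, 1 < l)
    (h : G.forestPoly c = C a * X * (L.map fun l => X + C (l + l⁻¹ - 2)).prod) :
    G.forestPolyPower c n = C (a ^ n) * X *
      ((L.map (· ^ n)).map fun l => X + C (l + l⁻¹ - 2)).prod := by
  have hL' : ∀ l ∈ 1 :: L, l ≠ 0 := by
    intro l hl
    rcases List.mem_cons.1 hl with rfl | hl
    · norm_num
    · linarith [hL l hl]
  let r : Fin (1 :: L).length → ℂˣ := fun i =>
    Units.mk0 (((1 :: L)[i.1] : ℝ) : ℂ) (by exact_mod_cast hL' _ (List.getElem_mem i.2))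
  have hgen : ∀ k : ℕ, ∏ i, (X - C (2 - (r i : ℂ) ^ k - ((r i : ℂ) ^ k)⁻¹)) =
      (X * ((L.map (· ^ k)).map fun l => X + C (l + l⁻¹ - 2)).prod).map (algebraMap ℝ ℂ) := by
    intro k
    have h1 : ∀ i, (X - C (2 - (r i : ℂ) ^ k - ((r i : ℂ) ^ k)⁻¹)) =
        (fun l : ℝ => (X + C (l ^ k + (l ^ k)⁻¹ - 2)).map (algebraMap ℝ ℂ)) (1 :: L)[i.1] := by
      intro i
      simp only [r, Units.val_mk0, Polynomial.map_add, map_X, map_C]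
      rw [sub_eq_add_neg, ← C_neg]
      congr 2
      simp
      ring
    refine (Finset.prod_congr rfl fun i _ => h1 i).trans
      ((Fin.prod_univ_fun_getElem (1 :: L) fun l : ℝ =>
        (X + C (l ^ k + (l ^ k)⁻¹ - 2)).map (algebraMap ℝ ℂ)).trans ?_)
    rw [List.map_cons, List.prod_cons, Polynomial.map_mul, Polynomial.map_list_prod, List.map_map, List.map_map]
    congr 1
    rw [one_pow, inv_one]
    norm_num
  apply Polynomial.map_injective _ (algebraMap ℝ ℂ).injective
  have h1 := forestPolyPower_map_eq_prod (n := n) hG hGn (c := c) (a := (a : ℂ)) (r := r) ?_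
  · rw [h1, hgen, mul_assoc, Polynomial.map_mul (algebraMap ℝ ℂ) (p := C (a ^ n)), map_C,
      map_pow (algebraMap ℝ ℂ)]
    rfl
  · have := hgen 1
    simp only [pow_one, List.map_id'] at this
    rw [this, h, mul_assoc, Polynomial.map_mul, map_C]
    rfl

open Polynomial in
theorem crsfSum_eq_of_list {n : ℕ} [NeZero n] (hG : G.Annular) (hGn : (G.power n).Annular)
    {L : List ℝ} {a : ℝ} (hL : ∀ l ∈ L, 1 < l)
    (h : G.forestPoly c = C a * X * (L.map fun l => X + C (l + l⁻¹ - 2)).prod) {j : ℕ} (hj : 1 ≤ j) :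
    G.crsfSum c j n =
      a ^ n * (((L.map (· ^ n)).map fun l => X + C (l + l⁻¹ - 2)).prod).coeff (j - 1) := by
  rw [crsfSum_eq_coeff]
  change (G.forestPolyPower c n).coeff j = _
  rw [forestPolyPower_eq_of_list hG hGn hL h, mul_assoc, coeff_C_mul]
  obtain ⟨k, rfl⟩ := Nat.exists_eq_add_of_le' hj
  rw [coeff_X_mul, Nat.add_sub_cancel]

theorem add_inv_sub_two_nonneg {l : ℝ} (hl : 0 < l) : 0 ≤ l + l⁻¹ - 2 := by
  have : l + l⁻¹ - 2 = (l - 1) ^ 2 / l := by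
    field_simp
    ring
  rw [this]
  positivity

theorem crsfSum_le_of_list {n : ℕ} [NeZero n] (hG : G.Annular) (hGn : (G.power n).Annular)
    {L : List ℝ} {a : ℝ} (ha : 0 < a) (hL : ∀ l ∈ L, 1 < l) (hLs : L.Pairwise (· ≤ ·))
    (h : G.forestPoly c = Polynomial.C a * Polynomial.X *
      (L.map fun l => Polynomial.X + Polynomial.C (l + l⁻¹ - 2)).prod) {j : ℕ} (hj : 1 ≤ j) :
    G.crsfSum c j n ≤ 2 ^ L.length * (a * (L.drop (j - 1)).prod) ^ n := by
  rw [crsfSum_eq_of_list hG hGn hL h hj]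
  have hLn : ∀ l ∈ L.map (· ^ n), 1 ≤ l := by
    intro l hl
    obtain ⟨l', hl', rfl⟩ := List.mem_map.1 hl
    exact one_le_pow₀ (hL l' hl').le
  have hs : (L.map (· ^ n)).Pairwise (· ≤ ·) := by
    rw [List.pairwise_map]
    exact hLs.imp_of_mem fun {x y} hx _ hxy => pow_le_pow_left₀ (by linarith [hL x hx]) hxy n
  have h1 := Polynomial.coeff_list_prod_le (L.map (· ^ n)) hs (fun l hl => by linarith [hLn l hl])
    (fun l => l + l⁻¹ - 2) (fun l hl => add_inv_sub_two_nonneg (by linarith [hLn l hl]))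
    (fun l hl => by linarith [inv_le_one_of_one_le₀ (hLn l hl)]) (j - 1)
  rw [List.length_map, ← List.map_drop] at h1
  have h2 : ((L.drop (j - 1)).map (· ^ n)).prod = (L.drop (j - 1)).prod ^ n :=
    List.prod_hom _ (powMonoidHom n : ℝ →* ℝ)
  rw [h2] at h1
  calc _ ≤ a ^ n * (2 ^ L.length * (L.drop (j - 1)).prod ^ n) := by gcongr
    _ = _ := by rw [mul_pow]; ring

theorem le_crsfSum_of_list (hG : G.Annular) (hGn : ∀ (n : ℕ) [NeZero n], (G.power n).Annular)
    {L : List ℝ} {a : ℝ} (ha : 0 < a) (hL : ∀ l ∈ L, 1 < l)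
    (h : G.forestPoly c = Polynomial.C a * Polynomial.X *
      (L.map fun l => Polynomial.X + Polynomial.C (l + l⁻¹ - 2)).prod) {j : ℕ} (hj : 1 ≤ j)
    (hjL : j ≤ L.length + 1) :
    ∀ᶠ n : ℕ in Filter.atTop,
      (1 / 2) ^ (L.drop (j - 1)).length * (a * (L.drop (j - 1)).prod) ^ n ≤ G.crsfSum c j n := by
  -- Once l^n ≥ 4, the number l^n + l^(-n) - 2 is at least l^n / 2.
  have hlarge : ∀ M : List ℝ, (∀ l ∈ M, 1 < l) → ∀ᶠ n : ℕ in Filter.atTop, ∀ l ∈ M, 4 ≤ l ^ n := by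
    intro M hM
    induction M with
    | nil => simp
    | cons l M ih =>
      have ih := ih fun l hl => hM l (List.mem_cons_of_mem _ hl)
      have := (tendsto_pow_atTop_atTop_of_one_lt (hM l List.mem_cons_self)).eventually_ge_atTop 4
      filter_upwards [ih, this] with n h1 h2
      intro l' hl'
      rcases List.mem_cons.1 hl' with rfl | hl'
      · exact h2
      · exact h1 l' hl'
  filter_upwards [hlarge L hL, Filter.eventually_gt_atTop 0] with n hn hn0
  have : NeZero n := ⟨hn0.ne'⟩
  rw [crsfSum_eq_of_list hG (hGn n) hL h hj]
  have h1 := Polynomial.le_coeff_list_prod (L.map (· ^ n)) (fun l => l + l⁻¹ - 2) (by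
    intro l hl
    obtain ⟨l', hl', rfl⟩ := List.mem_map.1 hl
    exact add_inv_sub_two_nonneg (pow_pos (by linarith [hL l' hl']) n)) (k := j - 1) (by
      rw [List.length_map]; omega)
  rw [← List.map_drop, List.map_map] at h1
  have h2 : ∀ M : List ℝ, (∀ l ∈ M, 4 ≤ l ^ n) → (1 / 2) ^ M.length * M.prod ^ n ≤
      (M.map ((fun l => l + l⁻¹ - 2) ∘ (· ^ n))).prod := by
    intro M hM
    induction M with
    | nil => simp
    | cons l M ih =>
      have ih := ih fun l hl => hM l (List.mem_cons_of_mem _ hl)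
      have hl := hM l List.mem_cons_self
      rw [List.map_cons, List.prod_cons, List.prod_cons, List.length_cons, mul_pow]
      have h3 : (1 / 2) * l ^ n ≤ ((fun l : ℝ => l + l⁻¹ - 2) ∘ (· ^ n)) l := by
        simp only [Function.comp_apply]
        have : 0 < (l ^ n)⁻¹ := inv_pos.2 (by linarith)
        linarith
      have h4 : 0 ≤ (M.map ((fun l : ℝ => l + l⁻¹ - 2) ∘ (· ^ n))).prod := by
        refine List.prod_nonneg fun x hx => ?_
        obtain ⟨l', hl', rfl⟩ := List.mem_map.1 hx
        exact add_inv_sub_two_nonneg (by linarith [hM l' (List.mem_cons_of_mem _ hl')])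
      calc (1 / 2) ^ (M.length + 1) * (l ^ n * M.prod ^ n) =
          ((1 / 2) * l ^ n) * ((1 / 2) ^ M.length * M.prod ^ n) := by ring
        _ ≤ ((1 / 2) * l ^ n) * (M.map ((fun l : ℝ => l + l⁻¹ - 2) ∘ (· ^ n))).prod :=
            mul_le_mul_of_nonneg_left ih (by linarith)
        _ ≤ _ := mul_le_mul_of_nonneg_right h3 h4
  have h5 := (h2 (L.drop (j - 1)) fun l hl => hn l (List.mem_of_mem_drop hl)).trans h1
  calc _ = a ^ n * ((1 / 2) ^ (L.drop (j - 1)).length * (L.drop (j - 1)).prod ^ n) := by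
        rw [mul_pow]; ring
    _ ≤ _ := by gcongr

end PeriodicGraph

/-! ### Lower bound for windows: lifting cycle-rooted spanning forests -/

namespace PeriodicGraph

variable {V E : Type*} [Fintype V] [DecidableEq V] [Fintype E] [DecidableEq E]

/-- The configuration of `F` in the window of length `n`, as a set of edges of `𝒢_n`. -/
def fold (n : ℕ) (F : Set (E × ℤ)) : Set (E × ZMod n) := {x | (x.1, (x.2.val : ℤ)) ∈ F}

theorem fold_lift {n : ℕ} [NeZero n] (F : Set (E × ZMod n)) : fold n (lift n F) = F := by
  ext x
  simp [fold, lift]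

/-- Identifying the window with the edges of 𝒢_n lets window configurations and CRSFs be compared as
subsets of the same finite set. -/
theorem windowSum_eq_sum (G : PeriodicGraph V E) (c : E → ℝ) (j n : ℕ) [NeZero n] :
    G.windowSum c j n = ∑ D ∈ Finset.univ.filter (fun D : Finset (E × ZMod n) =>
      ∃ F ∈ G.esf j, fold n F = (D : Set (E × ZMod n))), ∏ x ∈ D, c x.1 := by
  have hn : (0 : ℤ) < n := by exact_mod_cast NeZero.pos n
  have hmem : ∀ (F : Set (E × ℤ)) (x : E × ℤ), x ∈ window E n →
      (x ∈ F ↔ (x.1, (x.2 : ZMod n)) ∈ fold n F) := by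
    intro F x hx
    have : ((x.2 : ZMod n).val : ℤ) = x.2 := by
      rw [ZMod.val_intCast, Int.emod_eq_of_lt hx.1 hx.2]
    simp only [fold, Set.mem_ofPred_eq, this]
  have hfw : ∀ F : Set (E × ℤ), fold n (F ∩ window E n) = fold n F := by
    intro F
    ext x
    simp only [fold, Set.mem_ofPred_eq, Set.mem_inter_iff, and_iff_left_iff_imp]
    intro _
    exact ⟨by positivity, Nat.cast_lt.2 (ZMod.val_lt x.2)⟩
  have h1 : G.windowSum c j n = weightedSum c (fold n '' G.esf j) := by
    refine finsum_mem_eq_of_bijOn (fold n) ⟨?_, ?_, ?_⟩ ?_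
    · rintro _ ⟨F, hF, rfl⟩
      exact ⟨F, hF, (hfw F).symm⟩
    · rintro _ ⟨F, hF, rfl⟩ _ ⟨F', hF', rfl⟩ h
      simp only [hfw] at h
      ext x
      by_cases hx : x ∈ window E n
      · simp only [Set.mem_inter_iff, hx, and_true, hmem F x hx, hmem F' x hx, h]
      · simp [hx]
    · rintro _ ⟨F, hF, rfl⟩
      exact ⟨_, ⟨F, hF, rfl⟩, hfw F⟩
    · rintro _ ⟨F, hF, rfl⟩
      rw [hfw]
      refine finprod_mem_eq_of_bijOn (fun x : E × ℤ => (x.1, (x.2 : ZMod n))) ⟨?_, ?_, ?_⟩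
        fun _ _ => rfl
      · intro x hx
        exact (hmem F x hx.2).1 hx.1
      · rintro ⟨e, k⟩ hx ⟨e', k'⟩ hx' h
        simp only [Prod.mk.injEq] at h
        obtain ⟨rfl, h⟩ := h
        have h2 := congrArg (fun a : ZMod n => (a.val : ℤ)) h
        simp only [ZMod.val_intCast] at h2
        rw [Int.emod_eq_of_lt hx.2.1 hx.2.2, Int.emod_eq_of_lt hx'.2.1 hx'.2.2] at h2
        exact Prod.ext rfl h2
      · intro x hx
        refine ⟨(x.1, (x.2.val : ℤ)), ⟨hx, by positivity, Nat.cast_lt.2 (ZMod.val_lt x.2)⟩, ?_⟩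
        simp
  rw [h1, weightedSum_eq_sum]
  refine Finset.sum_congr ?_ fun _ _ => rfl
  ext D
  simp only [Finset.mem_filter, Finset.mem_univ, true_and]
  rfl

theorem Good.exists_form_eq {K : Type*} [Field K] {H : PeriodicGraph V E} (hH : H.Annular)
    {F : Finset E} (hF : H.Good F) {z : Kˣ} (hz : (z : K) ≠ 1) (b : E → K) :
    ∃ f : V → K, ∀ e ∈ F, H.form z e f = b e := by
  let φ : (V → K) →ₗ[K] (F → K) := LinearMap.pi fun e => H.form z e
  have hφ : Function.Injective φ := by
    rw [← LinearMap.ker_eq_bot, eq_bot_iff, ← (nullspace_eq_bot_iff hH hz (F : Set E)).2 hF.2]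
    intro f hf
    refine mem_nullspace.2 fun e he => ?_
    exact congrFun (LinearMap.mem_ker.1 hf) ⟨e, he⟩
  have hsurj : Function.Surjective φ := by
    refine (LinearMap.injective_iff_surjective_of_finrank_eq_finrank ?_).1 hφ
    rw [Module.finrank_fintype_fun_eq_card, Module.finrank_fintype_fun_eq_card, ← hF.1,
      Fintype.card_coe]
  obtain ⟨f, hf⟩ := hsurj fun e => b e
  exact ⟨f, fun e he => congrFun hf ⟨e, he⟩⟩

variable {G : PeriodicGraph V E} {n : ℕ} [NeZero n]

/-- The lift of a good set is a forest. -/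
theorem Good.isForest_lift (hGn : (G.power n).Annular) {F : Finset (E × ZMod n)}
    (hF : (G.power n).Good F) : G.cover.IsForest (lift n (F : Set (E × ZMod n))) := by
  intro x hx hreach
  -- With z the variable of formal Laurent series, functions with values in this field are read off
  -- coefficientwise as functions on the cover, and equations on 𝒢_n at z become equations on each
  -- edge of 𝒢.
  let z : (LaurentSeries ℝ)ˣ :=
    Units.mk0 (HahnSeries.single (1 : ℤ) (1 : ℝ)) (HahnSeries.single_ne_zero one_ne_zero)
  have hzpow : ∀ s : ℤ, ((z ^ s : (LaurentSeries ℝ)ˣ) : LaurentSeries ℝ) = HahnSeries.single s 1 := by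
    intro s
    rw [Units.val_zpow_eq_zpow_val]
    exact (RatFunc.single_zpow s).symm
  have hz : (z : LaurentSeries ℝ) ≠ 1 := by
    intro h
    have := congrArg (fun g : LaurentSeries ℝ => g.coeff 0) h
    simp [z] at this
  set r := roll n x with hr
  obtain ⟨f, hf⟩ := hF.exists_form_eq hGn hz
    (fun e => if e = r.1 then HahnSeries.single (-r.2) (1 : ℝ) else 0)
  -- The right-hand side of the system is a monomial supported on one translate of one edge. So `ψ`
  -- is a potential that jumps across the edge `x` and across no other edge of the lift, which makes
  -- `x` a bridge.
  let ψ : V × ℤ → ℝ := fun y => (f (roll n y).1).coeff (-(roll n y).2)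
  have hψ : ∀ a ∈ lift n (F : Set (E × ZMod n)), ψ (G.cover.tgt a) - ψ (G.cover.src a) =
      if a = x then 1 else 0 := by
    intro a ha
    have h1 : (roll n a).1 ∈ F := by
      have := (unroll_mem_lift (F := (F : Set (E × ZMod n))) (roll n a)).1 (by rwa [unroll_roll])
      exact this
    have hs : roll n (G.cover.src a) = (G.power n).cover.src (roll n a) := by
      rw [← roll_unroll ((G.power n).cover.src _), unroll_src, unroll_roll]
    have ht : roll n (G.cover.tgt a) = (G.power n).cover.tgt (roll n a) := by
      rw [← roll_unroll ((G.power n).cover.tgt _), unroll_tgt, unroll_roll]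
    have h2 := congrArg (fun g : LaurentSeries ℝ => g.coeff (-(roll n a).2)) (hf _ h1)
    simp only [form_apply, hzpow, HahnSeries.coeff_sub] at h2
    have h3 : -(roll n a).2 = (-(roll n a).2 - (G.power n).shift (roll n a).1) +
        (G.power n).shift (roll n a).1 := by ring
    have h4 : (HahnSeries.single ((G.power n).shift (roll n a).1) (1 : ℝ) *
        f ((G.power n).tgt (roll n a).1)).coeff (-(roll n a).2) =
        (f ((G.power n).tgt (roll n a).1)).coeff
          (-(roll n a).2 - (G.power n).shift (roll n a).1) := by
      conv_lhs => rw [h3, HahnSeries.coeff_single_mul_add]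
      simp
    rw [h4] at h2
    simp only [ψ, hs, ht]
    simp only [cover] at *
    rw [neg_add, ← sub_eq_add_neg, h2]
    by_cases hax : a = x
    · subst hax
      simp [hr]
    · rw [if_neg hax]
      split_ifs with h5
      · rw [HahnSeries.coeff_single_of_ne]
        intro h6
        apply hax
        rw [← unroll_roll (n := n) a, ← unroll_roll (n := n) x]
        congr 1
        exact Prod.ext h5 (by rw [hr] at h6; exact neg_injective h6)
      · rfl
  have h1 := G.cover.eq_of_reachable ψ (fun a ha => ?_) hreach
  · have h2 := hψ x hx
    rw [if_pos rfl, h1, sub_self] at h2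
    norm_num at h2
  · have h2 := hψ a ha.1
    rw [if_neg (show a ≠ x from ha.2)] at h2
    exact (sub_eq_zero.1 h2).symm

theorem Good.lift_mem_esf (hGn : (G.power n).Annular) {F : Finset (E × ZMod n)}
    (hF : (G.power n).Good F) :
    lift n (F : Set (E × ZMod n)) ∈
      G.esf ((G.power n).base.numComponents (F : Set (E × ZMod n))) := by
  have hn : (0 : ℤ) < n := by exact_mod_cast NeZero.pos n
  have hiff : ∀ x y : V × ℤ, (G.cover.spanned (lift n (F : Set (E × ZMod n)))).Reachable x y ↔
      ((G.power n).base.spanned (F : Set (E × ZMod n))).Reachable (roll n x).1 (roll n y).1 := by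
    intro x y
    rw [← hF.2.reachable_iff, ← reachable_unroll, unroll_roll, unroll_roll]
  have hshift : ∀ (x : V × ℤ) (t : ℤ),
      (G.cover.spanned (lift n (F : Set (E × ZMod n)))).Reachable x (x.1, x.2 + n * t) := by
    intro x t
    rw [hiff]
    have : (roll n (x.1, x.2 + n * t)).1 = (roll n x).1 := by simp [roll]
    rw [this]
  have hbi : ∀ (K : (G.cover.spanned (lift n (F : Set (E × ZMod n)))).ConnectedComponent) (N : ℤ),
      (∃ x ∈ K.supp, x.2 ≤ N) ∧ (∃ x ∈ K.supp, N ≤ x.2) := by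
    intro K N
    induction K using SimpleGraph.ConnectedComponent.ind with
    | h x =>
      have hsupp : ∀ t : ℤ, (x.1, x.2 + n * t) ∈
          ((G.cover.spanned (lift n (F : Set (E × ZMod n)))).connectedComponentMk x).supp := by
        intro t
        rw [SimpleGraph.ConnectedComponent.mem_supp_iff, SimpleGraph.ConnectedComponent.eq]
        exact (hshift x t).symm
      constructor
      · refine ⟨_, hsupp (-|x.2 - N|), ?_⟩
        have := le_abs_self (x.2 - N)
        have := abs_nonneg (x.2 - N)
        simp only
        nlinarith
      · refine ⟨_, hsupp (|x.2 - N|), ?_⟩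
        have := neg_abs_le (x.2 - N)
        have := abs_nonneg (x.2 - N)
        simp only
        nlinarith
  refine ⟨⟨hF.isForest_lift hGn, fun K => ?_⟩, ?_, hbi⟩
  · intro hfin
    obtain ⟨M, hM⟩ := (hfin.image Prod.snd).bddAbove
    obtain ⟨x, hx, hxM⟩ := (hbi K (M + 1)).2
    have := hM ⟨x, hx, rfl⟩
    linarith
  · refine Nat.card_congr (Equiv.ofBijective (fun K => K.lift (fun x =>
      ((G.power n).base.spanned (F : Set (E × ZMod n))).connectedComponentMk (roll n x).1)
        (fun x y p _ => SimpleGraph.ConnectedComponent.sound ((hiff x y).1 p.reachable))) ⟨?_, ?_⟩)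
    · intro K K'
      induction K using SimpleGraph.ConnectedComponent.ind with
      | h x =>
        induction K' using SimpleGraph.ConnectedComponent.ind with
        | h y =>
          intro h
          exact SimpleGraph.ConnectedComponent.sound
            ((hiff x y).2 (SimpleGraph.ConnectedComponent.exact h))
    · intro K
      induction K using SimpleGraph.ConnectedComponent.ind with
      | h u =>
        refine ⟨(G.cover.spanned _).connectedComponentMk (unroll (u, 0)), ?_⟩
        show ((G.power n).base.spanned (F : Set (E × ZMod n))).connectedComponentMk
          (roll n (unroll (u, 0))).1 = _
        rw [roll_unroll]

/-- The window of the lift of a CRSF is the CRSF itself, so different CRSFs give different windows.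
-/
theorem crsfSum_le_windowSum (hGn : (G.power n).Annular) {c : E → ℝ} (hc : ∀ e, 0 < c e) (j : ℕ) :
    G.crsfSum c j n ≤ G.windowSum c j n := by
  rw [windowSum_eq_sum, crsfSum, weightedSum_eq_sum]
  refine Finset.sum_le_sum_of_subset_of_nonneg ?_ fun D _ _ =>
    Finset.prod_nonneg fun x _ => (hc x.1).le
  intro F hF
  simp only [Finset.mem_filter, Finset.mem_univ, true_and] at hF ⊢
  rw [mem_crsf_iff] at hF
  refine ⟨lift n (F : Set (E × ZMod n)), ?_, fold_lift _⟩
  rw [← hF.2]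
  exact hF.1.lift_mem_esf hGn

end PeriodicGraph

/-! ### Disjoint bi-infinite paths from the components of a good set -/

namespace PeriodicGraph

variable {V E : Type*} {H : PeriodicGraph V E}

theorem adj_translate {F : Set E} {x y : V × ℤ} (h : (H.coverGraph F).Adj x y) (t : ℤ) :
    (H.coverGraph F).Adj (x.1, x.2 + t) (y.1, y.2 + t) := by
  rw [coverGraph, EdgeGraph.spanned_adj] at h ⊢
  obtain ⟨hne, ⟨e, k⟩, he, h⟩ := h
  refine ⟨fun h' => hne ?_, (e, k + t), he, ?_⟩
  · simp only [Prod.mk.injEq, add_left_inj] at h'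
    exact Prod.ext h'.1 h'.2
  · rcases h with ⟨rfl, rfl⟩ | ⟨rfl, rfl⟩
    · exact Or.inl ⟨rfl, by simp only [cover]; congr 1; ring⟩
    · exact Or.inr ⟨rfl, by simp only [cover]; congr 1; ring⟩

/-- A component of the lift of `F` that is invariant under a translation contains a simple
bi-infinite path. -/
theorem exists_injective_path {F : Set E} {v : V}
    (hv : (H.coverGraph F).Reachable (v, 0) (v, 1)) :
    ∃ p : ℤ → V × ℤ, Function.Injective p ∧ (∀ i, (H.coverGraph F).Adj (p i) (p (i + 1))) ∧
      ∀ i, (H.coverGraph F).Reachable (v, 0) (p i) := by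
  -- Among all paths in the component leading from some vertex to a positive translate of itself, a
  -- shortest one is chosen; its periodic continuation turns out to be simple.
  let S : ℕ → Prop := fun l => ∃ (w : ℕ → V × ℤ) (g : ℤ), 1 ≤ g ∧
    (H.coverGraph F).Reachable (v, 0) (w 0) ∧ (∀ i < l, (H.coverGraph F).Adj (w i) (w (i + 1))) ∧
      w l = ((w 0).1, (w 0).2 + g)
  have hS : ∃ l, S l := by
    obtain ⟨q⟩ := hv
    refine ⟨q.length, q.getVert, 1, le_rfl, by simp, fun i hi => q.adj_getVert_succ hi, ?_⟩
    rw [q.getVert_length, q.getVert_zero]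
    simp
  have hmin := fun l (hl : l < Nat.find hS) => Nat.find_min hS hl
  obtain ⟨w, g, hg, hw0, hadj, hend⟩ := Nat.find_spec hS
  set l := Nat.find hS with hl
  have hl0 : 0 < l := by
    rcases Nat.eq_zero_or_pos l with h | h
    · rw [h] at hend
      have := congrArg Prod.snd hend
      simp only at this
      omega
    · exact h
  have hlz : (0 : ℤ) < l := by exact_mod_cast hl0
  let p : ℤ → V × ℤ := fun i => ((w (i % l).toNat).1, (w (i % l).toNat).2 + g * (i / l))
  have hp : ∀ (r : ℕ) (q : ℤ), r < l → p (r + l * q) = ((w r).1, (w r).2 + g * q) := by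
    intro r q hr
    have h1 : ((r : ℤ) + l * q) % l = r := by
      rw [Int.add_mul_emod_self_left]
      exact Int.emod_eq_of_lt (by positivity) (by exact_mod_cast hr)
    have h2 : ((r : ℤ) + l * q) / l = q := by
      rw [Int.add_mul_ediv_left _ _ hlz.ne', Int.ediv_eq_zero_of_lt (by positivity)
        (by exact_mod_cast hr), zero_add]
    simp only [p, h1, h2, Int.toNat_natCast]
  have hdecomp : ∀ i : ℤ, ∃ (r : ℕ) (q : ℤ), r < l ∧ i = r + l * q := by
    intro i
    refine ⟨(i % l).toNat, i / l, ?_, ?_⟩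
    · have := Int.emod_lt_of_pos i hlz
      have := Int.emod_nonneg i hlz.ne'
      omega
    · rw [Int.toNat_of_nonneg (Int.emod_nonneg i hlz.ne')]
      exact (Int.emod_add_mul_ediv i l).symm
  have hpadj : ∀ i, (H.coverGraph F).Adj (p i) (p (i + 1)) := by
    intro i
    obtain ⟨r, q, hr, rfl⟩ := hdecomp i
    have h1 := adj_translate (hadj r hr) (g * q)
    rw [hp r q hr]
    by_cases hr1 : r + 1 < l
    · have : (r : ℤ) + l * q + 1 = ((r + 1 : ℕ) : ℤ) + l * q := by push_cast; ring
      rw [this, hp _ _ hr1]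
      exact h1
    · have hrl : r + 1 = l := by omega
      have : (r : ℤ) + l * q + 1 = ((0 : ℕ) : ℤ) + l * (q + 1) := by
        have : (r : ℤ) + 1 = l := by exact_mod_cast hrl
        push_cast
        linarith
      rw [this, hp _ _ hl0]
      rw [hrl, hend] at h1
      convert h1 using 2
      simp only
      ring
  have hpper : ∀ i q : ℤ, p (i + l * q) = ((p i).1, (p i).2 + g * q) := by
    intro i q
    obtain ⟨r, q', hr, rfl⟩ := hdecomp i
    rw [add_assoc, ← mul_add, hp _ _ hr, hp _ _ hr]
    simp only [Prod.mk.injEq, true_and]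
    ring
  have hreach : ∀ i, (H.coverGraph F).Reachable (v, 0) (p i) := by
    have h0 : p 0 = w 0 := by
      have := hp 0 0 hl0
      simpa using this
    intro i
    induction i using Int.induction_on with
    | zero => rwa [h0]
    | succ i ih => exact ih.trans (hpadj i).reachable
    | pred i ih =>
      have := hpadj (-i - 1)
      rw [sub_add_cancel] at this
      exact ih.trans this.symm.reachable
  have key : ∀ i i' : ℤ, i < i' → p i ≠ p i' := by
    intro i i' hlt heq
    obtain ⟨d, t, hd, hdt⟩ := hdecomp (i' - i)
    have ht : 0 ≤ t := by
      by_contra ht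
      have h1 : t ≤ -1 := by omega
      have h2 : (d : ℤ) < l := by exact_mod_cast hd
      nlinarith
    have hi' : i' = i + d + l * t := by linarith
    rw [hi', hpper] at heq
    rcases Nat.eq_zero_or_pos d with rfl | hd0
    · have h1 := congrArg Prod.snd heq
      simp only [Nat.cast_zero, add_zero] at h1
      have h2 : g * t = 0 := by linarith
      rcases mul_eq_zero.1 h2 with h3 | h3
      · omega
      · rw [h3] at hi'
        simp at hi'
        omega
    -- A repetition p i = p (i + d + l t) says that p i is p (i + d) translated by g t. The stretch
    -- from i + d to i + l then leads from a vertex to its translate by g (t + 1) in fewer steps.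
    · refine hmin (l - d) (by omega) ⟨fun s => p (i + d + s), g * (t + 1), ?_, hreach _, ?_, ?_⟩
      · nlinarith
      · intro s _
        have := hpadj (i + d + s)
        convert this using 2
        push_cast
        ring
      · have h1 : i + d + ((l - d : ℕ) : ℤ) = i + l * 1 := by
          rw [Nat.cast_sub hd.le]
          ring
        simp only [h1, Nat.cast_zero, add_zero, hpper, heq]
        refine Prod.ext rfl ?_
        simp only
        ring
  refine ⟨p, fun i i' h => ?_, hpadj, hreach⟩
  rcases lt_trichotomy i i' with hlt | rfl | hlt
  · exact absurd h (key i i' hlt)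
  · rfl
  · exact absurd h.symm (key i' i hlt)

theorem hasDisjointPaths_numComponents [Finite V] {F : Set E} (hF : H.Winds F) :
    H.HasDisjointPaths (H.base.numComponents F) := by
  let e : Fin (H.base.numComponents F) ≃ (H.base.spanned F).ConnectedComponent :=
    (Finite.equivFinOfCardEq rfl).symm
  choose rep hrep using fun K : (H.base.spanned F).ConnectedComponent => K.exists_rep
  choose p hp1 hp2 hp3 using fun v : V => exists_injective_path (hF v)
  refine ⟨fun a => p (rep (e a)), fun a i => ?_, ?_⟩
  · have := hp2 (rep (e a)) i
    rw [coverGraph, EdgeGraph.spanned_adj] at this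
    rw [EdgeGraph.spanned_adj]
    obtain ⟨h1, x, -, h2⟩ := this
    exact ⟨h1, x, Set.mem_univ _, h2⟩
  · rintro ⟨a, i⟩ ⟨a', i'⟩ h
    simp only at h
    have h1 := (hp3 (rep (e a)) i).trans (h ▸ (hp3 (rep (e a')) i').symm)
    have h2 := SimpleGraph.ConnectedComponent.sound (reachable_base h1)
    have h3 : e a = e a' := by
      rw [← hrep (e a), ← hrep (e a')]
      exact h2
    obtain rfl := e.injective h3
    rw [hp1 _ h]

end PeriodicGraph

/-! ### Cycles of a permutation with integer weights -/

section Cycles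

variable {X : Type*} [Fintype X] (σ : Equiv.Perm X) (q : X → ℤ)

/-- The sum of `q` over the cycle of `x`. -/
def cycleSum (x : X) : ℤ := ∑ y ∈ Finset.univ.filter (fun y => σ.SameCycle x y), q y

variable {σ q}

theorem cycleSum_eq_of_sameCycle {x y : X} (h : σ.SameCycle x y) :
    cycleSum σ q x = cycleSum σ q y := by
  refine Finset.sum_congr ?_ fun _ _ => rfl
  ext z
  simp only [Finset.mem_filter, Finset.mem_univ, true_and]
  exact ⟨fun h' => h.symm.trans h', fun h' => h.trans h'⟩

theorem exists_period (x : X) : ∃ L : ℕ, 0 < L ∧ (σ ^ L) x = x ∧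
    (∀ i : ℕ, (σ ^ i) x = x → L ∣ i) ∧
    cycleSum σ q x = ∑ t ∈ Finset.range L, q ((σ ^ t) x) := by
  have hpow : ∀ t, (σ ^ t) x = σ^[t] x := fun t => by rw [Equiv.Perm.iterate_eq_pow]
  have hper : x ∈ Function.periodicPts σ := by
    refine ⟨orderOf σ, orderOf_pos σ, ?_⟩
    rw [Function.IsPeriodicPt, Function.IsFixedPt, ← hpow, pow_orderOf_eq_one]
    rfl
  refine ⟨Function.minimalPeriod σ x, Function.minimalPeriod_pos_of_mem_periodicPts hper, ?_, ?_, ?_⟩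
  · rw [hpow]
    exact Function.iterate_minimalPeriod
  · intro i hi
    rw [hpow] at hi
    exact Function.IsPeriodicPt.minimalPeriod_dvd hi
  · symm
    refine Finset.sum_nbij (fun t => (σ ^ t) x) ?_ ?_ ?_ fun _ _ => rfl
    · intro t _
      simp only [Finset.mem_filter, Finset.mem_univ, true_and]
      exact ⟨t, by simp⟩
    · intro s hs t ht h
      simp only [Finset.coe_range, Set.mem_Iio] at hs ht
      simp only [hpow] at h
      exact Function.iterate_injOn_Iio_minimalPeriod hs ht h
    · intro y hy
      simp only [Finset.coe_filter, Finset.mem_univ, true_and, Set.mem_ofPred_eq] at hy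
      obtain ⟨i, hi⟩ := hy.exists_nat_pow_eq
      refine ⟨i % Function.minimalPeriod σ x, ?_, ?_⟩
      · simpa using Nat.mod_lt _ (Function.minimalPeriod_pos_of_mem_periodicPts hper)
      · simp only
        rw [hpow, Function.iterate_mod_minimalPeriod_eq, ← hpow, hi]

/-- The canonical element of the cycle of `x`. -/
def cycleRep (σ : Equiv.Perm X) (x : X) : X :=
  (Quotient.out (Quotient.mk (Equiv.Perm.SameCycle.setoid σ) x))

theorem sameCycle_cycleRep (x : X) : σ.SameCycle (cycleRep σ x) x :=
  Quotient.exact (Quotient.out_eq (Quotient.mk (Equiv.Perm.SameCycle.setoid σ) x))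

theorem cycleRep_eq_iff {x y : X} : cycleRep σ x = cycleRep σ y ↔ σ.SameCycle x y := by
  constructor
  · intro h
    have h1 := sameCycle_cycleRep (σ := σ) x
    rw [h] at h1
    exact h1.symm.trans (sameCycle_cycleRep y)
  · intro h
    have : Quotient.mk (Equiv.Perm.SameCycle.setoid σ) x =
      Quotient.mk (Equiv.Perm.SameCycle.setoid σ) y := Quotient.sound h
    rw [cycleRep, this]
    rfl

/-- The total splits into cycle sums; those that vanish do not count and the others are at most 1.
-/
theorem sum_le_card_image_cycleRep [DecidableEq X] (h1 : ∀ x, cycleSum σ q x ≤ 1) :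
    ∑ x, q x ≤
      ((Finset.univ.filter fun x => cycleSum σ q x ≠ 0).image (cycleRep σ)).card := by
  have hmaps : ∀ x ∈ (Finset.univ : Finset X), cycleRep σ x ∈ Finset.univ.image (cycleRep σ) :=
    fun x hx => Finset.mem_image_of_mem _ hx
  rw [← Finset.sum_fiberwise_of_maps_to hmaps]
  have h2 : ∀ ρ ∈ Finset.univ.image (cycleRep σ),
      ∑ x ∈ Finset.univ.filter (fun x => cycleRep σ x = ρ), q x = cycleSum σ q ρ := by
    intro ρ hρ
    obtain ⟨y, -, rfl⟩ := Finset.mem_image.1 hρ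
    refine Finset.sum_congr ?_ fun _ _ => rfl
    ext x
    simp only [Finset.mem_filter, Finset.mem_univ, true_and]
    rw [cycleRep_eq_iff]
    have := sameCycle_cycleRep (σ := σ) y
    exact ⟨fun h => this.trans h.symm, fun h => (this.symm.trans h).symm⟩
  rw [Finset.sum_congr rfl h2]
  have hsub : (Finset.univ.filter fun x => cycleSum σ q x ≠ 0).image (cycleRep σ) ⊆
      Finset.univ.image (cycleRep σ) := Finset.image_subset_image (Finset.filter_subset _ _)
  rw [← Finset.sum_subset hsub]
  · refine (Finset.sum_le_card_nsmul _ _ 1 fun ρ _ => h1 ρ).trans ?_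
    simp
  · intro ρ hρ hρ'
    by_contra hne
    obtain ⟨y, -, rfl⟩ := Finset.mem_image.1 hρ
    refine hρ' (Finset.mem_image.2 ⟨y, ?_, rfl⟩)
    simp only [Finset.mem_filter, Finset.mem_univ, true_and]
    rwa [← cycleSum_eq_of_sameCycle (sameCycle_cycleRep y)]

end Cycles

/-! ### Permutations that move along edges of an annular graph -/

namespace PeriodicGraph

variable {X Y : Type*} [Fintype X] [DecidableEq X] [Fintype Y] [DecidableEq Y]
  {H : PeriodicGraph X Y}

/-- `η x` joins `(x, 0)` to `(σ x, q x)`, whenever `σ x ≠ x`. -/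
def Follows (H : PeriodicGraph X Y) (σ : Equiv.Perm X) (q : X → ℤ) (η : X → Y) : Prop :=
  ∀ x, (σ x = x → q x = 0) ∧ (σ x ≠ x →
    (H.src (η x) = x ∧ H.tgt (η x) = σ x ∧ H.shift (η x) = q x) ∨
    (H.src (η x) = σ x ∧ H.tgt (η x) = x ∧ H.shift (η x) = -q x))

variable {σ : Equiv.Perm X} {q : X → ℤ} {η : X → Y}

/-- The edges of a winding cycle form a closed curve through distinct vertices. `Annular` gives a
path over these edges that winds once; it stays on the lifts of the curve, which return to a given
vertex only after multiples of the total winding W. So W divides 1. -/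
theorem Follows.abs_cycleSum_le (hH : H.Annular) (h : H.Follows σ q η) (x : X) :
    |cycleSum σ q x| ≤ 1 := by
  obtain ⟨L, hL0, hL, hdvd, hW⟩ := exists_period (σ := σ) (q := q) x
  set W := cycleSum σ q x
  by_cases hW0 : W = 0
  · rw [hW0]
    simp
  let Φ : ℕ → ℤ := fun i => ∑ t ∈ Finset.range i, q ((σ ^ t) x)
  have hΦs : ∀ i, Φ (i + 1) = Φ i + q ((σ ^ i) x) := fun i => Finset.sum_range_succ _ _
  have hσs : ∀ i, (σ ^ (i + 1)) x = σ ((σ ^ i) x) := fun i => by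
    rw [pow_succ']
    rfl
  have hσL : ∀ i, (σ ^ (L + i)) x = (σ ^ i) x := fun i => by
    rw [add_comm, pow_add]
    show (σ ^ i) ((σ ^ L) x) = _
    rw [hL]
  have hΦL : ∀ i, Φ (L + i) = W + Φ i := by
    intro i
    simp only [Φ]
    rw [Finset.sum_range_add, hW]
    simp only [hσL]
  have hΦmul : ∀ d, Φ (L * d) = W * d := by
    intro d
    induction d with
    | zero => simp [Φ]
    | succ d ih =>
      rw [mul_add, mul_one, add_comm, hΦL, ih]
      push_cast
      ring
  let C : Set Y := {e | ∃ y, σ y ≠ y ∧ η y = e ∧ σ.SameCycle x y}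
  have hstep : ∀ i, (H.coverGraph C).Reachable ((σ ^ i) x, Φ i) ((σ ^ (i + 1)) x, Φ (i + 1)) := by
    intro i
    rw [hσs, hΦs]
    set y := (σ ^ i) x with hy
    by_cases hfix : σ y = y
    · rw [hfix, (h y).1 hfix, add_zero]
    · have hC : η y ∈ C := ⟨y, hfix, rfl, ⟨i, by simp [hy]⟩⟩
      rcases (h y).2 hfix with ⟨h1, h2, h3⟩ | ⟨h1, h2, h3⟩
      · have := H.cover.reachable_edge (F := Prod.fst ⁻¹' C) (e := (η y, Φ i)) hC
        simp only [cover, h1, h2, h3] at this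
        exact this
      · have := H.cover.reachable_edge (F := Prod.fst ⁻¹' C) (e := (η y, Φ i + q y)) hC
        simp only [cover, h1, h2, h3, add_neg_cancel_right] at this
        exact this.symm
  have hreach : ∀ i, (H.coverGraph C).Reachable (x, 0) ((σ ^ i) x, Φ i) := by
    intro i
    induction i with
    | zero => exact SimpleGraph.Reachable.refl _
    | succ i ih => exact ih.trans (hstep i)
  have hxW : (H.coverGraph C).Reachable (x, 0) (x, W) := by
    have := hreach L
    rw [hL] at this
    rw [hW]
    exact this
  have hx1 : (H.coverGraph C).Reachable (x, 0) (x, 1) := by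
    rcases lt_or_gt_of_ne hW0 with hneg | hpos
    · refine hH C x (-W) (by omega) ?_
      have := (reachable_translate hxW (-W)).symm
      simpa using this
    · exact hH C x W (by omega) hxW
  -- The lift of the cycle through (x, 0), made invariant under translation by W. Both ends of an
  -- edge of the cycle belong to it or neither does.
  let Z : X × ℤ → Prop := fun u => ∃ (i : ℕ) (t : ℤ), u = ((σ ^ i) x, Φ i + W * t)
  have hZ : ∀ (y : X) (l : ℤ), Z (y, l) ↔ Z (σ y, l + q y) := by
    intro y l
    constructor
    · rintro ⟨i, t, hit⟩
      obtain ⟨rfl, rfl⟩ := Prod.mk.inj hit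
      refine ⟨i + 1, t, Prod.ext (hσs i).symm ?_⟩
      simp only
      rw [hΦs]
      ring
    · rintro ⟨i, t, hit⟩
      have h1 := congrArg Prod.fst hit
      have h2 := congrArg Prod.snd hit
      simp only at h1 h2
      obtain ⟨i', hi'⟩ : ∃ i', L + i = i' + 1 := ⟨L + i - 1, by omega⟩
      have h3 : y = (σ ^ i') x := by
        apply σ.injective
        rw [h1, ← hσL, hi', hσs]
      refine ⟨i', t - 1, Prod.ext h3 ?_⟩
      simp only
      have h4 := hΦL i
      rw [hi', hΦs, ← h3] at h4
      linarith
  have hx1Z : Z (x, 1) := by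
    have := H.cover.eq_of_reachable Z ?_ hx1
    · rw [← this]
      exact ⟨0, 0, by simp [Φ]⟩
    · rintro ⟨e, l⟩ ⟨y, hfix, rfl, -⟩
      apply propext
      rcases (h y).2 hfix with ⟨h1, h2, h3⟩ | ⟨h1, h2, h3⟩
      · simp only [cover, h1, h2, h3]
        exact hZ y l
      · simp only [cover, h1, h2, h3]
        rw [hZ y (l + -q y), neg_add_cancel_right]
  obtain ⟨i, t, hit⟩ := hx1Z
  have h1 := congrArg Prod.fst hit
  have h2 := congrArg Prod.snd hit
  simp only at h1 h2
  obtain ⟨d, rfl⟩ := hdvd i h1.symm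
  rw [hΦmul, ← mul_add] at h2
  exact (Int.isUnit_iff_abs_eq.1 (IsUnit.of_mul_eq_one _ h2.symm)).le

theorem Follows.ne_of_cycleSum_ne_zero (h : H.Follows σ q η) {x : X} (hx : cycleSum σ q x ≠ 0) :
    σ x ≠ x := by
  intro hfix
  obtain ⟨L, hL0, hL, hdvd, hW⟩ := exists_period (σ := σ) (q := q) x
  have h1 := hdvd 1 (by simpa using hfix)
  have : L = 1 := Nat.dvd_one.1 h1
  rw [this] at hW
  simp [(h x).1 hfix] at hW
  exact hx hW

/-- An edge is used twice only by a cycle that goes forth and back along it, and such a cycle has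
total winding 0. -/
theorem Follows.injOn (h : H.Follows σ q η) :
    Set.InjOn η {x | cycleSum σ q x ≠ 0} := by
  intro x hx x' hx' heq
  have key : ∀ x x', cycleSum σ q x ≠ 0 → x = σ x' → σ x = x' → q x = -q x' → False := by
    intro x x' hx h1 h2 h3
    obtain ⟨L, hL0, hL, hdvd, hW⟩ := exists_period (σ := σ) (q := q) x
    have h4 := hdvd 2 (by rw [pow_two]; show σ (σ x) = x; rw [h2, ← h1])
    rcases (Nat.dvd_prime Nat.prime_two).1 h4 with h5 | h5
    · rw [h5] at hL
      exact h.ne_of_cycleSum_ne_zero hx (by simpa using hL)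
    · rw [h5] at hW
      apply hx
      rw [hW, Finset.sum_range_succ, Finset.sum_range_one, pow_zero, pow_one]
      show q x + q (σ x) = 0
      rw [h2, h3]
      ring
  rcases (h x).2 (h.ne_of_cycleSum_ne_zero hx) with ⟨h1, h2, h3⟩ | ⟨h1, h2, h3⟩ <;>
    rcases (h x').2 (h.ne_of_cycleSum_ne_zero hx') with ⟨h1', h2', h3'⟩ | ⟨h1', h2', h3'⟩
  · rw [← h1, heq, h1']
  · rw [heq] at h1 h2 h3
    exact (key x x' hx (h1.symm.trans h1') (h2.symm.trans h2') (h3.symm.trans h3')).elim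
  · rw [heq] at h1 h2 h3
    exact (key x x' hx (h2.symm.trans h2') (h1.symm.trans h1') (by linarith)).elim
  · rw [← h2, heq, h2']

theorem cycleSum_apply (x : X) : cycleSum σ q (σ x) = cycleSum σ q x :=
  cycleSum_eq_of_sameCycle ⟨-1, by simp⟩

/-- The form of `η x`, up to a unit, is `z ^ q x * f (σ x) - f x`. -/
theorem Follows.exists_form (h : H.Follows σ q η) {x : X} (hx : cycleSum σ q x ≠ 0) {K : Type*}
    [Field K] (z : Kˣ) : ∃ u : Kˣ, (z = 1 → ((u : K) * u = 1)) ∧ ∀ f : X → K,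
      H.form z (η x) f = u * (((z ^ q x : Kˣ) : K) * f (σ x) - f x) := by
  rcases (h x).2 (h.ne_of_cycleSum_ne_zero hx) with ⟨h1, h2, h3⟩ | ⟨h1, h2, h3⟩
  · refine ⟨1, by simp, fun f => ?_⟩
    rw [form_apply, h1, h2, h3]
    simp
  · refine ⟨-(z ^ (-q x)), ?_, fun f => ?_⟩
    · rintro rfl
      simp
    · rw [form_apply, h1, h2, h3]
      have : ((z ^ (-q x) : Kˣ) : K) * ((z ^ q x : Kˣ) : K) = 1 := by
        rw [← Units.val_mul, ← zpow_add]
        simp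
      rw [Units.val_neg, mul_sub, ← mul_assoc, neg_mul, this]
      ring

/-- A function annihilated along a winding cycle is multiplied by a nontrivial power of 2 after one
turn, so it vanishes on the cycle. Completed by the coordinates at the other vertices, the forms
give an invertible operator `A`. -/
theorem Follows.linearIndepOn (h : H.Follows σ q η) :
    LinearIndepOn ℝ (H.form (Units.mk0 (2 : ℝ) two_ne_zero)) (η '' {x | cycleSum σ q x ≠ 0}) := by
  set z : ℝˣ := Units.mk0 2 two_ne_zero with hz
  let A : (X → ℝ) →ₗ[ℝ] (X → ℝ) := LinearMap.pi fun x =>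
    if cycleSum σ q x ≠ 0 then
      ((z ^ q x : ℝˣ) : ℝ) • LinearMap.proj (σ x) - LinearMap.proj x else LinearMap.proj x
  have hA1 : ∀ f x, cycleSum σ q x ≠ 0 → A f x = ((z ^ q x : ℝˣ) : ℝ) * f (σ x) - f x := by
    intro f x hx
    simp [A, hx]
  have hA2 : ∀ f x, cycleSum σ q x = 0 → A f x = f x := by
    intro f x hx
    simp [A, hx]
  have hinj : Function.Injective A := by
    rw [← LinearMap.ker_eq_bot, eq_bot_iff]
    intro f hf
    rw [Submodule.mem_bot]
    funext x
    have hf' : ∀ x, A f x = 0 := fun x => congrFun (LinearMap.mem_ker.1 hf) x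
    by_cases hx : cycleSum σ q x = 0
    · rw [← hA2 f x hx, hf']
      rfl
    · obtain ⟨L, hL0, hL, hdvd, hW⟩ := exists_period (σ := σ) (q := q) x
      have hiter : ∀ i : ℕ, cycleSum σ q ((σ ^ i) x) ≠ 0 ∧
          f x = ((z ^ (∑ t ∈ Finset.range i, q ((σ ^ t) x)) : ℝˣ) : ℝ) * f ((σ ^ i) x) := by
        intro i
        induction i with
        | zero => simpa using hx
        | succ i ih =>
          have h1 : (σ ^ (i + 1)) x = σ ((σ ^ i) x) := by
            rw [pow_succ']
            rfl
          refine ⟨by rw [h1, cycleSum_apply]; exact ih.1, ?_⟩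
          have h2 := hf' ((σ ^ i) x)
          rw [hA1 _ _ ih.1, sub_eq_zero] at h2
          rw [Finset.sum_range_succ, zpow_add, Units.val_mul, mul_assoc, h1, h2]
          exact ih.2
      have h1 := (hiter L).2
      rw [hL, ← hW] at h1
      have h2 : ((z ^ cycleSum σ q x : ℝˣ) : ℝ) ≠ 1 := by
        rw [Units.val_zpow_eq_zpow_val]
        intro h3
        have h4 : ((2 : ℝ) ^ cycleSum σ q x) = 2 ^ (0 : ℤ) := by simpa [hz] using h3
        exact hx (zpow_right_injective₀ (by norm_num) (by norm_num) h4)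
      have h3 : (((z ^ cycleSum σ q x : ℝˣ) : ℝ) - 1) * f x = 0 := by linarith
      exact (mul_eq_zero.1 h3).resolve_left (sub_ne_zero.2 h2)
  have hsurj : Function.Surjective A := LinearMap.injective_iff_surjective.1 hinj
  rw [LinearIndepOn, Fintype.linearIndependent_iff]
  rintro g hg ⟨_, x, hx, rfl⟩
  obtain ⟨f, hf⟩ := hsurj (Pi.single x 1)
  obtain ⟨u, -, hu⟩ := h.exists_form hx z
  have h1 := congrArg (fun φ : Module.Dual ℝ (X → ℝ) => φ f) hg
  simp only [LinearMap.sum_apply, LinearMap.smul_apply, LinearMap.zero_apply, smul_eq_mul] at h1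
  rw [Finset.sum_eq_single ⟨η x, x, hx, rfl⟩] at h1
  · rw [hu, ← hA1 f x hx, hf, Pi.single_eq_same, mul_one] at h1
    exact (mul_eq_zero.1 h1).resolve_right u.ne_zero
  · rintro ⟨_, y, hy, rfl⟩ _ hne
    obtain ⟨u', -, hu'⟩ := h.exists_form hy z
    have hyx : y ≠ x := by
      rintro rfl
      exact hne rfl
    rw [hu', ← hA1 f y hy, hf, Pi.single_eq_of_ne hyx]
    simp
  · simp

/-- Since `F` has as many edges as there are vertices, its cycle space, the kernel of `T`, has
dimension equal to the number of components. The winding cycles of σ use distinct edges and so are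
independent elements of it; there are at least as many of them as the total winding. -/
theorem Follows.le_numComponents (hH : H.Annular) (h : H.Follows σ q η) {F : Finset Y}
    (hF : F.card = Fintype.card X) (hηF : η '' {x | cycleSum σ q x ≠ 0} ⊆ F) :
    ∑ x, q x ≤ H.base.numComponents (F : Set Y) := by
  refine (sum_le_card_image_cycleRep fun x =>
    (le_abs_self _).trans (h.abs_cycleSum_le hH x)).trans ?_
  set S := Finset.univ.filter fun x => cycleSum σ q x ≠ 0 with hS
  set R := S.image (cycleRep σ) with hR
  let T : (F → ℝ) →ₗ[ℝ] Module.Dual ℝ (X → ℝ) := Fintype.linearCombination ℝ fun e : F => H.form 1 e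
  have hTr : LinearMap.range T = Submodule.span ℝ (H.form (1 : ℝˣ) '' F) := by
    rw [Fintype.range_linearCombination, Set.image_eq_range]
    rfl
  have h1 := LinearMap.finrank_range_add_finrank_ker T
  rw [hTr, Module.finrank_fintype_fun_eq_card, Fintype.card_coe, hF] at h1
  have h2 := H.finrank_span_add_finrank_nullspace (1 : ℝˣ) (F : Set Y)
  rw [finrank_nullspace_one] at h2
  have h3 : Module.finrank ℝ (LinearMap.ker T) = H.base.numComponents (F : Set Y) := by omega
  have hmemS : ∀ {x}, x ∈ S ↔ cycleSum σ q x ≠ 0 := by simp [hS]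
  choose! u hu1 hu2 using fun (x : X) (hx : cycleSum σ q x ≠ 0) => h.exists_form hx (1 : ℝˣ)
  have hrepR : ∀ x : S, cycleRep σ x ∈ R := fun x => Finset.mem_image_of_mem _ x.2
  -- A coefficient for each winding cycle is spread over its edges with the signs `u x`, which
  -- satisfy u² = 1 at z = 1. Applied to f the result is a sum of b x (f (σ x) - f x) with b
  -- constant on cycles, hence zero.
  let Ψ : (R → ℝ) →ₗ[ℝ] (F → ℝ) := LinearMap.pi fun e =>
    ∑ x : S, if η x = e then ((u x : ℝˣ) : ℝ) • LinearMap.proj (⟨cycleRep σ x, hrepR x⟩ : R) else 0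
  have hΨ : ∀ a e, Ψ a e = ∑ x : S, if η x = (e : Y) then
      ((u x : ℝˣ) : ℝ) * a ⟨cycleRep σ x, hrepR x⟩ else 0 := by
    intro a e
    simp only [Ψ, LinearMap.pi_apply, LinearMap.sum_apply]
    refine Finset.sum_congr rfl fun x _ => ?_
    split_ifs <;> simp
  have hΨinj : Function.Injective Ψ := by
    rw [← LinearMap.ker_eq_bot, eq_bot_iff]
    intro a ha
    rw [Submodule.mem_bot]
    funext ρ
    obtain ⟨x, hx, hxρ⟩ := Finset.mem_image.1 ρ.2
    have hxF : η x ∈ F := hηF ⟨x, hmemS.1 hx, rfl⟩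
    have h4 := congrFun (LinearMap.mem_ker.1 ha) ⟨η x, hxF⟩
    rw [hΨ, Finset.sum_eq_single ⟨x, hx⟩] at h4
    · simp only [if_true, Pi.zero_apply] at h4
      have h5 := (mul_eq_zero.1 h4).resolve_left (u x).ne_zero
      have h6 : (⟨cycleRep σ x, hrepR ⟨x, hx⟩⟩ : R) = ρ := Subtype.ext hxρ
      rw [h6] at h5
      exact h5
    · intro y _ hyx
      rw [if_neg]
      intro h5
      exact hyx (Subtype.ext (h.injOn (hmemS.1 y.2) (hmemS.1 hx) h5))
    · simp
  have hΨker : LinearMap.range Ψ ≤ LinearMap.ker T := by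
    rintro _ ⟨a, rfl⟩
    rw [LinearMap.mem_ker]
    refine LinearMap.ext fun f => ?_
    let b : X → ℝ := fun x => if hx : x ∈ S then a ⟨cycleRep σ x, hrepR ⟨x, hx⟩⟩ else 0
    have hbσ : ∀ x, b (σ x) = b x := by
      intro x
      have h4 : σ x ∈ S ↔ x ∈ S := by rw [hmemS, hmemS, cycleSum_apply]
      have h5 : cycleRep σ (σ x) = cycleRep σ x := cycleRep_eq_iff.2 ⟨-1, by simp⟩
      simp only [b, h4, h5]
    have h4 : T (Ψ a) f = ∑ x : S, b x * (f (σ x) - f x) := by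
      simp only [T, Fintype.linearCombination_apply, LinearMap.sum_apply, LinearMap.smul_apply,
        smul_eq_mul, hΨ, Finset.sum_mul]
      rw [Finset.sum_comm]
      refine Finset.sum_congr rfl fun x _ => ?_
      have hxS := hmemS.1 x.2
      have hxF : η x ∈ F := hηF ⟨x, hxS, rfl⟩
      rw [Finset.sum_eq_single ⟨η x, hxF⟩]
      · simp only [if_true]
        rw [hu2 x hxS]
        have h6 : b x = a ⟨cycleRep σ x, hrepR x⟩ := by
          simp only [b]
          rw [dif_pos x.2]
        rw [h6]
        simp only [one_zpow, Units.val_one, one_mul]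
        have h7 := hu1 x hxS rfl
        linear_combination (a ⟨cycleRep σ x, hrepR x⟩ * (f (σ x) - f x)) * h7
      · intro e _ he
        rw [if_neg, zero_mul]
        intro h6
        exact he (Subtype.ext h6.symm)
      · simp
    have h5 : ∑ x : S, b x * (f (σ x) - f x) = ∑ x : X, b x * (f (σ x) - f x) := by
      rw [Finset.sum_coe_sort S (fun x => b x * (f (σ x) - f x))]
      refine Finset.sum_subset (Finset.subset_univ _) fun x _ hx => ?_
      simp [b, hx]
    rw [h4, h5]
    simp only [mul_sub, Finset.sum_sub_distrib]
    have h6 := Equiv.sum_comp σ fun x => b x * f x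
    simp only [hbσ] at h6
    rw [h6, sub_self]
    rfl
  have h4 := Submodule.finrank_mono hΨker
  rw [LinearMap.finrank_range_of_inj hΨinj, Module.finrank_fintype_fun_eq_card, Fintype.card_coe,
    h3] at h4
  exact Int.ofNat_le.2 h4

end PeriodicGraph

/-! ### Flows across windows -/

namespace PeriodicGraph

section Roll

variable {V E : Type*} {G : PeriodicGraph V E} {n : ℕ} [NeZero n]

theorem cover_src_roll (e : E × ℤ) :
    (G.power n).cover.src (roll n e) = roll n (G.cover.src e) := by
  rw [← roll_unroll ((G.power n).cover.src _), unroll_src, unroll_roll]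

theorem cover_tgt_roll (e : E × ℤ) :
    (G.power n).cover.tgt (roll n e) = roll n (G.cover.tgt e) := by
  rw [← roll_unroll ((G.power n).cover.tgt _), unroll_tgt, unroll_roll]

theorem roll_mk_val (x : V × ZMod n) : roll n (x.1, (x.2.val : ℤ)) = (x, 0) := by
  have := roll_unroll (x, (0 : ℤ))
  simpa [unroll] using this

end Roll

variable {V E : Type*} [Fintype V] {G : PeriodicGraph V E}

/-- `nxt` moves along edges of `F`, each moved vertex `y` along the edge `ε y`; it is injective to the
left of `hi`, and the net number of crossings of each vertical line in `[lo, hi]` is `k`. -/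
structure IsFlow (G : PeriodicGraph V E) (F : Set (E × ℤ)) (s k : ℕ) (lo hi : ℤ)
    (nxt : V × ℤ → V × ℤ) (ε : V × ℤ → E × ℤ) : Prop where
  mem : ∀ y, nxt y ≠ y → ε y ∈ F
  link : ∀ y, nxt y ≠ y → (G.cover.src (ε y) = y ∧ G.cover.tgt (ε y) = nxt y) ∨
    (G.cover.src (ε y) = nxt y ∧ G.cover.tgt (ε y) = y)
  injOn : Set.InjOn nxt {y | y.2 < hi}
  flux : ∀ a, lo ≤ a → a ≤ hi → ∑ y ∈ Finset.univ ×ˢ Finset.Ico (a - s) (a + s),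
    ((if a ≤ (nxt y).2 then 1 else 0) - (if a ≤ y.2 then 1 else 0) : ℤ) = k

variable {F : Set (E × ℤ)} {s k : ℕ} {lo hi : ℤ} {nxt : V × ℤ → V × ℤ} {ε : V × ℤ → E × ℤ}

theorem IsFlow.mono (h : G.IsFlow F s k lo hi nxt ε) {lo' hi' : ℤ} (h1 : lo ≤ lo') (h2 : hi' ≤ hi) :
    G.IsFlow F s k lo' hi' nxt ε where
  mem := h.mem
  link := h.link
  injOn := h.injOn.mono fun _ hy => lt_of_lt_of_le hy h2
  flux a ha ha' := h.flux a (h1.trans ha) (ha'.trans h2)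

/-- The translation by `t`. -/
def trans (t : ℤ) (x : V × ℤ) : V × ℤ := (x.1, x.2 + t)

theorem trans_trans {V : Type*} (t t' : ℤ) (x : V × ℤ) : trans t (trans t' x) = trans (t' + t) x :=
  Prod.ext rfl (add_assoc _ _ _)

theorem trans_zero {V : Type*} (x : V × ℤ) : trans 0 x = x := Prod.ext rfl (add_zero _)

theorem trans_injective {V : Type*} (t : ℤ) : Function.Injective (trans (V := V) t) := by
  intro x y h
  have := congrArg (trans (-t)) h
  simpa [trans_trans, trans_zero] using this

theorem cover_src_trans (t : ℤ) (e : E × ℤ) :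
    G.cover.src (trans t e) = trans t (G.cover.src e) := rfl

theorem cover_tgt_trans (t : ℤ) (e : E × ℤ) :
    G.cover.tgt (trans t e) = trans t (G.cover.tgt e) :=
  Prod.ext rfl (add_right_comm _ _ _)

theorem IsFlow.translate (h : G.IsFlow F s k lo hi nxt ε) (t : ℤ) :
    G.IsFlow (trans t ⁻¹' F) s k (lo - t) (hi - t) (fun y => trans (-t) (nxt (trans t y)))
      (fun y => trans (-t) (ε (trans t y))) := by
  have hne : ∀ y : V × ℤ, trans (-t) (nxt (trans t y)) ≠ y → nxt (trans t y) ≠ trans t y := by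
    intro y hy h'
    apply hy
    rw [h', trans_trans]
    simp [trans_zero]
  refine ⟨fun y hy => ?_, fun y hy => ?_, fun y hy y' hy' heq => ?_, fun a ha ha' => ?_⟩
  · have := h.mem _ (hne y hy)
    simpa [trans_trans, trans_zero] using this
  · have h1 : ∀ z : V × ℤ, z = trans t y → trans (-t) z = y := by
      rintro z rfl
      simp [trans_trans, trans_zero]
    rcases h.link _ (hne y hy) with ⟨h2, h3⟩ | ⟨h2, h3⟩
    · left
      rw [cover_src_trans, cover_tgt_trans, h3]
      exact ⟨h1 _ h2, rfl⟩
    · right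
      rw [cover_src_trans, cover_tgt_trans, h2]
      exact ⟨rfl, h1 _ h3⟩
  · refine trans_injective t (h.injOn ?_ ?_ (trans_injective _ heq))
    · simp only [trans, Set.mem_ofPred_eq] at hy ⊢
      linarith
    · simp only [trans, Set.mem_ofPred_eq] at hy' ⊢
      linarith
  · rw [← h.flux (a + t) (by linarith) (by linarith)]
    refine Finset.sum_nbij' (trans t) (trans (-t)) ?_ ?_ ?_ ?_ ?_
    · simp only [trans, Finset.mem_product, Finset.mem_univ, true_and, Finset.mem_Ico]
      intro y hy
      constructor <;> linarith
    · simp only [trans, Finset.mem_product, Finset.mem_univ, true_and, Finset.mem_Ico]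
      intro y hy
      constructor <;> linarith
    · intro y _
      simp [trans_trans, trans_zero]
    · intro y _
      simp [trans_trans, trans_zero]
    · intro y _
      refine congrArg₂ _ (if_congr ?_ rfl rfl) (if_congr ?_ rfl rfl) <;> simp only [trans] <;>
        constructor <;> intro _ <;> linarith

theorem IsFlow.abs_step_le (h : G.IsFlow F s k lo hi nxt ε) (hs : ∀ e, |G.shift e| ≤ s)
    (y : V × ℤ) : |(nxt y).2 - y.2| ≤ s ∧ |y.2 - (nxt y).2| ≤ s := by
  rw [abs_sub_comm y.2, and_self]
  by_cases hy : nxt y = y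
  · simp [hy]
  · rcases h.link y hy with ⟨h1, h2⟩ | ⟨h1, h2⟩
    · have h3 := congrArg Prod.snd h1
      have h4 := congrArg Prod.snd h2
      simp only [cover] at h3 h4
      rw [← h4, ← h3, add_sub_cancel_left]
      exact hs _
    · have h3 := congrArg Prod.snd h1
      have h4 := congrArg Prod.snd h2
      simp only [cover] at h3 h4
      rw [← h4, ← h3, abs_sub_comm, add_sub_cancel_left]
      exact hs _

theorem IsFlow.abs_edge_le (h : G.IsFlow F s k lo hi nxt ε) (hs : ∀ e, |G.shift e| ≤ s)
    {y : V × ℤ} (hy : nxt y ≠ y) : |(ε y).2 - y.2| ≤ s := by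
  rcases h.link y hy with ⟨h1, h2⟩ | ⟨h1, h2⟩
  · have h3 := congrArg Prod.snd h1
    simp only [cover] at h3
    simp [h3]
  · have h4 := congrArg Prod.snd h2
    simp only [cover] at h4
    rw [← h4, abs_sub_comm, add_sub_cancel_left]
    exact hs _

theorem sum_zmod_eq {n : ℕ} [NeZero n] (g : V × ℤ → ℤ) :
    ∑ x : V × ZMod n, g (x.1, (x.2.val : ℤ)) =
      ∑ y ∈ Finset.univ ×ˢ Finset.Ico (0 : ℤ) n, g y := by
  refine Finset.sum_nbij' (fun x => (x.1, (x.2.val : ℤ))) (fun y => (y.1, (y.2 : ZMod n)))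
    ?_ ?_ ?_ ?_ ?_
  · intro x _
    simp only [Finset.mem_product, Finset.mem_univ, true_and, Finset.mem_Ico]
    exact ⟨by positivity, by exact_mod_cast ZMod.val_lt _⟩
  · simp
  · intro x _
    simp
  · intro y hy
    simp only [Finset.mem_product, Finset.mem_univ, true_and, Finset.mem_Ico] at hy
    refine Prod.ext rfl ?_
    simp only [ZMod.val_intCast]
    exact Int.emod_eq_of_lt hy.1 hy.2
  · simp

/-- A flow that looks the same at `0` and at `n` wraps around `𝒢/nℤ`. -/
theorem IsFlow.exists_follows (h : G.IsFlow F s k lo hi nxt ε) (hs : ∀ e, |G.shift e| ≤ s) {n : ℕ}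
    [NeZero n] (hsn : 2 * s + 1 ≤ n) (hlo : lo ≤ n) (hhi : n + (2 * s + 1) ≤ hi)
    (hper : ∀ y : V × ℤ, 0 ≤ y.2 → y.2 < 2 * s + 1 → nxt (trans n y) = trans n (nxt y)) :
    ∃ (σ : Equiv.Perm (V × ZMod n)) (q : V × ZMod n → ℤ) (η : V × ZMod n → E × ZMod n),
      (G.power n).Follows σ q η ∧ ∑ x, q x = k ∧
      ∀ x, σ x ≠ x → ∃ e ∈ F, η x = (roll n e).1 ∧ |e.2 - x.2.val| ≤ s := by
  have hn : (0 : ℤ) < n := by exact_mod_cast NeZero.pos n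
  have hsn' : 2 * (s : ℤ) + 1 ≤ n := by exact_mod_cast hsn
  let y : V × ZMod n → V × ℤ := fun x => (x.1, (x.2.val : ℤ))
  have hy0 : ∀ x, 0 ≤ (y x).2 := fun x => Int.natCast_nonneg _
  have hyn : ∀ x, (y x).2 < n := fun x => by
    simp only [y]
    exact_mod_cast ZMod.val_lt _
  have hry : ∀ x, roll n (y x) = (x, 0) := roll_mk_val
  have hyinj : ∀ x x', y x = y x' → x = x' := fun x x' hxx => by
    have := congrArg (roll n) hxx
    rw [hry, hry] at this
    exact (Prod.mk.inj this).1
  let σ₀ : V × ZMod n → V × ZMod n := fun x => (roll n (nxt (y x))).1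
  let q : V × ZMod n → ℤ := fun x => (roll n (nxt (y x))).2
  have hnxt : ∀ x, nxt (y x) = unroll (σ₀ x, q x) := fun x => (unroll_roll _).symm
  have hstep : ∀ z, -(s : ℤ) ≤ (nxt z).2 - z.2 ∧ (nxt z).2 - z.2 ≤ s :=
    fun z => abs_le.1 (h.abs_step_le hs z).1
  -- Two vertices of the window with images exactly n apart would contradict injectivity: the first
  -- is within the first 2s slabs, so by periodicity its translate by n has the same image as the
  -- second.
  have hwrap : ∀ x x' : V × ZMod n, (nxt (y x')) = trans n (nxt (y x)) → False := by
    intro x x' hxx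
    have h1 := congrArg Prod.snd hxx
    simp only [trans] at h1
    have h2 := hstep (y x)
    have h3 := hstep (y x')
    have h4 := hyn x'
    have h5 := hper (y x) (hy0 x) (by linarith)
    rw [← hxx] at h5
    have h6 := h.injOn (x₁ := trans n (y x)) (x₂ := y x')
      (by simp only [trans, Set.mem_ofPred_eq]; linarith)
      (by simp only [Set.mem_ofPred_eq]; linarith) h5
    have h7 := congrArg Prod.snd h6
    simp only [trans] at h7
    have := hy0 x
    linarith
  have hσ : Function.Injective σ₀ := by
    intro x x' hxx
    have h1 := hnxt x
    have h2 := hnxt x'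
    rw [hxx] at h1
    have h1' := congrArg Prod.snd h1
    have h2' := congrArg Prod.snd h2
    simp only [unroll] at h1' h2'
    have h3 := hstep (y x)
    have h4 := hstep (y x')
    have h5 := hyn x
    have h6 := hyn x'
    have h7 := hy0 x
    have h8 := hy0 x'
    have h9 : q x - q x' < 2 := by
      by_contra hcon
      nlinarith
    have h10 : q x' - q x < 2 := by
      by_contra hcon
      nlinarith
    have h11 : q x = q x' ∨ q x = q x' + 1 ∨ q x' = q x + 1 := by omega
    rcases h11 with h11 | h11 | h11
    · rw [h11, ← h2] at h1
      exact hyinj _ _ (h.injOn (by simp only [Set.mem_ofPred_eq]; linarith)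
        (by simp only [Set.mem_ofPred_eq]; linarith) h1)
    · refine (hwrap x' x ?_).elim
      rw [h1, h2, h11]
      refine Prod.ext rfl ?_
      simp only [unroll, trans]
      ring
    · refine (hwrap x x' ?_).elim
      rw [h1, h2, h11]
      refine Prod.ext rfl ?_
      simp only [unroll, trans]
      ring
  let σ : Equiv.Perm (V × ZMod n) := Equiv.ofBijective σ₀ (Finite.injective_iff_bijective.1 hσ)
  have hσσ : ∀ x, σ x = σ₀ x := fun _ => rfl
  have hmoved : ∀ x, σ x ≠ x → nxt (y x) ≠ y x := by
    intro x hx h'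
    apply hx
    rw [hσσ]
    simp only [σ₀]
    rw [h', hry]
  refine ⟨σ, q, fun x => (roll n (ε (y x))).1, fun x => ⟨fun hx => ?_, fun hx => ?_⟩, ?_,
    fun x hx => ⟨ε (y x), h.mem _ (hmoved x hx), rfl, h.abs_edge_le hs (hmoved x hx)⟩⟩
  · have h1 := hnxt x
    rw [← hσσ, hx] at h1
    have h2 := congrArg Prod.snd h1
    simp only [unroll] at h2
    have h3 := hstep (y x)
    have h4 : (y x).2 = x.2.val := rfl
    have h5 : q x < 1 := by
      by_contra hcon
      nlinarith
    have h6 : -1 < q x := by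
      by_contra hcon
      nlinarith
    omega
  · have h1 := cover_src_roll (G := G) (n := n) (ε (y x))
    have h2 := cover_tgt_roll (G := G) (n := n) (ε (y x))
    rcases h.link _ (hmoved x hx) with ⟨h3, h4⟩ | ⟨h3, h4⟩
    · left
      rw [h3, hry] at h1
      rw [h4] at h2
      obtain ⟨h5, h6⟩ := Prod.mk.inj h1
      refine ⟨h5, congrArg Prod.fst h2, ?_⟩
      have h7 := congrArg Prod.snd h2
      simp only [cover] at h7
      rw [h6, zero_add] at h7
      exact h7
    · right
      rw [h4, hry] at h2
      rw [h3] at h1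
      obtain ⟨h5, h6⟩ := Prod.mk.inj h2
      refine ⟨congrArg Prod.fst h1, h5, ?_⟩
      have h7 : (roll n (ε (y x))).2 = q x := congrArg Prod.snd h1
      rw [h7] at h6
      linarith
  · let D : V × ℤ → ℤ := fun z =>
      (if (n : ℤ) ≤ (nxt z).2 then 1 else 0) - (if (n : ℤ) ≤ z.2 then 1 else 0)
    have hflux := h.flux n hlo (by linarith)
    -- Steps are shorter than n, so q counts crossings of the cut: +1 through n, -1 through 0. By
    -- periodicity the latter are the backward crossings of n by vertices to the right of n, so the
    -- sum of q is the flux at n.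
    have hq : ∀ x, q x = (if (n : ℤ) ≤ (nxt (y x)).2 then 1 else 0) -
        (if (nxt (y x)).2 < 0 then 1 else 0) := by
      intro x
      have h2 := congrArg Prod.snd (hnxt x)
      simp only [unroll] at h2
      have h3 := hstep (y x)
      have h4 := hyn x
      have h5 := hy0 x
      have h6 : ((σ₀ x).2.val : ℤ) < n := by exact_mod_cast ZMod.val_lt _
      have h7 : (0 : ℤ) ≤ ((σ₀ x).2.val : ℤ) := by positivity
      split_ifs with h8 h9 h9
      · linarith
      · have : q x < 2 := by
          by_contra hcon
          nlinarith
        have : 0 < q x := by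
          by_contra hcon
          nlinarith
        omega
      · have : q x < 0 := by
          by_contra hcon
          nlinarith
        have : -2 < q x := by
          by_contra hcon
          nlinarith
        omega
      · have : q x < 1 := by
          by_contra hcon
          nlinarith
        have : -1 < q x := by
          by_contra hcon
          nlinarith
        omega
    rw [Finset.sum_congr rfl fun x _ => hq x]
    rw [sum_zmod_eq fun z => ((if (n : ℤ) ≤ (nxt z).2 then 1 else 0) -
      (if (nxt z).2 < 0 then 1 else 0) : ℤ), Finset.sum_sub_distrib]
    have e1 : ∑ z ∈ Finset.univ ×ˢ Finset.Ico ((n : ℤ) - s) (n + s), D z =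
        ∑ z ∈ Finset.univ ×ˢ Finset.Ico (0 : ℤ) (n + s), D z := by
      refine Finset.sum_subset ?_ fun z hz hz' => ?_
      · intro z
        simp only [Finset.mem_product, Finset.mem_univ, true_and, Finset.mem_Ico]
        intro hz
        constructor <;> linarith
      · simp only [Finset.mem_product, Finset.mem_univ, true_and, Finset.mem_Ico] at hz hz'
        have h1 := hstep z
        have h2 : z.2 < n - s := by
          by_contra hcon
          exact hz' ⟨by linarith, hz.2⟩
        simp only [D]
        rw [if_neg (by linarith), if_neg (by linarith), sub_self]
    have e2 : ∑ z ∈ Finset.univ ×ˢ Finset.Ico (0 : ℤ) (n + s), D z =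
        ∑ z ∈ Finset.univ ×ˢ Finset.Ico (0 : ℤ) n, D z +
          ∑ z ∈ Finset.univ ×ˢ Finset.Ico (n : ℤ) (n + s), D z := by
      rw [← Finset.sum_union]
      · rw [← Finset.product_union, Finset.Ico_union_Ico_eq_Ico (by linarith) (by linarith)]
      · rw [Finset.disjoint_left]
        intro z
        simp only [Finset.mem_product, Finset.mem_univ, true_and, Finset.mem_Ico]
        intro hz hz'
        linarith
    have e3 : ∑ z ∈ Finset.univ ×ˢ Finset.Ico (0 : ℤ) n, D z =
        ∑ z ∈ Finset.univ ×ˢ Finset.Ico (0 : ℤ) n, (if (n : ℤ) ≤ (nxt z).2 then 1 else 0) := by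
      refine Finset.sum_congr rfl fun z hz => ?_
      simp only [Finset.mem_product, Finset.mem_univ, true_and, Finset.mem_Ico] at hz
      simp only [D]
      rw [if_neg (not_le.2 hz.2), sub_zero]
    have e4 : ∑ z ∈ Finset.univ ×ˢ Finset.Ico (n : ℤ) (n + s), D z =
        ∑ z ∈ Finset.univ ×ˢ Finset.Ico (0 : ℤ) s, -(if (nxt z).2 < 0 then 1 else 0) := by
      symm
      refine Finset.sum_nbij' (trans n) (trans (-n)) ?_ ?_ ?_ ?_ ?_
      · simp only [trans, Finset.mem_product, Finset.mem_univ, true_and, Finset.mem_Ico]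
        intro y hy
        constructor <;> linarith
      · simp only [trans, Finset.mem_product, Finset.mem_univ, true_and, Finset.mem_Ico]
        intro y hy
        constructor <;> linarith
      · intro y _
        simp [trans_trans, trans_zero]
      · intro y _
        simp [trans_trans, trans_zero]
      · intro z hz
        simp only [Finset.mem_product, Finset.mem_univ, true_and, Finset.mem_Ico] at hz
        simp only [D]
        rw [hper z hz.1 (by linarith), if_pos (c := (n : ℤ) ≤ (trans n z).2)
          (by simp only [trans]; linarith)]
        simp only [trans, le_add_iff_nonneg_left]
        split_ifs <;> first | rfl | (exfalso; linarith)
    have e5 : ∑ z ∈ Finset.univ ×ˢ Finset.Ico (0 : ℤ) s, -(if (nxt z).2 < 0 then 1 else 0 : ℤ) =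
        ∑ z ∈ Finset.univ ×ˢ Finset.Ico (0 : ℤ) n, -(if (nxt z).2 < 0 then 1 else 0 : ℤ) := by
      refine Finset.sum_subset ?_ fun z hz hz' => ?_
      · intro z
        simp only [Finset.mem_product, Finset.mem_univ, true_and, Finset.mem_Ico]
        intro hz
        constructor <;> linarith
      · simp only [Finset.mem_product, Finset.mem_univ, true_and, Finset.mem_Ico] at hz hz'
        have h1 := hstep z
        have h2 : s ≤ z.2 := by
          by_contra hcon
          exact hz' ⟨hz.1, by linarith⟩
        rw [if_neg (by linarith), neg_zero]
    have hflux' : ∑ z ∈ Finset.univ ×ˢ Finset.Ico ((n : ℤ) - s) (n + s), D z = k := hflux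
    rw [e1, e2, e3, e4, e5, Finset.sum_neg_distrib] at hflux'
    linarith

end PeriodicGraph

/-! ### The width is the maximal number of components -/

namespace PeriodicGraph

variable {V E : Type*} [Fintype V] {G : PeriodicGraph V E}
  {F : Set (E × ℤ)} {s k : ℕ} {lo hi : ℤ} {nxt : V × ℤ → V × ℤ} {ε : V × ℤ → E × ℤ}

theorem abs_sub_le_of_adj (hs : ∀ e, |G.shift e| ≤ s) {x y : V × ℤ}
    (h : (G.cover.spanned F).Adj x y) : |y.2 - x.2| ≤ s := by
  obtain ⟨-, e, -, h⟩ := G.cover.spanned_adj.1 h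
  rcases h with ⟨rfl, rfl⟩ | ⟨rfl, rfl⟩
  · simpa [cover] using hs e.1
  · rw [abs_sub_comm]
    simpa [cover] using hs e.1

/-- Disjoint simple paths from the left of `lo` to the right of `hi` define a flow. -/
theorem exists_isFlow_of_paths [Nonempty E] (hs : ∀ e, |G.shift e| ≤ s) {p : Fin k → ℕ → V × ℤ}
    {len : Fin k → ℕ}
    (hadj : ∀ a i, i < len a → (G.cover.spanned F).Adj (p a i) (p a (i + 1)))
    (hinj : ∀ a i a' i', i ≤ len a → i' ≤ len a' → p a i = p a' i' → a = a' ∧ i = i')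
    (hlo : ∀ a, (p a 0).2 < lo) (hhi : ∀ a, hi ≤ (p a (len a)).2) :
    ∃ nxt ε, G.IsFlow F s k lo hi nxt ε := by
  let nxt : V × ℤ → V × ℤ := fun y =>
    if h : ∃ x : Fin k × ℕ, x.2 < len x.1 ∧ p x.1 x.2 = y then
      p h.choose.1 (h.choose.2 + 1) else y
  have hnxt : ∀ a i, i < len a → nxt (p a i) = p a (i + 1) := by
    intro a i hi'
    have h : ∃ x : Fin k × ℕ, x.2 < len x.1 ∧ p x.1 x.2 = p a i := ⟨(a, i), hi', rfl⟩
    have h1 := h.choose_spec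
    obtain ⟨h2, h3⟩ := hinj _ _ _ _ h1.1.le hi'.le h1.2
    simp only [nxt]
    rw [dif_pos h, h2, h3]
  have hfix : ∀ y, (¬ ∃ x : Fin k × ℕ, x.2 < len x.1 ∧ p x.1 x.2 = y) → nxt y = y := by
    intro y hy
    simp only [nxt]
    rw [dif_neg hy]
  have hcases : ∀ y, nxt y = y ∨ ∃ a i, i < len a ∧ p a i = y ∧ nxt y = p a (i + 1) := by
    intro y
    by_cases h : ∃ x : Fin k × ℕ, x.2 < len x.1 ∧ p x.1 x.2 = y
    · obtain ⟨⟨a, i⟩, h1, rfl⟩ := h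
      exact Or.inr ⟨a, i, h1, rfl, hnxt a i h1⟩
    · exact Or.inl (hfix y h)
  have hε : ∀ y, ∃ e, nxt y ≠ y → e ∈ F ∧ ((G.cover.src e = y ∧ G.cover.tgt e = nxt y) ∨
      (G.cover.src e = nxt y ∧ G.cover.tgt e = y)) := by
    intro y
    rcases hcases y with h | ⟨a, i, h1, rfl, h2⟩
    · exact ⟨Classical.arbitrary _, fun h' => (h' h).elim⟩
    · obtain ⟨-, e, he, h3⟩ := G.cover.spanned_adj.1 (hadj a i h1)
      rw [h2]
      exact ⟨e, fun _ => ⟨he, h3⟩⟩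
  choose ε hε using hε
  have hstep : ∀ z, -(s : ℤ) ≤ (nxt z).2 - z.2 ∧ (nxt z).2 - z.2 ≤ s := by
    intro z
    rw [← abs_le]
    rcases hcases z with h | ⟨a, i, h1, rfl, h2⟩
    · simp [h]
    · rw [h2]
      exact abs_sub_le_of_adj hs (hadj a i h1)
  refine ⟨nxt, ε, fun y hy => (hε y hy).1, fun y hy => (hε y hy).2, ?_, ?_⟩
  · have key : ∀ y y', y.2 < hi → y'.2 < hi → nxt y = y → nxt y = nxt y' → y = y' := by
      intro y y' hy hy' h1 h2
      rcases hcases y' with h | ⟨a, i, h3, rfl, h4⟩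
      · rw [← h1, h2, h]
      · have h5 : y = p a (i + 1) := by rw [← h1, h2, h4]
        rcases Nat.lt_or_ge (i + 1) (len a) with h6 | h6
        · have h7 := hnxt a (i + 1) h6
          rw [← h5, h1, h5] at h7
          have := (hinj _ _ _ _ h6.le h6 h7).2
          omega
        · have h7 : i + 1 = len a := by omega
          have := hhi a
          rw [← h7, ← h5] at this
          exact absurd hy (not_lt.2 this)
    intro y hy y' hy' heq
    rcases hcases y with h | ⟨a, i, h1, h2, h3⟩
    · exact key y y' hy hy' h heq
    · rcases hcases y' with h' | ⟨a', i', h1', h2', h3'⟩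
      · exact (key y' y hy' hy h' heq.symm).symm
      · rw [h3, h3'] at heq
        obtain ⟨rfl, h4⟩ := hinj _ _ _ _ h1 h1' heq
        rw [← h2, ← h2', Nat.succ_injective h4]
  · intro b hb hb'
    let χ : V × ℤ → ℤ := fun y => if b ≤ y.2 then 1 else 0
    let W : Finset (V × ℤ) := Finset.univ ×ˢ Finset.Ico (b - s) (b + s)
    let I : Finset (Σ _ : Fin k, ℕ) := Finset.univ.sigma fun a => Finset.range (len a)
    let P : Finset (V × ℤ) := I.image fun x => p x.1 x.2
    show ∑ y ∈ W, (χ (nxt y) - χ y) = k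
    have e1 : ∑ y ∈ W, (χ (nxt y) - χ y) = ∑ y ∈ W ∪ P, (χ (nxt y) - χ y) := by
      refine Finset.sum_subset Finset.subset_union_left fun y _ hy => ?_
      simp only [W, Finset.mem_product, Finset.mem_univ, true_and, Finset.mem_Ico, not_and_or,
        not_le, not_lt] at hy
      have := hstep y
      simp only [χ]
      rcases hy with hy | hy
      · rw [if_neg (by linarith), if_neg (by linarith), sub_self]
      · rw [if_pos (by linarith), if_pos (by linarith), sub_self]
    have e2 : ∑ y ∈ P, (χ (nxt y) - χ y) = ∑ y ∈ W ∪ P, (χ (nxt y) - χ y) := by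
      refine Finset.sum_subset Finset.subset_union_right fun y _ hy => ?_
      rcases hcases y with h | ⟨a, i, h1, rfl, h2⟩
      · rw [h, sub_self]
      · refine (hy (Finset.mem_image.2 ⟨⟨a, i⟩, ?_, rfl⟩)).elim
        simpa [I] using h1
    rw [e1, ← e2, Finset.sum_image, Finset.sum_sigma]
    · have e3 : ∀ a : Fin k, ∑ i ∈ Finset.range (len a), (χ (nxt (p a i)) - χ (p a i)) = 1 := by
        intro a
        rw [Finset.sum_congr rfl fun i hi' => by rw [hnxt a i (Finset.mem_range.1 hi')],
          Finset.sum_range_sub fun i => χ (p a i)]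
        simp only [χ]
        rw [if_pos (hb'.trans (hhi a)), if_neg (by have := hlo a; linarith)]
        simp
      rw [Finset.sum_congr rfl fun a _ => e3 a]
      simp
    · rintro ⟨a, i⟩ hx ⟨a', i'⟩ hx' heq
      simp only [I, Finset.coe_sigma, Finset.coe_univ, Set.mem_sigma_iff, Set.mem_univ, true_and,
        Finset.coe_range, Set.mem_Iio] at hx hx'
      obtain ⟨rfl, rfl⟩ := hinj _ _ _ _ hx.le hx'.le heq
      rfl

/-- What a flow does on `2 s + 1` consecutive slabs. -/
def flowState (s : ℕ) (nxt : V × ℤ → V × ℤ) (a : ℤ) :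
    V × Fin (2 * s + 1) → V × ZMod (2 * s + 1) :=
  fun x => ((nxt (x.1, a + x.2)).1, (((nxt (x.1, a + x.2)).2 - (a + x.2) : ℤ) : ZMod (2 * s + 1)))

theorem flowState_translate (t a : ℤ) :
    flowState s (fun y => trans (-t) (nxt (trans t y))) a = flowState s nxt (a + t) := by
  funext x
  simp only [flowState, trans]
  rw [show a + x.2 + t = a + t + (x.2 : ℤ) by ring]
  congr 2
  ring

theorem IsFlow.eq_of_flowState_eq (h : G.IsFlow F s k lo hi nxt ε) (hs : ∀ e, |G.shift e| ≤ s)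
    {n : ℤ} (hst : flowState s nxt 0 = flowState s nxt n) {y : V × ℤ} (h0 : 0 ≤ y.2)
    (h1 : y.2 < 2 * s + 1) : nxt (trans n y) = trans n (nxt y) := by
  obtain ⟨v, l⟩ := y
  simp only at h0 h1
  lift l to ℕ using h0
  have h2 := congrFun hst (v, ⟨l, by exact_mod_cast h1⟩)
  simp only [flowState, zero_add, Prod.mk.injEq] at h2
  obtain ⟨h3, h4⟩ := h2
  rw [ZMod.intCast_eq_intCast_iff_dvd_sub] at h4
  have h5 := abs_le.1 (h.abs_step_le hs (v, (l : ℤ))).1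
  have h6 := abs_le.1 (h.abs_step_le hs (v, n + (l : ℤ))).1
  simp only at h5 h6
  -- The state records displacements modulo 2s + 1. Two displacements in [-s, s] differ by at most
  -- 2s, so congruent ones are equal.
  have h7 := Int.eq_zero_of_abs_lt_dvd h4 (by
    rw [abs_lt]
    push_cast
    constructor <;> linarith)
  have h8 : trans n (v, (l : ℤ)) = (v, n + l) := Prod.ext rfl (add_comm _ _)
  rw [h8]
  refine Prod.ext h3.symm ?_
  simp only [trans]
  linarith

section Width

variable [DecidableEq V] [Fintype E] [DecidableEq E]

theorem connected_power {n : ℕ} [NeZero n] (hconn : (G.cover.spanned Set.univ).Connected) :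
    ((G.power n).cover.spanned Set.univ).Connected := by
  have h : ∀ x y : (V × ZMod n) × ℤ, ((G.power n).cover.spanned Set.univ).Reachable x y := by
    intro x y
    have h1 := reachable_unroll (G := G) (n := n) (F := Set.univ) (x := x) (y := y)
    have h2 : lift n (Set.univ : Set (E × ZMod n)) = Set.univ := by
      ext
      simp [lift]
    rw [h2] at h1
    exact h1.1 (hconn.preconnected _ _)
  have := hconn.nonempty
  have : Nonempty ((V × ZMod n) × ℤ) := this.map (roll n)
  exact ⟨h⟩

/-- Wide windows with `k` crossings force a cycle-rooted spanning forest with at least `k`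
components in some quotient. -/
theorem exists_good_of_flows (hGn : ∀ n [NeZero n], (G.power n).Annular)
    (hconn : (G.cover.spanned Set.univ).Connected) (hs : ∀ e, |G.shift e| ≤ s)
    (hflow : ∀ R : ℕ, ∃ lo nxt ε, G.IsFlow Set.univ s k lo (lo + R) nxt ε) :
    ∃ (n : ℕ) (_ : NeZero n) (F : Finset (E × ZMod n)), (G.power n).Good F ∧
      k ≤ (G.power n).base.numComponents (F : Set (E × ZMod n)) := by
  let M := Fintype.card (V × Fin (2 * s + 1) → V × ZMod (2 * s + 1))
  obtain ⟨lo, nxt, ε, h⟩ := hflow ((M + 1) * (2 * s + 1))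
  -- There are finitely many states, so among `M + 1` places two agree. Spacing the places by 2s + 1
  -- ensures that the period n is at least 2s + 1.
  obtain ⟨i, l, hne, hil⟩ := Fintype.exists_ne_map_eq_of_card_lt
    (fun i : Fin (M + 1) => flowState s nxt (lo + (i : ℕ) * (2 * s + 1 : ℕ))) (by simp [M])
  wlog hlt : i < l generalizing i l
  · exact this l i hne.symm hil.symm (lt_of_le_of_ne (not_lt.1 hlt) hne.symm)
  have hlt' : (i : ℕ) + 1 ≤ l := hlt
  obtain ⟨d, hd⟩ := Nat.exists_eq_add_of_le hlt'
  let n := (d + 1) * (2 * s + 1)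
  have hn0 : NeZero n := ⟨by positivity⟩
  set t : ℤ := lo + (i : ℕ) * (2 * s + 1 : ℕ) with ht
  have hn : (n : ℤ) = (d + 1) * (2 * s + 1) := by simp [n]
  have hl : lo + ((l : ℕ) : ℤ) * (2 * s + 1 : ℕ) = n + t := by
    rw [hd, ht, hn]
    push_cast
    ring
  have h' := h.translate t
  have hst : flowState s (fun y => trans (-t) (nxt (trans t y))) 0 =
      flowState s (fun y => trans (-t) (nxt (trans t y))) n := by
    rw [flowState_translate, flowState_translate, zero_add, ← hl]
    exact hil
  have hlM : (i : ℕ) + 1 + d + 1 ≤ M + 1 := by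
    have := l.2
    omega
  have hlM' : ((i : ℕ) : ℤ) + 1 + d + 1 ≤ M + 1 := by exact_mod_cast hlM
  obtain ⟨σ, q, η, hfol, hsum, -⟩ := h'.exists_follows hs (n := n) (by nlinarith)
    (by
      rw [ht]
      push_cast
      nlinarith)
    (by
      rw [ht, hn]
      push_cast
      nlinarith)
    (fun y h0 h1 => h'.eq_of_flowState_eq hs hst h0 h1)
  obtain ⟨F, hF, hIF, -⟩ := exists_good_of_linearIndepOn (hGn n) (z := Units.mk0 (2 : ℝ) two_ne_zero)
    (by norm_num) hfol.linearIndepOn (Set.subset_univ _) (winds_univ (connected_power hconn))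
  refine ⟨n, hn0, F, hF, ?_⟩
  have := hfol.le_numComponents (hGn n) hF.1 hIF
  rw [hsum] at this
  exact_mod_cast this

theorem unbounded_of_injective {r : ℕ → V × ℤ} (hr : Function.Injective r) :
    (∀ B : ℤ, ∃ i, B ≤ (r i).2) ∨ ∀ B : ℤ, ∃ i, (r i).2 ≤ B := by
  by_contra hcon
  simp only [not_or, not_forall, not_exists, not_le] at hcon
  obtain ⟨⟨B, hB⟩, ⟨B', hB'⟩⟩ := hcon
  refine Set.infinite_range_of_injective hr (((Finset.univ ×ˢ Finset.Icc B' B).finite_toSet).subset ?_)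
  rintro _ ⟨i, rfl⟩
  simpa using ⟨(hB' i).le, (hB i).le⟩

/-- The paths need not run from one end to the other, but each half is injective, hence unbounded to
the left or to the right. Of the 2k disjoint rays, at least k are unbounded on the same side, and
they cross any window placed beyond their starting points; rays going left are traversed backwards.
-/
theorem HasDisjointPaths.exists_flow [Nonempty E] (hs : ∀ e, |G.shift e| ≤ s)
    (hk : G.HasDisjointPaths k) (R : ℕ) :
    ∃ lo nxt ε, G.IsFlow Set.univ s k lo (lo + R) nxt ε := by
  obtain ⟨p, hadj, hinj⟩ := hk
  -- The forward half starts at index 1 and the backward half at index 0, so that the two halves are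
  -- disjoint.
  let r : Fin k × Bool → ℕ → V × ℤ := fun a i => if a.2 then p a.1 (i + 1) else p a.1 (-i)
  have hradj : ∀ a i, (G.cover.spanned Set.univ).Adj (r a i) (r a (i + 1)) := by
    rintro ⟨a, b⟩ i
    cases b
    · simp only [r, Bool.false_eq_true, if_false]
      have := hadj a (-((i + 1 : ℕ) : ℤ))
      rw [show -((i + 1 : ℕ) : ℤ) + 1 = -(i : ℤ) by push_cast; ring] at this
      exact this.symm
    · simp only [r, if_true]
      have := hadj a (i + 1)
      exact_mod_cast this
  have hrinj : ∀ a i a' i', r a i = r a' i' → a = a' ∧ i = i' := by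
    rintro ⟨a, b⟩ i ⟨a', b'⟩ i' h
    cases b <;> cases b' <;> simp only [r, Bool.false_eq_true, if_false, if_true] at h <;>
      have h1 := Prod.mk.inj (@hinj (_, _) (_, _) h) <;> obtain ⟨rfl, h2⟩ := h1
    · exact ⟨rfl, by omega⟩
    · omega
    · omega
    · exact ⟨rfl, by omega⟩
  let U : Finset (Fin k × Bool) := Finset.univ.filter fun a => ∀ B : ℤ, ∃ i, B ≤ (r a i).2
  let D : Finset (Fin k × Bool) := Finset.univ.filter fun a => ∀ B : ℤ, ∃ i, (r a i).2 ≤ B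
  have hUD : U ∪ D = Finset.univ := by
    ext a
    simp only [U, D, Finset.mem_union, Finset.mem_filter, Finset.mem_univ, true_and, iff_true]
    exact unbounded_of_injective fun i i' h => (hrinj a i a i' h).2
  have hcard : 2 * k ≤ U.card + D.card := by
    have h1 := Finset.card_union_le U D
    rw [hUD, Finset.card_univ, Fintype.card_prod, Fintype.card_fin, Fintype.card_bool] at h1
    omega
  have hemb : ∀ T : Finset (Fin k × Bool), k ≤ T.card → ∃ f : Fin k → Fin k × Bool,
      Function.Injective f ∧ ∀ a, f a ∈ T := by
    intro T hT
    obtain ⟨f⟩ := Function.Embedding.nonempty_of_card_le (α := Fin k) (β := T) (by simpa using hT)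
    exact ⟨fun a => f a, fun a b h => f.injective (Subtype.ext h), fun a => (f a).2⟩
  rcases Nat.lt_or_ge U.card k with hU | hU
  · obtain ⟨f, hf, hfD⟩ := hemb D (by omega)
    obtain ⟨hi, hhi⟩ : ∃ hi : ℤ, ∀ a, hi ≤ (r (f a) 0).2 := by
      obtain ⟨b, hb⟩ := (Set.finite_range fun a => (r (f a) 0).2).bddBelow
      exact ⟨b, fun a => hb ⟨a, rfl⟩⟩
    have hlen : ∀ a, ∃ i, (r (f a) i).2 ≤ hi - R - 1 := fun a => by
      have := hfD a
      simp only [D, Finset.mem_filter, Finset.mem_univ, true_and] at this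
      exact this _
    choose len hlen using hlen
    have := exists_isFlow_of_paths (F := Set.univ) (lo := hi - R) (hi := hi) hs
      (p := fun a i => r (f a) (len a - i)) (len := len) ?_ ?_ ?_ ?_
    · obtain ⟨nxt, ε, h⟩ := this
      exact ⟨hi - R, nxt, ε, by simpa using h⟩
    · intro a i hi'
      have h1 := hradj (f a) (len a - (i + 1))
      rw [show len a - (i + 1) + 1 = len a - i by omega] at h1
      exact h1.symm
    · intro a i a' i' h1 h2 h3
      obtain ⟨h4, h5⟩ := hrinj _ _ _ _ h3
      obtain rfl := hf h4
      exact ⟨rfl, by omega⟩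
    · intro a
      have := hlen a
      simp only [Nat.sub_zero]
      linarith
    · intro a
      simpa using hhi a
  · obtain ⟨f, hf, hfU⟩ := hemb U hU
    obtain ⟨lo, hlo⟩ : ∃ lo : ℤ, ∀ a, (r (f a) 0).2 ≤ lo := by
      obtain ⟨b, hb⟩ := (Set.finite_range fun a => (r (f a) 0).2).bddAbove
      exact ⟨b, fun a => hb ⟨a, rfl⟩⟩
    have hlen : ∀ a, ∃ i, lo + 1 + R ≤ (r (f a) i).2 := fun a => by
      have := hfU a
      simp only [U, Finset.mem_filter, Finset.mem_univ, true_and] at this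
      exact this _
    choose len hlen using hlen
    refine ⟨lo + 1, exists_isFlow_of_paths (F := Set.univ) hs (p := fun a => r (f a)) (len := len)
      (fun a i _ => hradj _ _) ?_ (fun a => Int.lt_add_one_of_le (hlo a)) hlen⟩
    intro a i a' i' h1 h2 h3
    obtain ⟨h4, h5⟩ := hrinj _ _ _ _ h3
    exact ⟨hf h4, h5⟩

theorem exists_abs_shift_le (G : PeriodicGraph V E) : ∃ s : ℕ, ∀ e, |G.shift e| ≤ s := by
  refine ⟨Finset.univ.sup fun e => (G.shift e).natAbs, fun e => ?_⟩
  rw [Int.abs_eq_natAbs]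
  exact_mod_cast Finset.le_sup (f := fun e => (G.shift e).natAbs) (Finset.mem_univ e)

theorem nonempty_edges (hconn : (G.cover.spanned Set.univ).Connected) : Nonempty E := by
  obtain ⟨⟨v, k⟩⟩ := hconn.nonempty
  by_contra hE
  have := G.cover.eq_of_reachable (fun x => x.2)
    (fun e _ => (hE ⟨e.1⟩).elim) (hconn.preconnected (v, 0) (v, 1))
  simp at this

theorem width_eq_maxComponents (hG : G.Annular) (hGn : ∀ n [NeZero n], (G.power n).Annular)
    (hconn : (G.cover.spanned Set.univ).Connected) : G.width = G.maxComponents := by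
  have hex : ∃ F, G.Good F := by
    obtain ⟨F, hF, -⟩ := exists_good_subset hG (winds_univ hconn)
    exact ⟨F, hF⟩
  have := nonempty_edges hconn
  refine IsGreatest.csSup_eq ⟨?_, fun k hk => ?_⟩
  · obtain ⟨F, hF, h⟩ := exists_good_eq_maxComponents hex
    rw [← h]
    exact hasDisjointPaths_numComponents hF.2
  · obtain ⟨s, hs⟩ := G.exists_abs_shift_le
    obtain ⟨n, hn, F, hF, hkF⟩ := exists_good_of_flows hGn hconn hs (hk.exists_flow hs)
    refine hkF.trans ((le_maxComponents hF).trans ?_)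
    -- Any positive conductances will do to compare the maximal numbers of components for 𝒢₁ and
    -- 𝒢_n, which are degrees of forest polynomials.
    have hc : ∀ e : E, (0 : ℝ) < 1 := fun _ => one_pos
    rw [← natDegree_forestPoly (c := fun _ => 1) hc hex,
      ← natDegree_forestPolyPower hG (hGn n) (forestPoly_ne_zero hc hex), forestPolyPower,
      natDegree_forestPoly (fun _ => one_pos) ⟨F, hF⟩]

end Width

end PeriodicGraph

/-! ### Windows of escaping forests are close to good sets -/

namespace PeriodicGraph

variable {V E : Type*} [Fintype V] [DecidableEq V] [Fintype E] [DecidableEq E]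
  {G : PeriodicGraph V E} {F : Set (E × ℤ)} {s : ℕ} {n : ℕ} [NeZero n]

/-- The vertices in the first and the last `s` slabs of the window of length `n`. -/
def margin (n s : ℕ) : V × (Fin s ⊕ Fin s) → V × ZMod n
  | (v, Sum.inl i) => (v, ((i : ℕ) : ZMod n))
  | (v, Sum.inr i) => (v, ((n - s + i : ℕ) : ZMod n))

theorem mem_range_margin {x : V × ZMod n} (hsn : s ≤ n) (hx : x.2.val < s ∨ n ≤ x.2.val + s) :
    x ∈ Set.range (margin (V := V) n s) := by
  by_cases h : x.2.val < s
  · exact ⟨(x.1, Sum.inl ⟨_, h⟩), Prod.ext rfl (by simp [margin])⟩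
  · have h1 := hx.resolve_left h
    have h2 := ZMod.val_lt x.2
    refine ⟨(x.1, Sum.inr ⟨x.2.val - (n - s), by omega⟩), Prod.ext rfl ?_⟩
    simp only [margin]
    rw [Nat.add_sub_cancel' (by omega)]
    simp

theorem card_margin_le (hsn : s ≤ n) {S : Finset (V × ZMod n)}
    (hS : ∀ x ∈ S, x.2.val < s ∨ n ≤ x.2.val + s) : S.card ≤ 2 * s * Fintype.card V := by
  have h1 : S ⊆ Finset.univ.image (margin (V := V) n s) := by
    intro x hx
    obtain ⟨y, rfl⟩ := mem_range_margin hsn (hS x hx)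
    exact Finset.mem_image_of_mem _ (Finset.mem_univ y)
  refine (Finset.card_le_card h1).trans (Finset.card_image_le.trans ?_)
  rw [Finset.card_univ, Fintype.card_prod, Fintype.card_sum, Fintype.card_fin]
  exact le_of_eq (by ring)

theorem coe_val_intCast {k : ℤ} (h0 : 0 ≤ k) (hn : k < n) : ((k : ZMod n).val : ℤ) = k := by
  rw [ZMod.val_intCast, Int.emod_eq_of_lt h0 hn]

/-- The forest `F` has no cycles, and each of its components extends to `+∞`. -/
structure Escaping (G : PeriodicGraph V E) (F : Set (E × ℤ)) : Prop where
  isForest : G.cover.IsForest F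
  exists_reachable : ∀ x (N : ℤ), ∃ y, N ≤ y.2 ∧ (G.cover.spanned F).Reachable x y

/-- A function in the kernel that vanishes on the two margins extends by zero to a function on 𝒢
constant along the edges of `F`. Every component of `F` reaches the region where it is zero, so it
is zero. The dimension is thus at most the number of margin vertices, independently of n. -/
theorem Escaping.finrank_nullspace_le {K : Type*} [Field K] (hF : G.Escaping F)
    (hs : ∀ e, |G.shift e| ≤ s) (hsn : s ≤ n) (z : Kˣ) :
    Module.finrank K ((G.power n).nullspace z (fold n F)) ≤ 2 * s * Fintype.card V := by
  let ρ : (G.power n).nullspace z (fold n F) →ₗ[K] (V × (Fin s ⊕ Fin s) → K) :=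
    (LinearMap.funLeft K K (margin n s)).comp (Submodule.subtype _)
  have hρ : Function.Injective ρ := by
    rw [← LinearMap.ker_eq_bot, eq_bot_iff]
    rintro ⟨f, hf⟩ hfρ
    rw [Submodule.mem_bot]
    apply Subtype.ext
    have hm : ∀ x : V × ZMod n, x.2.val < s ∨ n ≤ x.2.val + s → f x = 0 := by
      intro x hx
      obtain ⟨y, rfl⟩ := mem_range_margin hsn hx
      exact congrFun (LinearMap.mem_ker.1 hfρ) y
    rw [mem_nullspace] at hf
    let ψ : V × ℤ → K := fun y => if 0 ≤ y.2 ∧ y.2 < n then f (y.1, (y.2 : ZMod n)) else 0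
    have hψ0 : ∀ y : V × ℤ, y.2 < s ∨ n ≤ y.2 + s → ψ y = 0 := by
      intro y hy
      simp only [ψ]
      split_ifs with h
      · apply hm
        have := coe_val_intCast h.1 h.2
        simp only
        omega
      · rfl
    have hψ : ∀ e ∈ F, ψ (G.cover.src e) = ψ (G.cover.tgt e) := by
      intro e he
      have h1 := abs_le.1 (hs e.1)
      by_cases h2 : 0 ≤ e.2 ∧ e.2 < n ∧ 0 ≤ e.2 + G.shift e.1 ∧ e.2 + G.shift e.1 < n
      · obtain ⟨h3, h4, h5, h6⟩ := h2
        have h7 := hf (roll n e).1 (by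
          simp only [fold, roll, Set.mem_ofPred_eq, coe_val_intCast h3 h4]
          exact he)
        have h8 := cover_src_roll (G := G) (n := n) e
        have h9 := cover_tgt_roll (G := G) (n := n) e
        have h10 : (roll n e).2 = 0 := Int.ediv_eq_zero_of_lt h3 h4
        have h11 : (roll n (G.cover.tgt e)).2 = 0 := Int.ediv_eq_zero_of_lt h5 h6
        have h12 := congrArg Prod.snd h9
        rw [h11] at h12
        simp only [cover, h10, zero_add] at h12
        rw [form_apply, h12, zpow_zero, Units.val_one, one_mul, sub_eq_zero] at h7
        have e1 : ψ (G.cover.src e) = f ((G.power n).src (roll n e).1) := by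
          simp only [ψ]
          rw [if_pos ⟨h3, h4⟩]
          exact congrArg f (congrArg Prod.fst h8).symm
        have e2 : ψ (G.cover.tgt e) = f ((G.power n).tgt (roll n e).1) := by
          simp only [ψ]
          rw [if_pos ⟨h5, h6⟩]
          exact congrArg f (congrArg Prod.fst h9).symm
        rw [e1, e2, h7]
      · rw [hψ0 (G.cover.src e) (by simp only [cover]; omega),
          hψ0 (G.cover.tgt e) (by simp only [cover]; omega)]
    funext x
    obtain ⟨y, hy, hxy⟩ := hF.exists_reachable (x.1, (x.2.val : ℤ)) n
    have h1 := G.cover.eq_of_reachable ψ hψ hxy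
    rw [hψ0 y (Or.inr (by omega))] at h1
    simp only [ψ] at h1
    rw [if_pos ⟨by positivity, by exact_mod_cast ZMod.val_lt _⟩] at h1
    simpa using h1
  have := LinearMap.finrank_le_finrank_of_injective hρ
  rw [Module.finrank_fintype_fun_eq_card, Fintype.card_prod, Fintype.card_sum, Fintype.card_fin] at this
  exact this.trans (le_of_eq (by ring))

/-- The window edges have their ends in n + 2s slabs. Removing an edge of the forest separates its
ends, and the indicator of one side is a function whose coboundary is the indicator of that edge. So
the coboundary map is onto. -/
theorem card_fold_le (hF : G.cover.IsForest F) (hs : ∀ e, |G.shift e| ≤ s)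
    {D : Finset (E × ZMod n)} (hD : fold n F = (D : Set (E × ZMod n))) :
    D.card ≤ (n + 2 * s) * Fintype.card V := by
  have : NeZero (n + 2 * s) := ⟨by have := NeZero.ne n; omega⟩
  let idx : V × ℤ → V × ZMod (n + 2 * s) := fun y => (y.1, ((y.2 + s : ℤ) : ZMod (n + 2 * s)))
  let emb : V × ZMod (n + 2 * s) → V × ℤ := fun x => (x.1, x.2.val - s)
  have hidx : ∀ y : V × ℤ, -(s : ℤ) ≤ y.2 → y.2 < n + s → emb (idx y) = y := by
    intro y h1 h2
    refine Prod.ext rfl ?_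
    simp only [emb, idx]
    rw [coe_val_intCast (by linarith) (by push_cast; linarith)]
    ring
  let ed : E × ZMod n → E × ℤ := fun d => (d.1, (d.2.val : ℤ))
  have hedF : ∀ d ∈ D, ed d ∈ F := fun d hd => by
    have : d ∈ fold n F := hD ▸ hd
    exact this
  have hval : ∀ d : E × ZMod n, ((d.2.val : ℕ) : ℤ) < n := fun d => by
    exact_mod_cast ZMod.val_lt d.2
  have hsrc : ∀ d, emb (idx (G.cover.src (ed d))) = G.cover.src (ed d) := by
    intro d
    have := hval d
    exact hidx _ (by simp only [cover, ed]; linarith [Int.natCast_nonneg d.2.val])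
      (by simp only [cover, ed]; linarith)
  have htgt : ∀ d, emb (idx (G.cover.tgt (ed d))) = G.cover.tgt (ed d) := by
    intro d
    have := hval d
    have h1 := abs_le.1 (hs d.1)
    exact hidx _ (by simp only [cover, ed]; linarith [Int.natCast_nonneg d.2.val])
      (by simp only [cover, ed]; linarith)
  let φ : (V × ZMod (n + 2 * s) → ℝ) →ₗ[ℝ] (D → ℝ) := LinearMap.pi fun d =>
    (LinearMap.proj (R := ℝ) (φ := fun _ => ℝ) (idx (G.cover.src (ed d))) -
      LinearMap.proj (R := ℝ) (φ := fun _ => ℝ) (idx (G.cover.tgt (ed d))))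
  let ind : D → V × ZMod (n + 2 * s) → ℝ := fun d x =>
    if (G.cover.spanned (F \ {ed d})).Reachable (G.cover.src (ed d)) (emb x) then 1 else 0
  have hφ : ∀ d d' : D, φ (ind d) d' = if d = d' then 1 else 0 := by
    intro d d'
    show ind d (idx (G.cover.src (ed d'))) - ind d (idx (G.cover.tgt (ed d'))) = _
    simp only [ind, hsrc, htgt]
    by_cases hdd : d = d'
    · subst hdd
      rw [if_pos rfl, if_pos (SimpleGraph.Reachable.refl _), if_neg (hF _ (hedF d d.2)), sub_zero]
    · rw [if_neg hdd, sub_eq_zero]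
      have h1 : ed d' ∈ F \ {ed d} := by
        refine ⟨hedF d' d'.2, fun h => hdd (Subtype.ext ?_)⟩
        have h2 := congrArg Prod.fst h
        have h3 := congrArg Prod.snd h
        simp only [ed] at h2 h3
        exact (Prod.ext h2 (ZMod.val_injective n (by exact_mod_cast h3))).symm
      have h2 := G.cover.reachable_edge h1
      exact if_congr ⟨fun h => h.trans h2, fun h => h.trans h2.symm⟩ rfl rfl
  have hsurj : Function.Surjective φ := by
    intro b
    refine ⟨∑ d, b d • ind d, ?_⟩
    funext d'
    rw [map_sum, Finset.sum_apply]
    simp only [map_smul, Pi.smul_apply, hφ, smul_eq_mul, mul_ite, mul_one, mul_zero]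
    simp
  have h1 := LinearMap.finrank_le_finrank_of_surjective hsurj
  rw [Module.finrank_fintype_fun_eq_card, Module.finrank_fintype_fun_eq_card, Fintype.card_coe,
    Fintype.card_prod, ZMod.card] at h1
  exact h1.trans (le_of_eq (by ring))

/-- The window of an escaping forest with a flow that looks the same at both ends is close to a
cycle-rooted spanning forest with at least as many components. -/
theorem IsFlow.exists_good_near {k : ℕ} {lo hi : ℤ} {nxt : V × ℤ → V × ℤ} {ε : V × ℤ → E × ℤ}
    (h : G.IsFlow F s k lo hi nxt ε) (hGn : (G.power n).Annular)
    (hconn : (G.cover.spanned Set.univ).Connected) (hF : G.Escaping F)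
    (hs : ∀ e, |G.shift e| ≤ s) (hsn : 2 * s + 1 ≤ n) (hlo : lo ≤ n) (hhi : n + (2 * s + 1) ≤ hi)
    (hst : flowState s nxt 0 = flowState s nxt n)
    {D : Finset (E × ZMod n)} (hD : fold n F = (D : Set (E × ZMod n))) :
    ∃ F' : Finset (E × ZMod n), (G.power n).Good F' ∧
      k ≤ (G.power n).base.numComponents (F' : Set (E × ZMod n)) ∧
      (F' \ D).card ≤ 4 * s * Fintype.card V ∧ (D \ F').card ≤ 6 * s * Fintype.card V := by
  obtain ⟨σ, q, η, hfol, hsum, hη⟩ := h.exists_follows hs hsn hlo hhi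
    (fun y h0 h1 => h.eq_of_flowState_eq hs hst h0 h1)
  let A : Finset (V × ZMod n) := Finset.univ.filter fun x => cycleSum σ q x ≠ 0
  let C : Finset (E × ZMod n) := A.image η
  have hC : (C : Set (E × ZMod n)) = η '' {x | cycleSum σ q x ≠ 0} := by simp [C, A]
  have hCli := hfol.linearIndepOn
  rw [← hC] at hCli
  have hz : ((Units.mk0 (2 : ℝ) two_ne_zero : ℝˣ) : ℝ) ≠ 1 := by norm_num
  set z := Units.mk0 (2 : ℝ) two_ne_zero
  -- The winding cycles `C` are kept, completed first by edges of `D` to a basis `b` of C ∪ D, then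
  -- arbitrarily to a good set. Keeping `C` guarantees k components, and using `D` keeps the good
  -- set close to it.
  obtain ⟨b, hb, hCb, hspan, hbli⟩ := exists_linearIndepOn_extension hCli
    (Set.subset_union_left (t := (D : Set (E × ZMod n))))
  obtain ⟨F', hF', hbF', -⟩ := exists_good_of_linearIndepOn hGn hz hbli (Set.subset_univ _)
    (winds_univ (connected_power hconn))
  let I := b.toFinset
  have hI : (I : Set (E × ZMod n)) = b := by simp [I]
  have hIF' : I ⊆ F' := by
    rw [← Finset.coe_subset, hI]
    exact hbF'
  have hk := hfol.le_numComponents hGn hF'.1 (hC ▸ hCb.trans hbF')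
  rw [hsum] at hk
  have hcardI : Fintype.card (V × ZMod n) ≤ I.card + 2 * s * Fintype.card V := by
    have h1 := (G.power n).finrank_span_add_finrank_nullspace z (fold n F)
    have h2 := hF.finrank_nullspace_le hs (n := n) (by omega) z
    rw [← hI] at hbli
    have h3 := finrank_span_eq_card hbli
    have h4 : Submodule.span ℝ ((G.power n).form z '' fold n F) ≤
        Submodule.span ℝ ((G.power n).form z '' I) := by
      refine Submodule.span_le.2 ?_
      rw [hD, hI]
      exact (Set.image_mono Set.subset_union_right).trans hspan
    have h5 := Submodule.finrank_mono h4
    omega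
  -- Away from the margins an edge used by the flow has its index inside the window, so it is
  -- already in `D`.
  have hmargin : ∀ x ∈ A.filter (fun x => η x ∉ D), x.2.val < s ∨ n ≤ x.2.val + s := by
    intro x hx
    simp only [A, Finset.mem_filter, Finset.mem_univ, true_and] at hx
    obtain ⟨e, he, h1, h2⟩ := hη x (hfol.ne_of_cycleSum_ne_zero hx.1)
    by_contra hcon
    rw [abs_le] at h2
    refine hx.2 (Finset.mem_coe.1 ?_)
    rw [← hD, h1]
    simp only [fold, roll, Set.mem_ofPred_eq]
    rw [coe_val_intCast (by omega) (by omega)]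
    exact he
  have hCD : (C \ D).card ≤ 2 * s * Fintype.card V := by
    refine le_trans (Finset.card_le_card (t := (A.filter (fun x => η x ∉ D)).image η) ?_)
      (Finset.card_image_le.trans (card_margin_le (by omega) hmargin))
    intro e he
    obtain ⟨h1, h2⟩ := Finset.mem_sdiff.1 he
    obtain ⟨x, hx, rfl⟩ := Finset.mem_image.1 h1
    exact Finset.mem_image_of_mem _ (Finset.mem_filter.2 ⟨hx, h2⟩)
  have h1 : (F' \ D).card ≤ 4 * s * Fintype.card V := by
    have h2 : F' \ D ⊆ (F' \ I) ∪ (C \ D) := by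
      intro e he
      obtain ⟨h3, h4⟩ := Finset.mem_sdiff.1 he
      by_cases h5 : e ∈ I
      · have h6 : e ∈ b := hI ▸ Finset.mem_coe.2 h5
        rcases hb h6 with h7 | h7
        · exact Finset.mem_union_right _ (Finset.mem_sdiff.2 ⟨h7, h4⟩)
        · exact (h4 h7).elim
      · exact Finset.mem_union_left _ (Finset.mem_sdiff.2 ⟨h3, h5⟩)
    have h3 := (Finset.card_le_card h2).trans (Finset.card_union_le _ _)
    have h4 := Finset.card_sdiff_add_card_eq_card hIF'
    have h5 := hF'.1
    have h6 : 4 * s * Fintype.card V = 2 * s * Fintype.card V + 2 * s * Fintype.card V := by ring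
    omega
  refine ⟨F', hF', by exact_mod_cast hk, h1, ?_⟩
  have h2 := card_fold_le hF.isForest hs hD
  have h3 := Finset.card_sdiff_add_card D F'
  have h4 := Finset.card_sdiff_add_card F' D
  rw [Finset.union_comm] at h4
  have h5 := hF'.1
  rw [Fintype.card_prod, ZMod.card] at h5
  have h6 : (n + 2 * s) * Fintype.card V = Fintype.card V * n + 2 * s * Fintype.card V := by ring
  have h7 : 6 * s * Fintype.card V = 2 * s * Fintype.card V + 4 * s * Fintype.card V := by ring
  omega

end PeriodicGraph

/-! ### Weighted sums over neighbouring sets -/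

section Near

variable {X : Type*} [Fintype X] [DecidableEq X]

theorem Finset.card_filter_card_le (b : ℕ) :
    (Finset.univ.filter fun A : Finset X => A.card ≤ b).card ≤ (Fintype.card X + 1) ^ b := by
  have h : (Finset.univ.filter fun A : Finset X => A.card ≤ b) ⊆
      Finset.univ.image fun f : Fin b → Option X => Finset.univ.filter fun x => ∃ i, f i = some x := by
    intro A hA
    simp only [Finset.mem_filter, Finset.mem_univ, true_and] at hA
    refine Finset.mem_image.2 ⟨fun i => A.toList[i.1]?, Finset.mem_univ _, ?_⟩
    ext x
    simp only [Finset.mem_filter, Finset.mem_univ, true_and]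
    rw [← Finset.mem_toList, List.mem_iff_getElem?]
    constructor
    · rintro ⟨i, hi⟩
      exact ⟨i, hi⟩
    · rintro ⟨i, hi⟩
      have h1 := (List.getElem?_eq_some_iff.1 hi).1
      rw [Finset.length_toList] at h1
      exact ⟨⟨i, by omega⟩, hi⟩
  refine (Finset.card_le_card h).trans (Finset.card_image_le.trans ?_)
  rw [Finset.card_univ, Fintype.card_fun, Fintype.card_option, Fintype.card_fin]

theorem Finset.prod_le_of_near {c : X → ℝ} (hc : ∀ x, 0 < c x) {κ : ℝ} (hκ : 1 ≤ κ)
    (h1 : ∀ x, c x ≤ κ) (h2 : ∀ x, 1 ≤ κ * c x) {D F : Finset X} {b b' : ℕ}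
    (hb : (F \ D).card ≤ b) (hb' : (D \ F).card ≤ b') :
    ∏ x ∈ D, c x ≤ κ ^ (b + b') * ∏ x ∈ F, c x := by
  have hpos : ∀ A : Finset X, 0 < ∏ x ∈ A, c x := fun A => Finset.prod_pos fun x _ => hc x
  have e1 : (∏ x ∈ F \ D, c x) * ∏ x ∈ D, c x = (∏ x ∈ D \ F, c x) * ∏ x ∈ F, c x := by
    rw [← Finset.prod_union Finset.sdiff_disjoint, ← Finset.prod_union Finset.sdiff_disjoint,
      Finset.sdiff_union_self_eq_union, Finset.sdiff_union_self_eq_union, Finset.union_comm]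
  have e2 : ∏ x ∈ D \ F, c x ≤ κ ^ b' := by
    refine (Finset.prod_le_prod (fun x _ => (hc x).le) fun x _ => h1 x).trans ?_
    rw [Finset.prod_const]
    exact pow_le_pow_right₀ hκ hb'
  have e3 : 1 ≤ κ ^ b * ∏ x ∈ F \ D, c x := by
    have : 1 ≤ κ ^ (F \ D).card * ∏ x ∈ F \ D, c x := by
      rw [← Finset.prod_const, ← Finset.prod_mul_distrib]
      exact Finset.one_le_prod fun x _ => h2 x
    refine this.trans (mul_le_mul_of_nonneg_right (pow_le_pow_right₀ hκ hb) (hpos _).le)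
  have hκ0 : 0 < κ := by linarith
  calc ∏ x ∈ D, c x ≤ (κ ^ b * ∏ x ∈ F \ D, c x) * ∏ x ∈ D, c x :=
        le_mul_of_one_le_left (hpos D).le e3
    _ = κ ^ b * ((∏ x ∈ D \ F, c x) * ∏ x ∈ F, c x) := by rw [← e1]; ring
    _ ≤ κ ^ b * (κ ^ b' * ∏ x ∈ F, c x) := by
        have := hpos F
        gcongr
    _ = _ := by rw [pow_add]; ring

/-- Given F, the set D is determined by the small sets F \ D and D \ F, so each F is chosen
polynomially often, and the weights of D and F differ by a bounded factor. -/
theorem Finset.sum_prod_le_of_near {c : X → ℝ} (hc : ∀ x, 0 < c x) {κ : ℝ} (hκ : 1 ≤ κ)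
    (h1 : ∀ x, c x ≤ κ) (h2 : ∀ x, 1 ≤ κ * c x) {𝒟 𝓕 : Finset (Finset X)} {b b' : ℕ}
    (h : ∀ D ∈ 𝒟, ∃ F ∈ 𝓕, (F \ D).card ≤ b ∧ (D \ F).card ≤ b') :
    ∑ D ∈ 𝒟, ∏ x ∈ D, c x ≤
      ((Fintype.card X + 1) * κ) ^ (b + b') * ∑ F ∈ 𝓕, ∏ x ∈ F, c x := by
  choose! φ hφ1 hφ2 hφ3 using h
  rw [← Finset.sum_fiberwise_of_maps_to hφ1, Finset.mul_sum]
  refine Finset.sum_le_sum fun F _ => ?_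
  have hpos : 0 < ∏ x ∈ F, c x := Finset.prod_pos fun x _ => hc x
  have hκ0 : 0 < κ := by linarith
  have e1 : ∀ D ∈ 𝒟.filter (fun D => φ D = F), ∏ x ∈ D, c x ≤ κ ^ (b + b') * ∏ x ∈ F, c x := by
    intro D hD
    obtain ⟨hD1, rfl⟩ := Finset.mem_filter.1 hD
    exact Finset.prod_le_of_near hc hκ h1 h2 (hφ2 D hD1) (hφ3 D hD1)
  refine (Finset.sum_le_card_nsmul _ _ _ e1).trans ?_
  rw [nsmul_eq_mul, mul_pow, mul_assoc]
  refine mul_le_mul_of_nonneg_right ?_ (by positivity)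
  have e2 : (𝒟.filter (fun D => φ D = F)).card ≤
      ((Finset.univ.filter fun A : Finset X => A.card ≤ b) ×ˢ
        (Finset.univ.filter fun A : Finset X => A.card ≤ b')).card := by
    refine Finset.card_le_card_of_injOn (fun D => (F \ D, D \ F)) ?_ ?_
    · intro D hD
      obtain ⟨hD1, rfl⟩ := Finset.mem_filter.1 (Finset.mem_coe.1 hD)
      simpa using ⟨hφ2 D hD1, hφ3 D hD1⟩
    · intro D _ D' _ heq
      obtain ⟨e3, e4⟩ := Prod.mk.inj heq
      ext x
      have e5 := congrArg (fun A => x ∈ A) e3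
      have e6 := congrArg (fun A => x ∈ A) e4
      simp only [Finset.mem_sdiff, eq_iff_iff] at e5 e6
      tauto
  rw [Finset.card_product] at e2
  have e3 := e2.trans (Nat.mul_le_mul (Finset.card_filter_card_le b) (Finset.card_filter_card_le b'))
  rw [← pow_add] at e3
  exact_mod_cast e3

end Near

namespace PeriodicGraph

variable {V E : Type*} [Fintype V] [DecidableEq V] [Fintype E] [DecidableEq E]
  {G : PeriodicGraph V E}

theorem sum_good_le_sum_crsfSum {c : E → ℝ} (hc : ∀ e, 0 < c e) (j n : ℕ) [NeZero n] :
    ∑ F ∈ Finset.univ.filter (fun F : Finset (E × ZMod n) => (G.power n).Good F ∧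
      j ≤ (G.power n).base.numComponents (F : Set (E × ZMod n))), ∏ x ∈ F, c x.1 ≤
      ∑ i ∈ Finset.Icc j (Fintype.card V * n), G.crsfSum c i n := by
  rw [← Finset.sum_fiberwise_of_maps_to
    (g := fun F : Finset (E × ZMod n) => (G.power n).base.numComponents (F : Set (E × ZMod n)))
    (t := Finset.Icc j (Fintype.card V * n))]
  · refine Finset.sum_le_sum fun i _ => ?_
    rw [crsfSum_eq_coeff, forestPoly_coeff]
    refine Finset.sum_le_sum_of_subset_of_nonneg ?_ fun F _ _ =>
      Finset.prod_nonneg fun x _ => (hc x.1).le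
    intro F
    simp only [Finset.mem_filter, Finset.mem_univ, true_and]
    exact fun h => ⟨h.1.1, h.2⟩
  · intro F hF
    simp only [Finset.mem_filter, Finset.mem_univ, true_and] at hF
    have := (G.power n).numComponents_le (F : Set (E × ZMod n))
    rw [Fintype.card_prod, ZMod.card] at this
    exact Finset.mem_Icc.2 ⟨hF.2, this⟩

theorem exists_conductance_bound {c : E → ℝ} (hc : ∀ e, 0 < c e) :
    ∃ κ : ℝ, 1 ≤ κ ∧ (∀ e, c e ≤ κ) ∧ ∀ e, 1 ≤ κ * c e := by
  have hnn : ∀ e, 0 ≤ c e + (c e)⁻¹ := fun e => by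
    have := hc e
    positivity
  refine ⟨1 + ∑ e, (c e + (c e)⁻¹), ?_, fun e => ?_, fun e => ?_⟩
  · have := Finset.sum_nonneg fun e (_ : e ∈ Finset.univ) => hnn e
    linarith
  · have h1 := Finset.single_le_sum (fun e _ => hnn e) (Finset.mem_univ e)
    have h2 := inv_pos.2 (hc e)
    linarith
  · have h1 := Finset.single_le_sum (fun e _ => hnn e) (Finset.mem_univ e)
    have h2 := hc e
    have h3 : (c e)⁻¹ ≤ 1 + ∑ e, (c e + (c e)⁻¹) := by linarith
    calc (1 : ℝ) = (c e)⁻¹ * c e := (inv_mul_cancel₀ h2.ne').symm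
      _ ≤ _ := by gcongr

/-- The weighted sum of the configurations close to some cycle-rooted spanning forest with at least
`j` components is at most a polynomial times `R ^ n`, if this holds for these forests. -/
theorem exists_sum_near_le {c : E → ℝ} (hc : ∀ e, 0 < c e) {j : ℕ} {K R : ℝ} (hR : 0 < R)
    (hK : 0 ≤ K) (hsum : ∀ (i n : ℕ) [NeZero n], j ≤ i → G.crsfSum c i n ≤ K * R ^ n) (b b' : ℕ) :
    ∃ (B : ℝ) (d : ℕ), 0 ≤ B ∧ ∀ (n : ℕ) [NeZero n] (𝒟 : Finset (Finset (E × ZMod n))),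
      (∀ D ∈ 𝒟, ∃ F : Finset (E × ZMod n), (G.power n).Good F ∧
        j ≤ (G.power n).base.numComponents (F : Set (E × ZMod n)) ∧
        (F \ D).card ≤ b ∧ (D \ F).card ≤ b') →
      ∑ D ∈ 𝒟, ∏ x ∈ D, c x.1 ≤ B * (n + 1) ^ d * R ^ n := by
  obtain ⟨κ, hκ, hκ1, hκ2⟩ := exists_conductance_bound hc
  refine ⟨((Fintype.card E + 1) * κ) ^ (b + b') * ((Fintype.card V + 1) * K), b + b' + 1,
    by positivity, ?_⟩
  intro n _ 𝒟 h𝒟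
  have h1 := Finset.sum_prod_le_of_near (c := fun x : E × ZMod n => c x.1) (fun x => hc x.1) hκ
    (fun x => hκ1 x.1) (fun x => hκ2 x.1) (𝒟 := 𝒟)
    (𝓕 := Finset.univ.filter (fun F : Finset (E × ZMod n) => (G.power n).Good F ∧
      j ≤ (G.power n).base.numComponents (F : Set (E × ZMod n)))) (b := b) (b' := b') (by
      intro D hD
      obtain ⟨F, h1, h2, h3⟩ := h𝒟 D hD
      exact ⟨F, by simpa using ⟨h1, h2⟩, h3⟩)
  refine h1.trans ?_
  have h2 : ∑ i ∈ Finset.Icc j (Fintype.card V * n), G.crsfSum c i n ≤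
      (Fintype.card V + 1) * (n + 1) * (K * R ^ n) := by
    refine (Finset.sum_le_card_nsmul _ _ (K * R ^ n) fun i hi =>
      hsum i n (Finset.mem_Icc.1 hi).1).trans ?_
    rw [nsmul_eq_mul, Nat.card_Icc]
    refine mul_le_mul_of_nonneg_right ?_ (by positivity)
    have : Fintype.card V * n + 1 - j ≤ (Fintype.card V + 1) * (n + 1) := by
      refine (Nat.sub_le _ _).trans ?_
      nlinarith
    exact_mod_cast this
  have h3 : ((Fintype.card (E × ZMod n) : ℝ) + 1) * κ ≤ (Fintype.card E + 1) * κ * (n + 1) := by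
    rw [Fintype.card_prod, ZMod.card]
    push_cast
    have : (0 : ℝ) ≤ (Fintype.card E + n) * κ := by positivity
    nlinarith
  have h4 : 0 ≤ ∑ F ∈ Finset.univ.filter (fun F : Finset (E × ZMod n) => (G.power n).Good F ∧
      j ≤ (G.power n).base.numComponents (F : Set (E × ZMod n))), ∏ x ∈ F, c x.1 :=
    Finset.sum_nonneg fun F _ => Finset.prod_nonneg fun x _ => (hc x.1).le
  calc _ ≤ ((Fintype.card E + 1) * κ * (n + 1)) ^ (b + b') *
        ((Fintype.card V + 1) * (n + 1) * (K * R ^ n)) :=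
      mul_le_mul (pow_le_pow_left₀ (by positivity) h3 _) ((sum_good_le_sum_crsfSum hc j n).trans h2)
        h4 (by positivity)
    _ = _ := by
      rw [mul_pow, pow_succ]
      ring

end PeriodicGraph

/-! ### Languages cut at last returns -/

section Words

open scoped ENNReal

variable {α : Type*} (ω : α → ℝ≥0∞)

/-- The product of the weights of the letters. -/
def wordWeight (w : List α) : ℝ≥0∞ := (w.map ω).prod

/-- The total weight of a set of words. -/
def langWeight (S : Set (List α)) : ℝ≥0∞ := ∑' w : S, wordWeight ω w

variable {ω}

theorem wordWeight_append_cons (u v : List α) (a : α) :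
    wordWeight ω (u ++ a :: v) = wordWeight ω u * (ω a * wordWeight ω v) := by
  simp [wordWeight]

theorem langWeight_mono {S T : Set (List α)} (h : S ⊆ T) : langWeight ω S ≤ langWeight ω T :=
  ENNReal.tsum_mono_subtype _ h

theorem langWeight_singleton_nil : langWeight ω {[]} = 1 := by
  simp [langWeight, wordWeight]

theorem langWeight_append_cons_le [Fintype α] (A B : Set (List α)) :
    langWeight ω {w | ∃ u ∈ A, ∃ a, ∃ v ∈ B, w = u ++ a :: v} ≤
      langWeight ω A * ((∑ a, ω a) * langWeight ω B) := by
  let f : A × α × B → {w | ∃ u ∈ A, ∃ a, ∃ v ∈ B, w = u ++ a :: v} := fun x =>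
    ⟨x.1 ++ x.2.1 :: x.2.2, x.1, x.1.2, x.2.1, x.2.2, x.2.2.2, rfl⟩
  have hf : Function.Surjective f := by
    rintro ⟨_, u, hu, a, v, hv, rfl⟩
    exact ⟨(⟨u, hu⟩, a, ⟨v, hv⟩), rfl⟩
  refine (ENNReal.tsum_le_tsum_comp_of_surjective hf _).trans (le_of_eq ?_)
  simp only [f, wordWeight_append_cons]
  have h : ∑' x : α × B, ω x.1 * wordWeight ω x.2 = (∑ a, ω a) * langWeight ω B := by
    rw [ENNReal.tsum_prod (f := fun a (v : B) => ω a * wordWeight ω v)]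
    simp only [ENNReal.tsum_mul_left, tsum_fintype]
    rw [← Finset.sum_mul]
    rfl
  rw [ENNReal.tsum_prod (f := fun (u : A) (x : α × B) => wordWeight ω u * (ω x.1 * wordWeight ω x.2))]
  simp only [ENNReal.tsum_mul_left, h, ENNReal.tsum_mul_right]
  rfl

theorem langWeight_length_le [Fintype α] (n : ℕ) :
    langWeight ω {w | w.length = n} ≤ (∑ a, ω a) ^ n := by
  induction n with
  | zero =>
    rw [pow_zero, ← langWeight_singleton_nil (ω := ω)]
    exact langWeight_mono fun w hw => List.length_eq_zero_iff.1 hw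
  | succ n ih =>
    have h : {w : List α | w.length = n + 1} ⊆
        {w | ∃ u ∈ ({[]} : Set (List α)), ∃ a, ∃ v ∈ {w : List α | w.length = n}, w = u ++ a :: v} := by
      intro w hw
      cases w with
      | nil => simp at hw
      | cons a v => exact ⟨[], rfl, a, v, by simpa using hw, rfl⟩
    refine (langWeight_mono h).trans ((langWeight_append_cons_le _ _).trans ?_)
    rw [langWeight_singleton_nil, one_mul, pow_succ']
    gcongr

/-- A word which visits the states in `T` splits at the last visit of its first state. -/
theorem langWeight_le_of_split [Fintype α] {P : Type*} [Fintype P] [DecidableEq P]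
    {lang : Finset P → ℕ → Set (List α)} {ret : ℕ → Set (List α)} (hnil : ∀ T, lang T 0 ⊆ {[]})
    (hsplit : ∀ T n w, 0 < n → w ∈ lang T n → ∃ p ∈ T, ∃ l < n, ∃ u ∈ ret l, ∃ a,
      ∃ v ∈ lang (T.erase p) (n - 1 - l), w = u ++ a :: v)
    {κ β ρ : ℝ≥0∞} {d : ℕ} (hret : ∀ l, langWeight ω (ret l) ≤ κ * (l + 1) ^ d * ρ ^ l)
    (hβ : 1 ≤ β) (hκ : Fintype.card P * (κ * ∑ a, ω a) ≤ β * ρ) (T : Finset P) (n : ℕ) :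
    langWeight ω (lang T n) ≤ β ^ T.card * (n + 1) ^ ((d + 1) * T.card) * ρ ^ n := by
  induction hT : T.card generalizing T n with
  | zero =>
    rcases Nat.eq_zero_or_pos n with rfl | hn
    · refine (langWeight_mono (hnil T)).trans ?_
      simp [langWeight_singleton_nil]
    · have : lang T n ⊆ ∅ := by
        intro w hw
        obtain ⟨p, hp, -⟩ := hsplit T n w hn hw
        rw [Finset.card_eq_zero.1 hT] at hp
        simp at hp
      refine (langWeight_mono this).trans ?_
      simp [langWeight]
  | succ t ih =>
    rcases Nat.eq_zero_or_pos n with rfl | hn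
    · refine (langWeight_mono (hnil T)).trans ?_
      rw [langWeight_singleton_nil]
      simpa using one_le_pow₀ hβ
    · have hsub : lang T n ⊆ ⋃ x ∈ T ×ˢ Finset.range n,
          {w | ∃ u ∈ ret x.2, ∃ a, ∃ v ∈ lang (T.erase x.1) (n - 1 - x.2), w = u ++ a :: v} := by
        intro w hw
        obtain ⟨p, hp, l, hl, h⟩ := hsplit T n w hn hw
        simp only [Set.mem_iUnion]
        exact ⟨(p, l), Finset.mem_product.2 ⟨hp, Finset.mem_range.2 hl⟩, h⟩
      refine (langWeight_mono hsub).trans ((ENNReal.tsum_biUnion_le _ _ _).trans ?_)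
      have hterm : ∀ x ∈ T ×ˢ Finset.range n, langWeight ω
          {w | ∃ u ∈ ret x.2, ∃ a, ∃ v ∈ lang (T.erase x.1) (n - 1 - x.2), w = u ++ a :: v} ≤
          (κ * ∑ a, ω a) * (β ^ t * (n + 1) ^ (d + (d + 1) * t) * ρ ^ (n - 1)) := by
        rintro ⟨p, l⟩ hx
        obtain ⟨hp, hl⟩ := Finset.mem_product.1 hx
        have hl := Finset.mem_range.1 hl
        simp only at hp hl ⊢
        refine (langWeight_append_cons_le _ _).trans ?_
        have h1 := ih (T.erase p) (n - 1 - l) (by rw [Finset.card_erase_of_mem hp, hT]; rfl)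
        have h2 : ((l : ℝ≥0∞) + 1) ≤ n + 1 := by
          have : (l : ℝ≥0∞) ≤ n := by exact_mod_cast hl.le
          gcongr
        have h3 : (((n - 1 - l : ℕ) : ℝ≥0∞) + 1) ≤ n + 1 := by
          have : ((n - 1 - l : ℕ) : ℝ≥0∞) ≤ n := by
            exact_mod_cast ((Nat.sub_le _ _).trans (Nat.sub_le _ _))
          gcongr
        calc _ ≤ (κ * (n + 1) ^ d * ρ ^ l) * ((∑ a, ω a) *
              (β ^ t * (n + 1) ^ ((d + 1) * t) * ρ ^ (n - 1 - l))) := by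
              refine mul_le_mul' ((hret l).trans ?_) (mul_le_mul' le_rfl (h1.trans ?_))
              · gcongr
              · gcongr
          _ = (κ * ∑ a, ω a) * (β ^ t * ((n + 1) ^ d * (n + 1) ^ ((d + 1) * t)) *
              (ρ ^ l * ρ ^ (n - 1 - l))) := by ring
          _ = _ := by
              rw [← pow_add, ← pow_add, Nat.add_sub_cancel' (by omega : l ≤ n - 1)]
      refine (Finset.sum_le_card_nsmul _ _ _ hterm).trans ?_
      rw [nsmul_eq_mul, Finset.card_product, Finset.card_range]
      have hTP : ((T.card : ℕ) : ℝ≥0∞) ≤ Fintype.card P := by exact_mod_cast Finset.card_le_univ T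
      have hn1 : (n : ℝ≥0∞) ≤ n + 1 := le_self_add
      calc _ = (T.card * (κ * ∑ a, ω a)) *
            (n * (β ^ t * (n + 1) ^ (d + (d + 1) * t) * ρ ^ (n - 1))) := by
              push_cast
              ring
        _ ≤ (β * ρ) * ((n + 1) * (β ^ t * (n + 1) ^ (d + (d + 1) * t) * ρ ^ (n - 1))) := by
              refine mul_le_mul' (le_trans ?_ hκ) (mul_le_mul' hn1 le_rfl)
              gcongr
        _ = β ^ (t + 1) * (n + 1) ^ (d + (d + 1) * t + 1) * (ρ ^ (n - 1) * ρ) := by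
              rw [pow_succ, pow_succ ((n : ℝ≥0∞) + 1)]
              ring
        _ = _ := by
              rw [← pow_succ, Nat.sub_add_cancel hn]
              congr 3
              ring

end Words

/-! ### Upper bound for the windows of essential spanning forests -/

namespace PeriodicGraph

variable {V E : Type*} [Fintype V] [DecidableEq V] [Fintype E] [DecidableEq E]
  {G : PeriodicGraph V E} {F : Set (E × ℤ)} {s : ℕ}

theorem reachable_trans (t : ℤ) {x y : V × ℤ} :
    (G.cover.spanned (trans t ⁻¹' F)).Reachable x y ↔
      (G.cover.spanned F).Reachable (trans t x) (trans t y) := by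
  constructor
  · refine G.cover.reachable_map G.cover (trans t) fun e he => ?_
    rw [← cover_src_trans, ← cover_tgt_trans]
    exact G.cover.reachable_edge he
  · intro h
    have h1 : ∀ z : V × ℤ, trans (-t) (trans t z) = z := fun z => by
      rw [trans_trans, add_neg_cancel, trans_zero]
    rw [← h1 x, ← h1 y]
    refine G.cover.reachable_map G.cover (trans (-t)) (fun e he => ?_) h
    rw [← cover_src_trans, ← cover_tgt_trans]
    refine G.cover.reachable_edge ?_
    rw [Set.mem_preimage, trans_trans, neg_add_cancel, trans_zero]
    exact he

theorem Escaping.translate (h : G.Escaping F) (t : ℤ) : G.Escaping (trans t ⁻¹' F) where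
  isForest e he hr := by
    have h1 : trans t ⁻¹' F \ {e} = trans t ⁻¹' (F \ {trans t e}) := by
      ext e'
      simp [(trans_injective t).eq_iff]
    rw [h1, reachable_trans, ← cover_src_trans, ← cover_tgt_trans] at hr
    exact h.isForest _ he hr
  exists_reachable x N := by
    obtain ⟨y, hy, hxy⟩ := h.exists_reachable (trans t x) (N + t)
    refine ⟨trans (-t) y, ?_, ?_⟩
    · simp only [trans]
      linarith
    · rw [reachable_trans, trans_trans, neg_add_cancel, trans_zero]
      exact hxy

/-- The edges of `F` in the fundamental domain number `l`. -/
def slab (F : Set (E × ℤ)) (l : ℤ) : Finset E := Finset.univ.filter fun e => (e, l) ∈ F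

/-- The window of length `n` of `F` at `a`, as a word. -/
def word (F : Set (E × ℤ)) (a : ℤ) (n : ℕ) : List (Finset E) :=
  (List.range n).map fun i : ℕ => slab F (a + i)

theorem word_split (F : Set (E × ℤ)) {l n : ℕ} (h : l < n) :
    word F 0 n = word F 0 l ++ slab F l :: word (trans (l + 1) ⁻¹' F) 0 (n - 1 - l) := by
  obtain ⟨d, rfl⟩ := Nat.exists_eq_add_of_lt h
  rw [show l + d + 1 - 1 - l = d by omega, show l + d + 1 = l + (1 + d) by ring]
  simp only [word, List.range_add, List.map_append, List.map_map, List.range_one, List.map_cons,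
    List.singleton_append]
  congr 1
  simp only [zero_add, add_zero]
  congr 1
  refine List.map_congr_left fun i _ => ?_
  simp only [slab, Function.comp_apply, Set.mem_preimage, trans]
  ext e
  simp only [Finset.mem_filter, Finset.mem_univ, true_and]
  rw [show ((l + (1 + i) : ℕ) : ℤ) = (i : ℤ) + (l + 1) by push_cast; ring]

theorem word_eq_iff {F F' : Set (E × ℤ)} {n : ℕ} [NeZero n] :
    word F 0 n = word F' 0 n ↔ fold n F = fold n F' := by
  simp only [word, List.map_inj_left, List.mem_range, zero_add]
  constructor
  · intro h
    ext x
    have h1 := congrArg (fun A => x.1 ∈ A) (h x.2.val (ZMod.val_lt _))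
    simpa [slab, fold, -ZMod.natCast_val] using h1
  · intro h i hi
    ext e
    have h1 := congrArg (fun A => (e, (i : ZMod n)) ∈ A) h
    simpa [slab, fold, ZMod.val_natCast_of_lt hi, -ZMod.natCast_val] using h1

theorem wordWeight_word {c : E → ℝ} (hc : ∀ e, 0 < c e) {n : ℕ} [NeZero n]
    {D : Finset (E × ZMod n)} (hD : fold n F = (D : Set (E × ZMod n))) :
    wordWeight (fun A : Finset E => ENNReal.ofReal (∏ e ∈ A, c e)) (word F 0 n) =
      ENNReal.ofReal (∏ x ∈ D, c x.1) := by
  have h1 : wordWeight (fun A : Finset E => ENNReal.ofReal (∏ e ∈ A, c e)) (word F 0 n) =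
      ∏ i ∈ Finset.range n, ENNReal.ofReal (∏ e ∈ slab F i, c e) := by
    simp only [wordWeight, word, List.map_map, zero_add]
    rfl
  rw [h1, ← ENNReal.ofReal_prod_of_nonneg fun i _ => Finset.prod_nonneg fun e _ => (hc e).le,
    Finset.prod_sigma']
  congr 1
  refine Finset.prod_nbij' (fun x => (x.2, (x.1 : ZMod n))) (fun x => ⟨x.2.val, x.1⟩) ?_ ?_ ?_ ?_ ?_
  · rintro ⟨i, e⟩ hx
    obtain ⟨hi, he⟩ := Finset.mem_sigma.1 hx
    rw [← Finset.mem_coe, ← hD]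
    simpa [fold, ZMod.val_natCast_of_lt (Finset.mem_range.1 hi), slab, -ZMod.natCast_val] using he
  · intro x hx
    rw [← Finset.mem_coe, ← hD] at hx
    simpa [slab, ZMod.val_lt, fold, -ZMod.natCast_val] using hx
  · rintro ⟨i, e⟩ hx
    obtain ⟨hi, he⟩ := Finset.mem_sigma.1 hx
    simp [ZMod.val_natCast_of_lt (Finset.mem_range.1 hi)]
  · intro x _
    simp
  · intro x _
    rfl

/-- The windows of escaping forests with a flow whose states at the places `i < n` are in `T`. -/
def flowLang (G : PeriodicGraph V E) (s k : ℕ) (T : Finset (V × Fin (2 * s + 1) → V × ZMod (2 * s + 1)))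
    (n : ℕ) : Set (List (Finset E)) :=
  {w | ∃ F nxt ε, G.Escaping F ∧ G.IsFlow F s k 0 (n + (2 * s + 1)) nxt ε ∧
    (∀ i < n, flowState s nxt (i : ℕ) ∈ T) ∧ w = word F 0 n}

/-- The windows of escaping forests with a flow whose states at both ends agree. -/
def returnLang (G : PeriodicGraph V E) (s k : ℕ) (n : ℕ) : Set (List (Finset E)) :=
  {w | ∃ F nxt ε, G.Escaping F ∧ G.IsFlow F s k 0 (n + (2 * s + 1)) nxt ε ∧
    flowState s nxt 0 = flowState s nxt n ∧ w = word F 0 n}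

theorem flowLang_split {k : ℕ} (T : Finset (V × Fin (2 * s + 1) → V × ZMod (2 * s + 1))) (n : ℕ)
    (w : List (Finset E)) (hn : 0 < n) (hw : w ∈ G.flowLang s k T n) :
    ∃ p ∈ T, ∃ l < n, ∃ u ∈ G.returnLang s k l, ∃ a, ∃ v ∈ G.flowLang s k (T.erase p) (n - 1 - l),
      w = u ++ a :: v := by
  obtain ⟨F, nxt, ε, hF, h, hT, rfl⟩ := hw
  -- The window is cut at the last time its initial state recurs; time 0 belongs to `S`, so the
  -- return piece may be empty.
  let S := (Finset.range n).filter fun i => flowState s nxt (i : ℕ) = flowState s nxt 0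
  have hS : S.Nonempty := ⟨0, by simp [S, hn]⟩
  obtain ⟨l, hlS, hl⟩ := S.exists_max_image id hS
  simp only [S, Finset.mem_filter, Finset.mem_range, id] at hlS hl
  refine ⟨flowState s nxt 0, by simpa using hT 0 hn, l, hlS.1, word F 0 l,
    ⟨F, nxt, ε, hF, h.mono le_rfl ?_, hlS.2.symm, rfl⟩, slab F l,
    word (trans (l + 1) ⁻¹' F) 0 (n - 1 - l), ?_, word_split F hlS.1⟩
  · have : (l : ℤ) ≤ n := by exact_mod_cast hlS.1.le
    linarith
  · refine ⟨_, _, _, hF.translate (l + 1), (h.translate (l + 1)).mono (by linarith) ?_, ?_, rfl⟩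
    · have : ((n - 1 - l : ℕ) : ℤ) = n - 1 - l := by omega
      rw [this]
      linarith
    · intro i hi
      rw [flowState_translate]
      have h1 : (i : ℤ) + (l + 1) = ((i + (l + 1) : ℕ) : ℤ) := by push_cast; ring
      rw [h1]
      refine Finset.mem_erase.2 ⟨fun h2 => ?_, hT _ (by omega)⟩
      have := hl _ ⟨by omega, h2⟩
      omega

theorem flowLang_zero {k : ℕ} (T : Finset (V × Fin (2 * s + 1) → V × ZMod (2 * s + 1))) :
    G.flowLang s k T 0 ⊆ {[]} := by
  rintro _ ⟨F, nxt, ε, -, -, -, rfl⟩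
  rfl

theorem exists_langWeight_returnLang_le {c : E → ℝ} (hc : ∀ e, 0 < c e)
    (hGn : ∀ n [NeZero n], (G.power n).Annular) (hconn : (G.cover.spanned Set.univ).Connected)
    (hs : ∀ e, |G.shift e| ≤ s) {k : ℕ} {K R : ℝ} (hR : 0 < R) (hK : 0 ≤ K)
    (hsum : ∀ (i n : ℕ) [NeZero n], k ≤ i → G.crsfSum c i n ≤ K * R ^ n) :
    ∃ (B : ℝ) (d : ℕ), 0 ≤ B ∧ ∀ n,
      langWeight (fun A : Finset E => ENNReal.ofReal (∏ e ∈ A, c e)) (G.returnLang s k n) ≤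
        ENNReal.ofReal B * (n + 1) ^ d * ENNReal.ofReal R ^ n := by
  obtain ⟨B, d, hB, h⟩ := exists_sum_near_le hc hR hK hsum (4 * s * Fintype.card V)
    (6 * s * Fintype.card V)
  let A : ℝ := ∑ S : Finset E, ∏ e ∈ S, c e
  have hA : 0 ≤ A := Finset.sum_nonneg fun S _ => Finset.prod_nonneg fun e _ => (hc e).le
  let B' : ℝ := B + ∑ n ∈ Finset.range (2 * s + 1), A ^ n / R ^ n
  have hterm : ∀ n, 0 ≤ A ^ n / R ^ n := fun n => by positivity
  have hB' : B ≤ B' := by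
    have := Finset.sum_nonneg fun n (_ : n ∈ Finset.range (2 * s + 1)) => hterm n
    simp only [B']
    linarith
  refine ⟨B', d, hB.trans hB', fun n => ?_⟩
  have hofReal : ENNReal.ofReal B' * (n + 1) ^ d * ENNReal.ofReal R ^ n =
      ENNReal.ofReal (B' * (n + 1) ^ d * R ^ n) := by
    rw [ENNReal.ofReal_mul (by have := hB.trans hB'; positivity), ENNReal.ofReal_mul (hB.trans hB'),
      ENNReal.ofReal_pow hR.le, ENNReal.ofReal_pow (by positivity)]
    congr 3
    rw [ENNReal.ofReal_add (by positivity) zero_le_one]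
    simp
  rw [hofReal]
  -- Closing up needs n ≥ 2s + 1. The finitely many shorter lengths are absorbed in the constant
  -- `B'`.
  rcases Nat.lt_or_ge n (2 * s + 1) with hn | hn
  · have h1 : G.returnLang s k n ⊆ {w | w.length = n} := by
      rintro _ ⟨F, nxt, ε, -, -, -, rfl⟩
      simp [word]
    refine (langWeight_mono h1).trans ((langWeight_length_le n).trans ?_)
    rw [← ENNReal.ofReal_sum_of_nonneg fun S _ => Finset.prod_nonneg fun e _ => (hc e).le,
      ← ENNReal.ofReal_pow hA]
    refine ENNReal.ofReal_le_ofReal ?_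
    have h2 : A ^ n / R ^ n ≤ B' := by
      have := Finset.single_le_sum (fun n _ => hterm n) (Finset.mem_range.2 hn)
      simp only [B']
      linarith
    have h3 : (1 : ℝ) ≤ (n + 1) ^ d := one_le_pow₀ (by linarith [Nat.cast_nonneg (α := ℝ) n])
    calc A ^ n = A ^ n / R ^ n * R ^ n := by field_simp
      _ ≤ B' * R ^ n := by gcongr
      _ ≤ B' * (n + 1) ^ d * R ^ n := by
          refine mul_le_mul_of_nonneg_right ?_ (by positivity)
          exact le_mul_of_one_le_right (hB.trans hB') h3
  · have hn0 : NeZero n := ⟨by omega⟩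
    let 𝒟 : Finset (Finset (E × ZMod n)) := Finset.univ.filter fun D =>
      ∃ F : Finset (E × ZMod n), (G.power n).Good F ∧
        k ≤ (G.power n).base.numComponents (F : Set (E × ZMod n)) ∧
        (F \ D).card ≤ 4 * s * Fintype.card V ∧ (D \ F).card ≤ 6 * s * Fintype.card V
    have h1 := h n 𝒟 fun D hD => (Finset.mem_filter.1 hD).2
    have hw : ∀ w : G.returnLang s k n, ∃ D : 𝒟, ∃ F, fold n F = (D : Set (E × ZMod n)) ∧
        (w : List (Finset E)) = word F 0 n := by
      rintro ⟨_, F, nxt, ε, hF, hflow, hst, rfl⟩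
      have hD : fold n F = ((fold n F).toFinset : Set (E × ZMod n)) := by simp
      refine ⟨⟨(fold n F).toFinset, Finset.mem_filter.2 ⟨Finset.mem_univ _, ?_⟩⟩, F, hD, rfl⟩
      exact hflow.exists_good_near (hGn n) hconn hF hs hn (by positivity) (by linarith) hst hD
    choose D F hDF hwF using hw
    have hinj : Function.Injective D := by
      intro w w' heq
      apply Subtype.ext
      rw [hwF, hwF, word_eq_iff, hDF, hDF, heq]
    have h2 : langWeight (fun A : Finset E => ENNReal.ofReal (∏ e ∈ A, c e)) (G.returnLang s k n) ≤
        ∑' D : 𝒟, ENNReal.ofReal (∏ x ∈ (D : Finset (E × ZMod n)), c x.1) := by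
      refine le_trans (le_of_eq (tsum_congr fun w => ?_)) (ENNReal.tsum_comp_le_tsum_of_injective hinj _)
      rw [hwF w, wordWeight_word hc (hDF w)]
    rw [Finset.tsum_subtype 𝒟 fun D => ENNReal.ofReal (∏ x ∈ D, c x.1),
      ← ENNReal.ofReal_sum_of_nonneg fun S _ => Finset.prod_nonneg fun e _ => (hc e.1).le] at h2
    refine h2.trans (ENNReal.ofReal_le_ofReal (h1.trans ?_))
    gcongr

theorem exists_isFlow_of_mem_esf {j : ℕ} (hj : 1 ≤ j) (hs : ∀ e, |G.shift e| ≤ s) [Nonempty E]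
    (hF : F ∈ G.esf j) (lo hi : ℤ) : ∃ nxt ε, G.IsFlow F s j lo hi nxt ε := by
  obtain ⟨-, hcard, hub⟩ := hF
  -- The count by `Nat.card` is 0 for infinitely many components; j ≥ 1 rules this out.
  have hfin : Finite (G.cover.spanned F).ConnectedComponent := by
    by_contra hinf
    rw [not_finite_iff_infinite] at hinf
    rw [EdgeGraph.numComponents, Nat.card_eq_zero_of_infinite] at hcard
    omega
  let κ : Fin j ≃ (G.cover.spanned F).ConnectedComponent := (Finite.equivFinOfCardEq hcard).symm
  choose x hx hxlo using fun a => (hub (κ a) (lo - 1)).1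
  choose y hy hyhi using fun a => (hub (κ a) hi).2
  have hxy : ∀ a, (G.cover.spanned F).Reachable (x a) (y a) := fun a =>
    SimpleGraph.ConnectedComponent.exact ((hx a).trans (hy a).symm)
  choose w hw using fun a => (hxy a).exists_isPath
  refine exists_isFlow_of_paths hs (p := fun a i => (w a).getVert i) (len := fun a => (w a).length)
    (fun a i hi' => (w a).adj_getVert_succ hi') ?_ (fun a => ?_) (fun a => ?_)
  · intro a i a' i' hi1 hi2 heq
    have hcomp : ∀ a i, (G.cover.spanned F).connectedComponentMk ((w a).getVert i) = κ a := by
      intro a i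
      rw [← hx a]
      exact SimpleGraph.ConnectedComponent.sound ((w a).take i).reachable.symm
    have h1 : a = a' := by
      apply κ.injective
      rw [← hcomp a i, ← hcomp a' i', heq]
    subst h1
    exact ⟨rfl, (hw a).getVert_injOn hi1 hi2 heq⟩
  · simp only [SimpleGraph.Walk.getVert_zero]
    have := hxlo a
    linarith
  · simp only [SimpleGraph.Walk.getVert_length]
    exact hyhi a

theorem Escaping.of_mem_esf {j : ℕ} (hF : F ∈ G.esf j) : G.Escaping F where
  isForest := hF.1.1
  exists_reachable x N := by
    obtain ⟨y, hy, hyN⟩ := (hF.2.2 ((G.cover.spanned F).connectedComponentMk x) N).2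
    exact ⟨y, hyN, SimpleGraph.ConnectedComponent.exact hy.symm⟩

/-- The growth of the windows of essential spanning forests is at most that of the cycle-rooted
spanning forests. -/
theorem exists_windowSum_le {c : E → ℝ} (hc : ∀ e, 0 < c e)
    (hGn : ∀ n [NeZero n], (G.power n).Annular) (hconn : (G.cover.spanned Set.univ).Connected)
    {j : ℕ} (hj : 1 ≤ j) {K R : ℝ} (hR : 0 < R) (hK : 0 ≤ K)
    (hsum : ∀ (i n : ℕ) [NeZero n], j ≤ i → G.crsfSum c i n ≤ K * R ^ n) :
    ∃ (B : ℝ) (d : ℕ), 0 ≤ B ∧ ∀ n, 0 < n → G.windowSum c j n ≤ B * (n + 1) ^ d * R ^ n := by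
  obtain ⟨s, hs⟩ := G.exists_abs_shift_le
  obtain ⟨B, d, hB, hret⟩ := exists_langWeight_returnLang_le hc hGn hconn hs hR hK hsum
  have := nonempty_edges hconn
  let P := V × Fin (2 * s + 1) → V × ZMod (2 * s + 1)
  let A : ℝ := ∑ S : Finset E, ∏ e ∈ S, c e
  have hA : 0 ≤ A := Finset.sum_nonneg fun S _ => Finset.prod_nonneg fun e _ => (hc e).le
  let β : ℝ := 1 + Fintype.card P * (B * A) / R
  have hβ : 1 ≤ β := by
    have : 0 ≤ Fintype.card P * (B * A) / R := by positivity
    simp only [β]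
    linarith
  have hβ0 : 0 ≤ β := by linarith
  have hβR : Fintype.card P * (B * A) ≤ β * R := by
    have : β * R = R + Fintype.card P * (B * A) := by
      simp only [β]
      field_simp
    linarith
  refine ⟨β ^ Fintype.card P, (d + 1) * Fintype.card P, by positivity, fun n hn => ?_⟩
  have hn0 : NeZero n := ⟨hn.ne'⟩
  have h1 := langWeight_le_of_split (lang := G.flowLang s j) (ret := G.returnLang s j)
    (ω := fun A : Finset E => ENNReal.ofReal (∏ e ∈ A, c e)) flowLang_zero flowLang_split hret
    (β := ENNReal.ofReal β) (by simpa using ENNReal.ofReal_le_ofReal hβ) (by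
      rw [← ENNReal.ofReal_sum_of_nonneg fun S _ => Finset.prod_nonneg fun e _ => (hc e).le,
        ← ENNReal.ofReal_mul hB, ← ENNReal.ofReal_natCast, ← ENNReal.ofReal_mul (by positivity),
        ← ENNReal.ofReal_mul hβ0]
      exact ENNReal.ofReal_le_ofReal hβR) Finset.univ n
  let 𝒟 : Finset (Finset (E × ZMod n)) := Finset.univ.filter fun D =>
    ∃ F ∈ G.esf j, fold n F = (D : Set (E × ZMod n))
  have hD : ∀ D : 𝒟, ∃ w : G.flowLang s j Finset.univ n, ∃ F, fold n F = (D : Set (E × ZMod n)) ∧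
      (w : List (Finset E)) = word F 0 n := by
    rintro ⟨D, hD⟩
    obtain ⟨F, hF, hFD⟩ := (Finset.mem_filter.1 hD).2
    obtain ⟨nxt, ε, hflow⟩ := exists_isFlow_of_mem_esf hj hs hF 0 (n + (2 * s + 1))
    exact ⟨⟨_, F, nxt, ε, Escaping.of_mem_esf hF, hflow, fun _ _ => Finset.mem_univ _, rfl⟩, F, hFD,
      rfl⟩
  choose w F hFD hw using hD
  have hinj : Function.Injective w := by
    intro D D' heq
    have h2 : word (F D) 0 n = word (F D') 0 n := by rw [← hw, ← hw, heq]
    rw [word_eq_iff, hFD, hFD, Finset.coe_inj] at h2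
    exact Subtype.ext h2
  have h2 : ∑' D : 𝒟, ENNReal.ofReal (∏ x ∈ (D : Finset (E × ZMod n)), c x.1) ≤
      langWeight (fun A : Finset E => ENNReal.ofReal (∏ e ∈ A, c e))
        (G.flowLang s j Finset.univ n) := by
    refine le_trans (le_of_eq (tsum_congr fun D => ?_)) (ENNReal.tsum_comp_le_tsum_of_injective hinj _)
    rw [hw D, wordWeight_word hc (hFD D)]
  rw [Finset.tsum_subtype 𝒟 fun D => ENNReal.ofReal (∏ x ∈ D, c x.1),
    ← ENNReal.ofReal_sum_of_nonneg fun S _ => Finset.prod_nonneg fun e _ => (hc e.1).le] at h2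
  rw [windowSum_eq_sum]
  have h3 := h2.trans h1
  have h4 : ENNReal.ofReal β ^ (Finset.univ : Finset P).card *
      ((n : ENNReal) + 1) ^ ((d + 1) * (Finset.univ : Finset P).card) * ENNReal.ofReal R ^ n =
      ENNReal.ofReal (β ^ Fintype.card P * (n + 1) ^ ((d + 1) * Fintype.card P) * R ^ n) := by
    rw [ENNReal.ofReal_mul (by positivity), ENNReal.ofReal_mul (by positivity),
      ENNReal.ofReal_pow hR.le, ENNReal.ofReal_pow hβ0, ENNReal.ofReal_pow (by positivity),
      Finset.card_univ]
    congr 3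
    rw [ENNReal.ofReal_add (by positivity) zero_le_one]
    simp
  rw [h4] at h3
  exact (ENNReal.ofReal_le_ofReal_iff (by positivity)).1 h3

end PeriodicGraph

/-! ### Conclusion -/

theorem LaurentPolynomial.one_lt_of_mem_rootsAboveOne {f : LaurentPolynomial ℝ} {l : ℝ}
    (hl : l ∈ f.rootsAboveOne) : 1 < l := by
  rw [rootsAboveOne, Multiset.mem_sort] at hl
  exact (Multiset.mem_filter.1 hl).2

theorem LaurentPolynomial.pairwise_rootsAboveOne (f : LaurentPolynomial ℝ) :
    f.rootsAboveOne.Pairwise (· ≤ ·) :=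
  Multiset.pairwise_sort _ _

namespace PeriodicGraph

variable {V E : Type*} [Fintype V] [DecidableEq V] [Fintype E] [DecidableEq E]
  {G : PeriodicGraph V E} {c : E → ℝ}

theorem hasGrowthRate_of_list (hG : G.Annular) (hGn : ∀ (n : ℕ) [NeZero n], (G.power n).Annular)
    (hconn : (G.cover.spanned Set.univ).Connected) (hc : ∀ e, 0 < c e) {L : List ℝ} {a : ℝ}
    (ha : 0 < a) (hL : ∀ l ∈ L, 1 < l) (hLs : L.Pairwise (· ≤ ·))
    (h : G.forestPoly c = Polynomial.C a * Polynomial.X *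
      (L.map fun l => Polynomial.X + Polynomial.C (l + l⁻¹ - 2)).prod) {j : ℕ} (hj : 1 ≤ j)
    (hjL : j ≤ L.length + 1) :
    HasGrowthRate (G.windowSum c j) (Real.log (a * (L.drop (j - 1)).prod)) ∧
      HasGrowthRate (G.crsfSum c j) (Real.log (a * (L.drop (j - 1)).prod)) := by
  have hone : ∀ M : List ℝ, (∀ l ∈ M, 1 < l) → 1 ≤ M.prod := by
    intro M hM
    induction M with
    | nil => simp
    | cons l M ih =>
      rw [List.prod_cons]
      exact one_le_mul_of_one_le_of_one_le (hM l List.mem_cons_self).le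
        (ih fun l hl => hM l (List.mem_cons_of_mem _ hl))
  have hprod : ∀ k, 1 ≤ (L.drop k).prod := fun k =>
    hone _ fun l hl => hL l (List.mem_of_mem_drop hl)
  have hR : 0 < a * (L.drop (j - 1)).prod := mul_pos ha (zero_lt_one.trans_le (hprod _))
  -- All the roots exceed 1, so forests with more components grow no faster. This is why comparison
  -- with CRSFs having at least j components is enough.
  have hmono : ∀ i, j ≤ i → (L.drop (i - 1)).prod ≤ (L.drop (j - 1)).prod := by
    intro i hi
    have h1 : L.drop (i - 1) = (L.drop (j - 1)).drop (i - j) := by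
      rw [List.drop_drop]
      congr 1
      omega
    have h2 := List.prod_take_mul_prod_drop (L.drop (j - 1)) (i - j)
    rw [← h1] at h2
    have h3 : 1 ≤ ((L.drop (j - 1)).take (i - j)).prod :=
      hone _ fun l hl => hL l (List.mem_of_mem_drop (List.mem_of_mem_take hl))
    rw [← h2]
    exact le_mul_of_one_le_left (zero_le_one.trans (hprod _)) h3
  have hsum : ∀ (i n : ℕ) [NeZero n], j ≤ i →
      G.crsfSum c i n ≤ 2 ^ L.length * (a * (L.drop (j - 1)).prod) ^ n := by
    intro i n _ hi
    refine (crsfSum_le_of_list hG (hGn n) ha hL hLs h (hj.trans hi)).trans ?_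
    have h1 := hmono i hi
    have h2 := zero_le_one.trans (hprod (i - 1))
    gcongr
  have hlow := le_crsfSum_of_list hG hGn ha hL h hj hjL
  obtain ⟨B, d, hB, hup⟩ := exists_windowSum_le hc hGn hconn hj hR (by positivity) hsum
  constructor
  · refine HasGrowthRate.of_bounds (A := (1 / 2) ^ (L.drop (j - 1)).length) (B := (B + 1) * 2 ^ d)
      (D := d) hR (by positivity) (by positivity) ?_ ?_
    · filter_upwards [hlow, Filter.eventually_gt_atTop 0] with n hn hn0
      have : NeZero n := ⟨hn0.ne'⟩
      exact hn.trans (crsfSum_le_windowSum (hGn n) hc j)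
    · filter_upwards [Filter.eventually_gt_atTop 0] with n hn0
      refine (hup n hn0).trans (mul_le_mul_of_nonneg_right ?_ (by positivity))
      rw [mul_assoc, ← mul_pow]
      have : (1 : ℝ) ≤ n := by exact_mod_cast hn0
      refine mul_le_mul (by linarith) (pow_le_pow_left₀ (by positivity) (by linarith) d)
        (by positivity) (by linarith)
  · refine HasGrowthRate.of_bounds (A := (1 / 2) ^ (L.drop (j - 1)).length) (B := 2 ^ L.length)
      (D := 0) hR (by positivity) (by positivity) hlow ?_
    filter_upwards [Filter.eventually_gt_atTop 0] with n hn0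
    have : NeZero n := ⟨hn0.ne'⟩
    rw [pow_zero, mul_one]
    exact hsum j n le_rfl

/-- The forests of `𝒢₁` determine the degree, the leading coefficient and the roots of `P`. -/
theorem charPoly_structure (hG : G.Annular) (hGn : ∀ (n : ℕ) [NeZero n], (G.power n).Annular)
    (hconn : (G.cover.spanned Set.univ).Connected) (hc : ∀ e, 0 < c e) :
    (G.charPoly c).degree = ((G.width : ℤ) : WithBot ℤ) ∧
    0 < |(G.charPoly c).coeff (G.width : ℤ)| ∧
    (G.charPoly c).rootsAboveOne.length + 1 = G.width ∧
    G.forestPoly c = Polynomial.C |(G.charPoly c).coeff (G.width : ℤ)| * Polynomial.X *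
      ((G.charPoly c).rootsAboveOne.map
        fun l => Polynomial.X + Polynomial.C (l + l⁻¹ - 2)).prod := by
  have : Nonempty V := hconn.nonempty.map Prod.fst
  have hex : ∃ F, G.Good F := by
    obtain ⟨F, hF, -⟩ := exists_good_subset hG (winds_univ hconn)
    exact ⟨F, hF⟩
  have hm : (G.forestPoly c).natDegree = G.width := by
    rw [natDegree_forestPoly hc hex, width_eq_maxComponents hG hGn hconn]
  have hlead : 0 < (G.forestPoly c).coeff G.width := by
    rw [← hm]
    exact leadingCoeff_forestPoly_pos hc hex
  -- The last member of the chain is a CRSF with a single component; it makes 0 a simple root of the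
  -- forest polynomial.
  have h1 : (G.forestPoly c).coeff 1 ≠ 0 := by
    obtain ⟨B, hB⟩ := hex
    obtain ⟨idx, -, h⟩ := exists_good_chain hG hconn hB
    have hpos := G.numComponents_pos (B : Set E)
    obtain ⟨F, hF, hF1, -⟩ := h (G.base.numComponents (B : Set E) - 1) (by omega)
    exact ((forestPoly_coeff_pos_iff hc).2 ⟨F, hF, by omega⟩).ne'
  obtain ⟨e1, e2, e3, e4⟩ := Polynomial.laurent_of_roots_nonpos hm hlead (forestPoly_coeff_zero c) h1
    (forestPoly_root_nonpos hG hGn hconn hc)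
  rw [← charPoly_eq hG] at e1 e2 e3 e4
  rw [e2]
  exact ⟨e1, hlead, e3, e4⟩

end PeriodicGraph

end

/-- With `m` the width and `P` the characteristic polynomial: `P` has degree `m` (so that its
coefficient of `z ^ m` is the leading one) and exactly `m - 1` real roots `λ_2 ≤ ⋯ ≤ λ_m` larger
than `1`, and the growth rate of the weighted sum of essential spanning forests with `j` components
is `log |C_m| + ∑_{i = j + 1}^m log λ_i`, both for windows of `𝒢` and for the quotients `𝒢_n`. -/
theorem theorem3p2 {V E : Type*} [Fintype V] [DecidableEq V] [Fintype E] [DecidableEq E]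
    (G : PeriodicGraph V E) (hG : G.IsStripGraph) (c : E → ℝ) (hc : ∀ e, 0 < c e) :
    (G.charPoly c).degree = ((G.width : ℤ) : WithBot ℤ) ∧
    (G.charPoly c).rootsAboveOne.length + 1 = G.width ∧
    ∀ j : ℕ, 1 ≤ j → j ≤ G.width →
      HasGrowthRate (G.windowSum c j)
        (Real.log |(G.charPoly c).coeff (G.width : ℤ)| +
          ∑ i ∈ Finset.Icc (j + 1) G.width, Real.log ((G.charPoly c).lam i)) ∧
      HasGrowthRate (G.crsfSum c j)
        (Real.log |(G.charPoly c).coeff (G.width : ℤ)| +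
          ∑ i ∈ Finset.Icc (j + 1) G.width, Real.log ((G.charPoly c).lam i)) := by
  obtain ⟨hconn, ⟨em⟩⟩ := hG
  have hA := PeriodicGraph.annular_of_planarEmbedding em
  have hAn : ∀ (n : ℕ) [NeZero n], (G.power n).Annular := fun n _ =>
    PeriodicGraph.annular_power em
  obtain ⟨hdeg, hpos, hlen, hfac⟩ := PeriodicGraph.charPoly_structure hA hAn hconn hc
  refine ⟨hdeg, hlen, fun j hj hjm => ?_⟩
  have hL : ∀ l ∈ (G.charPoly c).rootsAboveOne, 1 < l := fun l hl =>
    LaurentPolynomial.one_lt_of_mem_rootsAboveOne hl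
  have hlog : Real.log |(G.charPoly c).coeff (G.width : ℤ)| +
      ∑ i ∈ Finset.Icc (j + 1) G.width, Real.log ((G.charPoly c).lam i) =
      Real.log (|(G.charPoly c).coeff (G.width : ℤ)| *
        ((G.charPoly c).rootsAboveOne.drop (j - 1)).prod) := by
    rw [Real.log_mul hpos.ne' (List.prod_pos fun l hl =>
      zero_lt_one.trans (hL l (List.mem_of_mem_drop hl))).ne',
      ← List.log_prod_drop (fun l hl => zero_lt_one.trans (hL l hl)) hj, hlen]
    rfl
  rw [hlog]
  exact PeriodicGraph.hasGrowthRate_of_list hA hAn hconn hc hpos hL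
    (LaurentPolynomial.pairwise_rootsAboveOne _) hfac hj (hlen ▸ hjm)
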